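/- Throughout, $p$ is a prime. A \emph{discrete $p$-torus of rank $r$} is a group isomorphic to $(\mathbb{Z}/p^\infty)^r$ ($r\ge 0$); we then write $\mathrm{rk}=r$. A \emph{discrete $p$-toral group} is a group $S$ containing a discrete $p$-torus $S_0$ as a normal subgroup of $p$-power index; put $|S|=(\mathrm{rk}(S_0),[S:S_0])$, with such pairs ordered lexicographically (all subgroups of $S$ are again discrete $p$-toral). A \emph{fusion system} over $S$ is a category $\mathcal{F}$ whose objects are the subgroups of $S$, where $\mathrm{Hom}_{\mathcal F}(P,Q)$ is a set of injective homomorphisms $P\to Q$ containing all those induced by conjugation in $S$, and where each $\varphi\in\mathrm{Hom}_{\mathcal F}(P,Q)$ satisfies $\varphi\in\mathrm{Hom}_{\mathcal F}(P,\varphi(P))$ and $\varphi^{-1}\in\mathrm{Hom}_{\mathcal F}(\varphi(P),P)$. A subgroup $P\le S$ is \emph{fully normalized} (\emph{fully centralized}) if $|N_S(P)|\ge|N_S(Q)|$ (resp. $|C_S(P)|\ge|C_S(Q)|$) for every $Q$ isomorphic to $P$ in $\mathcal F$; it is \emph{fully automized} if $\mathrm{Out}_{\mathcal F}(P)=\mathrm{Aut}_{\mathcal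 F}(P)/\mathrm{Inn}(P)$ is finite and has the image $\mathrm{Out}_S(P)$ of $\mathrm{Aut}_S(P)$ as a Sylow $p$-subgroup; it is \emph{receptive} if every isomorphism $\varphi\colon Q\to P$ in $\mathcal F$ extends to an element of $\mathrm{Hom}_{\mathcal F}(N_\varphi,S)$, where $N_\varphi=\{g\in N_S(Q)\mid \varphi c_g\varphi^{-1}\in \mathrm{Aut}_S(P)\}$. $\mathcal F$ is \emph{saturated} if fully normalized subgroups are fully automized and fully centralized, fully centralized subgroups are receptive, and, for each increasing sequence $P_1\le P_2\le\cdots$ of subgroups of $S$ with union $P$, each $\varphi\in \mathrm{Hom}(P,S)$ with $\varphi|_{P_i}\in\mathrm{Hom}_{\mathcal F}(P_i,S)$ for all $i$ is in $\mathrm{Hom}_{\mathcal F}(P,S)$. A subgroup $P\le S$ is \emph{normal} in $\mathcal F$ if each $\varphi\in\mathrm{Hom}_{\mathcal F}(Q,R)$ extends to some $\overline\varphi\in\mathrm{Hom}_{\mathcal F}(PQ,PR)$ with $\overline\varphi(P)=P$; $O_p(\mathcal F)$ is the largest subgroup that is normal in $\mathcal F$. \textbf{Proposition 5.7.} Let $p$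 be an odd prime, let $S$ be a nonabelian discrete $p$-toral group with a unique abelian subgroup $A$ of index $p$, and let $\mathcal F$ be a saturated fusion system over $S$. Assume that $A$ is infinite and that $O_p(\mathcal F)=1$. Then $A$ is a discrete $p$-torus. If $\mathrm{rk}(A)\ge p$, then the center $Z(S)$ is also a discrete $p$-torus, of rank $\mathrm{rk}(A)-p+1$. -/

import Mathlib

/-! ### Discrete `p`-tori and discrete `p`-toral groups -/

/-- `ℤ/p^∞`, written multiplicatively: the union, over all `k`, of the cyclic groups of
`p^k`-th roots of unity in the unit circle. -/
abbrev Prufer (p : ℕ) : Type := ↥(CommGroup.primaryComponent Circle p)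

/-- `G` is a discrete `p`-torus of rank `r`, i.e. `G ≅ (ℤ/p^∞)^r`. -/
def IsDiscreteTorusOfRank (p r : ℕ) (G : Type*) [Group G] : Prop :=
  Nonempty (G ≃* (Fin r → Prufer p))

/-- `G` is a discrete `p`-torus. -/
def IsDiscreteTorus (p : ℕ) (G : Type*) [Group G] : Prop :=
  ∃ r : ℕ, IsDiscreteTorusOfRank p r G

/-- `G` has a normal subgroup which is a discrete `p`-torus of rank `r`, and whose index is the
`p`-power `n`. For a discrete `p`-toral group the pair `(r, n)` is uniquely determined. -/
def HasToralSize (p : ℕ) (G : Type*) [Group G] (r n : ℕ) : Prop :=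
  ∃ T : Subgroup G, T.Normal ∧ IsDiscreteTorusOfRank p r T ∧ T.index = n ∧ ∃ k : ℕ, n = p ^ k

/-- `G` is a discrete `p`-toral group: it contains a discrete `p`-torus as a normal subgroup of
`p`-power index. -/
def IsDiscreteToral (p : ℕ) (G : Type*) [Group G] : Prop :=
  ∃ T : Subgroup G, T.Normal ∧ IsDiscreteTorus p T ∧ ∃ k : ℕ, T.index = p ^ k

/-- The relation `|G| ≤ |H|` between discrete `p`-toral groups, where `|G|` is the pair (rank of the
identity component, its index), and such pairs are ordered lexicographically. -/
def ToralSizeLE (p : ℕ) (G H : Type*) [Group G] [Group H] : Prop :=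
  ∃ r n r' n' : ℕ, HasToralSize p G r n ∧ HasToralSize p H r' n' ∧
    (r < r' ∨ (r = r' ∧ n ≤ n'))

/-! ### Fusion systems -/

section Fusion

variable {S : Type*} [Group S]

/-- The homomorphism `P → Q`, `x ↦ g x g⁻¹`, where `g P g⁻¹ ≤ Q`. -/
def conjHom (P Q : Subgroup S) (g : S) (h : ∀ x ∈ P, g * x * g⁻¹ ∈ Q) : P →* Q :=
  ((MulAut.conj g).toMonoidHom.comp P.subtype).codRestrict Q fun x => h x x.2

/-- `ψ : P' → Q'` extends `φ : P → Q`, where `P ≤ P'` (all subgroups of `S`). -/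
def IsExtension {P Q P' Q' : Subgroup S} (ψ : P' →* Q') (φ : P →* Q) : Prop :=
  ∃ h : P ≤ P', ∀ x : P, (ψ (Subgroup.inclusion h x) : S) = (φ x : S)

/-- `Aut_S(P)`: the automorphisms of `P` induced by conjugation by elements of `N_S(P)`. -/
def autS (P : Subgroup S) : Subgroup (MulAut P) := P.normalizerMonoidHom.range

/-- `Inn(P)`. -/
def innS (P : Subgroup S) : Subgroup (MulAut P) := (MulAut.conj : P →* MulAut P).range

instance innS_normal (P : Subgroup S) : (innS P).Normal := by
  constructor
  rintro _ ⟨x, rfl⟩ g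
  refine ⟨g x, ?_⟩
  ext y
  simp

/-- For an isomorphism `φ : Q → P`, the subgroup
`N_φ = {g ∈ N_S(Q) | φ c_g φ⁻¹ ∈ Aut_S(P)}` of `S`. -/
def extender {P Q : Subgroup S} (φ : Q ≃* P) : Subgroup S :=
  (((autS P).comap (MulAut.congr φ).toMonoidHom).comap Q.normalizerMonoidHom).map
    (Subgroup.normalizer (Q : Set S)).subtype

variable (S) in
/-- A fusion system over `S`: a category whose objects are the subgroups of `S`, whose morphisms
are injective homomorphisms including all those induced by conjugation in `S` (in particular all
inclusions), and in which each `φ ∈ Hom(P, Q)` is a morphism `P → φ(P)` whose inverse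
is a morphism `φ(P) → P`. -/
structure FusionSystem where
  Hom : ∀ P Q : Subgroup S, Set (P →* Q)
  injective_of_mem : ∀ {P Q : Subgroup S} {φ : P →* Q}, φ ∈ Hom P Q → Function.Injective φ
  comp_mem : ∀ {P Q R : Subgroup S} {φ : P →* Q} {ψ : Q →* R},
    φ ∈ Hom P Q → ψ ∈ Hom Q R → ψ.comp φ ∈ Hom P R
  conj_mem : ∀ (P Q : Subgroup S) (g : S) (h : ∀ x ∈ P, g * x * g⁻¹ ∈ Q),
    conjHom P Q g h ∈ Hom P Q
  range_mem : ∀ {P Q : Subgroup S} {φ : P →* Q}, φ ∈ Hom P Q →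
    (Q.subtype.comp φ).rangeRestrict ∈ Hom P (Q.subtype.comp φ).range
  symm_mem : ∀ {P Q : Subgroup S} {e : P ≃* Q}, e.toMonoidHom ∈ Hom P Q →
    e.symm.toMonoidHom ∈ Hom Q P

namespace FusionSystem

variable (F : FusionSystem S)

/-- `P` and `Q` are `F`-conjugate (isomorphic in `F`). -/
def IsConj (P Q : Subgroup S) : Prop := ∃ e : P ≃* Q, e.toMonoidHom ∈ F.Hom P Q

/-- `Aut_F(P)`. -/
def aut (P : Subgroup S) : Subgroup (MulAut P) where
  carrier := {α | α.toMonoidHom ∈ F.Hom P P}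
  one_mem' := by
    have h := F.conj_mem P P 1 (by simp)
    have e : conjHom P P 1 (by simp) = MulEquiv.toMonoidHom (1 : MulAut P) := by
      ext x
      simp [conjHom]
    rw [e] at h
    exact h
  mul_mem' := fun ha hb => F.comp_mem hb ha
  inv_mem' := fun ha => F.symm_mem ha

/-- `Out_F(P) = Aut_F(P) / Inn(P)`. -/
abbrev Out (P : Subgroup S) : Type _ := F.aut P ⧸ (innS P).subgroupOf (F.aut P)

/-- `Out_S(P)`, the image of `Aut_S(P)` in `Out_F(P)`. -/
def outS (P : Subgroup S) : Subgroup (F.Out P) :=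
  ((autS P).subgroupOf (F.aut P)).map (QuotientGroup.mk' ((innS P).subgroupOf (F.aut P)))

/-- `P` is fully normalized in `F`: `|N_S(P)| ≥ |N_S(Q)|` for each `Q` that is `F`-conjugate
to `P`. -/
def FullyNormalized (p : ℕ) (P : Subgroup S) : Prop :=
  ∀ Q : Subgroup S, F.IsConj P Q →
    ToralSizeLE p (Subgroup.normalizer (Q : Set S)) (Subgroup.normalizer (P : Set S))

/-- `P` is fully centralized in `F`: `|C_S(P)| ≥ |C_S(Q)|` for each `Q` that is `F`-conjugate
to `P`. -/
def FullyCentralized (p : ℕ) (P : Subgroup S) : Prop :=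
  ∀ Q : Subgroup S, F.IsConj P Q →
    ToralSizeLE p (Subgroup.centralizer (Q : Set S)) (Subgroup.centralizer (P : Set S))

/-- `P` is fully automized in `F`: `Out_F(P)` is finite, with Sylow `p`-subgroup `Out_S(P)`. -/
def FullyAutomized (p : ℕ) (P : Subgroup S) : Prop :=
  Finite (F.Out P) ∧ ∃ T : Sylow p (F.Out P), (T : Subgroup (F.Out P)) = F.outS P

/-- `P` is receptive in `F`: each isomorphism `φ : Q → P` in `F` extends to a morphism
`N_φ → S` in `F`. -/
def Receptive (P : Subgroup S) : Prop :=
  ∀ (Q : Subgroup S) (φ : Q ≃* P), φ.toMonoidHom ∈ F.Hom Q P →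
    ∃ ψ ∈ F.Hom (extender φ) ⊤, IsExtension ψ φ.toMonoidHom

/-- Saturation of a fusion system over a discrete `p`-toral group. (The continuity axiom
holds automatically when `S` is finite.) -/
structure IsSaturated (p : ℕ) : Prop where
  sylow : ∀ P : Subgroup S, F.FullyNormalized p P → F.FullyAutomized p P ∧ F.FullyCentralized p P
  extension : ∀ P : Subgroup S, F.FullyCentralized p P → F.Receptive P
  continuity : ∀ (P : ℕ → Subgroup S), Monotone P →
    ∀ φ : ↥(⨆ i, P i) →* (⊤ : Subgroup S),
      (∀ i, φ.comp (Subgroup.inclusion (le_iSup P i)) ∈ F.Hom (P i) ⊤) →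
        φ ∈ F.Hom (⨆ i, P i) ⊤

/-- `P` is normal in `F`: each `φ ∈ Hom_F(Q, R)` extends to some `ψ ∈ Hom_F(PQ, PR)` with
`ψ(P) = P`. (Taking `φ` to be conjugation on `Q = R = S` one sees that such a `P` is normal in `S`,
so that the join `P ⊔ Q` is the product `PQ`.) -/
def IsNormal (P : Subgroup S) : Prop :=
  ∀ (Q R : Subgroup S), ∀ φ ∈ F.Hom Q R, ∃ ψ ∈ F.Hom (P ⊔ Q) (P ⊔ R),
    IsExtension ψ φ ∧ (P.subgroupOf (P ⊔ Q)).map ((P ⊔ R).subtype.comp ψ) = P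

/-- `O_p(F)`, the largest subgroup of `S` that is normal in `F`. -/
def Op : Subgroup S := sSup {P | F.IsNormal P}

end FusionSystem

end Fusion

/-! ### Divisible abelian `p`-groups with finite socle -/

section Tori

/-! Let T be the identity component of S, let Z = Z(S), and let Z₀ = Z ∩ [A,S], a nontrivial group
of exponent p. Since A has index p, T ≤ A. If T were central it would be normal in the fusion
system, hence trivial, and S would be finite; so T is not central. Consequently every morphism
defined on A is an automorphism of A, and a subgroup R lies in A exactly when T centralizes R.

The fusion-theoretic part establishes two facts. (a) Z₀ has order p (`centerCommCyclic`). (b) Every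
nontrivial subgroup Q ≤ Z invariant under Aut_F(A) contains Z₀, and then Z₀ is a direct factor of Z
(`centerComm_le`). For (a), A is not normal in F, so it is not strongly closed and some element of A
is conjugate to some y ∉ A. For (b), Q is not normal in F, so some element of Q is conjugate to some
y ∉ A. In both cases one studies P = C_S(y) = Z⟨y⟩, an abelian group with |P : Z| = p whose
normalizer meets A in the second center. Either P is conjugate into A, and up to Aut_F(A) such a map
extends to N_S(P), where it embeds (A ∩ Z₂(S))/Z into S/A; or some β ∈ Aut_F(P) carries y into Z. In
the second case Aut_S(P) and its conjugate by β are Sylow subgroups centralizing Z and β(Z). Any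
p-group of automorphisms normalized by both lies in both, so is trivial on Zβ(Z) = P; this forces Z
= Z₀ × (Z ∩ β(Z)).

What remains is module theory for G = Aut_F(A) acting on M = A, with Sylow p-subgroup ⟨u⟩, where u
is conjugation by an element outside A; it is axiomatized in `RigidAction`. With x = u − 1, the norm
1 + u + ⋯ + u^(p−1) equals x^(p−1) + p·v with v invertible because x is locally nilpotent. The norm
kills [M,u], so p is x^(p−1) there up to a unit. Comparison with [T,u] shows that [M,u] is divisible
and M = [M,u] + Z. Let H be the kernel of G on M/pM; it contains u. Transfer over H/⟨u⟩ gives M =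
C_M(H) + pM. Averaging the projection Z → Z₀ over G/⟨u⟩ and using (b) shows that C_M(H) is 0 or Z₀,
so it lies in pM. Hence M is divisible and A = T (`RigidAction.divisible`).

For the center, Y = p^n Z is divisible for large n and M = Y + [M,u]. If Y ∩ [M,u] ≠ 0, then Z₀ ≤ Y
and Z = Y is divisible. Otherwise the trace of the projection M → Y, in the spirit of Green
correspondence, shows that Y has no p-torsion (`socle_complement_eq_zero`); then M has rank p − 1,
against rk(A) ≥ p. Finally x maps the socle of M onto that of [M,u], which has order p^(p−1), with
kernel the socle of Z; this yields the rank. -/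

theorem prufer_isPGroup (p : ℕ) : IsPGroup p (Prufer p) := by
  rintro ⟨x, n, hx⟩
  refine ⟨n, Subtype.ext ?_⟩
  simpa using hx

theorem mem_prufer_of_pow {p : ℕ} {x : Circle} {n : ℕ} (h : x ^ p ^ n = 1) :
    x ∈ CommGroup.primaryComponent Circle p :=
  ⟨n, h⟩

theorem circle_exists_pow_eq (n : ℕ) (hn : n ≠ 0) (x : Circle) : ∃ y : Circle, y ^ n = x := by
  obtain ⟨t, rfl⟩ := Circle.exp_surjective x
  refine ⟨Circle.exp (t / n), ?_⟩
  rw [← Circle.exp_nsmul]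
  congr 1
  simp; field_simp

theorem prufer_exists_pow_eq (p : ℕ) [hp : Fact p.Prime] (x : Prufer p) : ∃ y, y ^ p = x := by
  obtain ⟨y, hy⟩ := circle_exists_pow_eq p hp.out.ne_zero x
  obtain ⟨n, hn⟩ := prufer_isPGroup p x
  have hn' : (x : Circle) ^ p ^ n = 1 := by
    have := congrArg Subtype.val hn
    simpa using this
  refine ⟨⟨y, mem_prufer_of_pow (n := n + 1) ?_⟩, Subtype.ext (by simpa using hy)⟩
  rw [pow_succ', pow_mul, hy, hn']

theorem card_prufer_socle (p : ℕ) [hp : Fact p.Prime] :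
    Nat.card {x : Prufer p // x ^ p = 1} = p := by
  have : NeZero p := ⟨hp.out.ne_zero⟩
  have h1 : Nat.card {x : Circle // x ^ p = 1} = p := by
    have h2 : Nat.card (rootsOfUnity p ℂ) = p := by
      exact HasEnoughRootsOfUnity.natCard_rootsOfUnity ℂ p
    let e : {x : Circle // x ^ p = 1} ≃ rootsOfUnity p ℂ :=
      { toFun := fun x => ⟨Circle.toUnits x.1, by
          rw [mem_rootsOfUnity, ← map_pow, x.2, map_one]⟩
        invFun := fun u => ⟨⟨(u.1 : ℂ), by
            have := Complex.norm_eq_one_of_mem_rootsOfUnity u.2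
            simpa [Submonoid.unitSphere] using this⟩, by
          have := (mem_rootsOfUnity p u.1).1 u.2
          exact Circle.ext ((Circle.coe_pow _ _).trans (by simpa using congrArg Units.val this))⟩
        left_inv := fun x => rfl
        right_inv := fun u => by ext; rfl }
    exact (Nat.card_congr e).trans h2
  let e : {x : Prufer p // x ^ p = 1} ≃ {x : Circle // x ^ p = 1} :=
    { toFun := fun x => ⟨x.1.1, by rw [← SubmonoidClass.coe_pow, x.2]; rfl⟩
      invFun := fun x => ⟨⟨x.1, mem_prufer_of_pow (n := 1) (by rw [pow_one, x.2])⟩,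
        Subtype.ext x.2⟩
      left_inv := fun x => rfl
      right_inv := fun x => rfl }
  exact (Nat.card_congr e).trans h1

theorem IsDiscreteTorusOfRank.mul_comm {p r : ℕ} {M : Type*} [Group M]
    (h : IsDiscreteTorusOfRank p r M) (x y : M) : x * y = y * x := by
  obtain ⟨e⟩ := h
  apply e.injective
  rw [map_mul, map_mul, _root_.mul_comm]

theorem IsDiscreteTorusOfRank.isPGroup {p r : ℕ} {M : Type*} [Group M]
    (h : IsDiscreteTorusOfRank p r M) : IsPGroup p M := by
  obtain ⟨e⟩ := h
  intro x
  choose n hn using fun i => prufer_isPGroup p (e x i)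
  refine ⟨∑ i, n i, e.injective ?_⟩
  rw [map_pow, map_one]
  ext1 i
  obtain ⟨k, hk⟩ : ∃ k, ∑ i, n i = n i + k :=
    Nat.exists_eq_add_of_le (Finset.single_le_sum (fun _ _ => Nat.zero_le _) (Finset.mem_univ i))
  rw [Pi.pow_apply, hk, pow_add, pow_mul, hn, one_pow]
  rfl

theorem IsDiscreteTorusOfRank.exists_pow_eq {p r : ℕ} [hp : Fact p.Prime] {M : Type*} [Group M]
    (h : IsDiscreteTorusOfRank p r M) (x : M) : ∃ y, y ^ p = x := by
  obtain ⟨e⟩ := h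
  choose f hf using fun i => prufer_exists_pow_eq p (e x i)
  refine ⟨e.symm f, e.injective ?_⟩
  rw [map_pow, e.apply_symm_apply]
  ext1 i
  exact hf i

theorem IsDiscreteTorusOfRank.card_socle {p r : ℕ} [hp : Fact p.Prime] {M : Type*} [Group M]
    (h : IsDiscreteTorusOfRank p r M) : Nat.card {x : M // x ^ p = 1} = p ^ r := by
  obtain ⟨e⟩ := h
  have e1 : {x : M // x ^ p = 1} ≃ (Fin r → {x : Prufer p // x ^ p = 1}) :=
    { toFun := fun x i => ⟨e x.1 i, by
        rw [← Pi.pow_apply, ← map_pow, x.2, map_one]; rfl⟩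
      invFun := fun f => ⟨e.symm fun i => (f i).1, by
        rw [← map_pow]
        have : (fun i => ((f i).1 : Prufer p)) ^ p = 1 := by
          ext1 i; exact (f i).2
        rw [this, map_one]⟩
      left_inv := fun x => by ext; simp
      right_inv := fun f => by ext; simp }
  rw [Nat.card_congr e1, Nat.card_fun, card_prufer_socle, Nat.card_fin]

/-- A divisible subgroup of an abelian `p`-group containing the socle is everything. -/
theorem eq_top_of_socle_le {p : ℕ} {M : Type*} [CommGroup M] (hM : IsPGroup p M) (D : Subgroup M)
    (hD : ∀ d ∈ D, ∃ e ∈ D, e ^ p = d) (hs : ∀ x : M, x ^ p = 1 → x ∈ D) : D = ⊤ := by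
  rw [eq_top_iff]
  have key : ∀ n : ℕ, ∀ x : M, x ^ p ^ n = 1 → x ∈ D := by
    intro n
    induction n with
    | zero => intro x hx; rw [pow_zero, pow_one] at hx; rw [hx]; exact D.one_mem
    | succ n ih =>
      intro x hx
      have h1 : x ^ p ∈ D := ih _ (by rw [← pow_mul, ← pow_succ', hx])
      obtain ⟨e, he, hep⟩ := hD _ h1
      have h2 : x * e⁻¹ ∈ D := hs _ (by rw [mul_pow, inv_pow, hep, mul_inv_cancel])
      simpa using D.mul_mem h2 he
  intro x _
  obtain ⟨n, hn⟩ := hM x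
  exact key n x hn

/-- A nontrivial kernel in a p-group contains an element of order p. -/
theorem injective_of_socle {p : ℕ} {M N : Type*} [CommGroup M] [Group N] (hM : IsPGroup p M)
    (f : M →* N) (hf : ∀ x, x ^ p = 1 → f x = 1 → x = 1) : Function.Injective f := by
  rw [injective_iff_map_eq_one]
  have key : ∀ n : ℕ, ∀ x : M, x ^ p ^ n = 1 → f x = 1 → x = 1 := by
    intro n
    induction n with
    | zero => intro x hx _; simpa using hx
    | succ n ih =>
      intro x hx h1
      have h2 : x ^ p = 1 :=
        ih _ (by rw [← pow_mul, ← pow_succ', hx]) (by rw [map_pow, h1, one_pow])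
      exact hf x h2 h1
  intro x hx
  obtain ⟨n, hn⟩ := hM x
  exact key n x hn hx

theorem exists_linearEquiv_of_card {p r : ℕ} [hp : Fact p.Prime] {V W : Type*} [AddCommGroup V]
    [AddCommGroup W] [Module (ZMod p) V] [Module (ZMod p) W] [Finite V] [Finite W]
    (cV : Nat.card V = p ^ r) (cW : Nat.card W = p ^ r) : Nonempty (V ≃ₗ[ZMod p] W) := by
  have h1 := Module.natCard_eq_pow_finrank (K := ZMod p) (V := V)
  have h2 := Module.natCard_eq_pow_finrank (K := ZMod p) (V := W)
  rw [Nat.card_zmod] at h1 h2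
  refine ⟨LinearEquiv.ofFinrankEq V W (Nat.pow_right_injective hp.out.two_le ?_)⟩
  change p ^ _ = p ^ _
  rw [← h1, ← h2, cV, cW]

theorem exists_socle_equiv {p r : ℕ} [hp : Fact p.Prime] {M N : Type*} [CommGroup M] [CommGroup N]
    (hM : ∀ x : M, x ^ p = 1) (hN : ∀ x : N, x ^ p = 1)
    (cM : Nat.card M = p ^ r) (cN : Nat.card N = p ^ r) : Nonempty (M ≃* N) := by
  have pos : 0 < p ^ r := pow_pos hp.out.pos r
  have : Finite (Additive M) := Nat.finite_of_card_ne_zero (α := M) (by omega)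
  have : Finite (Additive N) := Nat.finite_of_card_ne_zero (α := N) (by omega)
  let iM : Module (ZMod p) (Additive M) := AddCommGroup.zmodModule (fun x => hM x.toMul)
  let iN : Module (ZMod p) (Additive N) := AddCommGroup.zmodModule (fun x => hN x.toMul)
  obtain ⟨e⟩ := exists_linearEquiv_of_card (p := p) (r := r) (V := Additive M) (W := Additive N)
    cM cN
  exact ⟨AddEquiv.toMultiplicative e.toAddEquiv⟩

theorem exists_pow_eq_of_prime {p : ℕ} [hp : Fact p.Prime] {M : Type*} [CommGroup M]
    (hM : IsPGroup p M) (hd : ∀ x : M, ∃ y, y ^ p = x) (n : ℕ) (hn : n ≠ 0) (x : M) :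
    ∃ y, y ^ n = x := by
  have hpow : ∀ k : ℕ, ∀ x : M, ∃ y, y ^ p ^ k = x := by
    intro k
    induction k with
    | zero => intro x; exact ⟨x, by simp⟩
    | succ k ih =>
      intro x
      obtain ⟨y, hy⟩ := ih x
      obtain ⟨z, hz⟩ := hd y
      exact ⟨z, by rw [pow_succ', pow_mul, hz, hy]⟩
  obtain ⟨k, m, hm, rfl⟩ := Nat.exists_eq_pow_mul_and_not_dvd hn p hp.out.ne_one
  obtain ⟨y, rfl⟩ := hpow k x
  obtain ⟨j, hj⟩ := hM y
  have hc : Nat.Coprime (p ^ j) m := Nat.Coprime.pow_left _ ((hp.out.coprime_iff_not_dvd).2 hm)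
  have hc' : (orderOf y).Coprime m := Nat.Coprime.of_dvd_left (orderOf_dvd_of_pow_eq_one hj) hc
  obtain ⟨l, hl⟩ := exists_pow_eq_self_of_coprime hc'.symm
  exact ⟨y ^ l, by
    rw [← pow_mul, show l * (p ^ k * m) = m * l * p ^ k by ring, pow_mul, pow_mul, hl]⟩

/-- An isomorphism of socles extends to a homomorphism into (ℤ/p^∞)^r because the target is
divisible, hence injective over ℤ. It is injective since it is so on the socle, and surjective since
its image is divisible and contains the socle. -/
theorem isDiscreteTorusOfRank_of_divisible {p : ℕ} [hp : Fact p.Prime] {M : Type*} [CommGroup M]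
    (hM : IsPGroup p M) (hd : ∀ x : M, ∃ y, y ^ p = x) {r : ℕ}
    (hr : Nat.card {x : M // x ^ p = 1} = p ^ r) : IsDiscreteTorusOfRank p r M := by
  let N := Fin r → Prufer p
  have hN : IsDiscreteTorusOfRank p r N := ⟨MulEquiv.refl _⟩
  let Ms : Subgroup M := (powMonoidHom p : M →* M).ker
  let Ns : Subgroup N := (powMonoidHom p : N →* N).ker
  have memM : ∀ x, x ∈ Ms ↔ x ^ p = 1 := fun x => by simp [Ms, MonoidHom.mem_ker]
  have memN : ∀ x, x ∈ Ns ↔ x ^ p = 1 := fun x => by simp only [Ns, MonoidHom.mem_ker]; rfl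
  obtain ⟨e⟩ : Nonempty (Ms ≃* Ns) := by
    refine exists_socle_equiv (p := p) (r := r) (fun x => Subtype.ext ((memM _).1 x.2))
      (fun x => Subtype.ext ((memN _).1 x.2)) ?_ ?_
    · rw [← hr]; exact Nat.card_congr (Equiv.subtypeEquivRight memM)
    · rw [← hN.card_socle]; exact Nat.card_congr (Equiv.subtypeEquivRight memN)
  let : DivisibleBy (Additive N) ℕ := divisibleByOfSMulRightSurj (Additive N) ℕ (by
    intro n hn x
    obtain ⟨y, hy⟩ := exists_pow_eq_of_prime hN.isPGroup hN.exists_pow_eq n hn x.toMul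
    exact ⟨Additive.ofMul y, hy⟩)
  let : DivisibleBy (Additive N) ℤ := AddGroup.divisibleByIntOfDivisibleByNat (Additive N)
  obtain ⟨h, hh⟩ := (Module.Baer.of_divisible (Additive N)).extension_property
    (MonoidHom.toAdditive Ms.subtype).toIntLinearMap
    (by intro x y hxy; exact Subtype.ext hxy)
    (MonoidHom.toAdditive (Ns.subtype.comp e.toMonoidHom)).toIntLinearMap
  let f : M →* N := AddMonoidHom.toMultiplicative h.toAddMonoidHom
  have hf : ∀ x : Ms, f x = (e x : N) := fun x => LinearMap.congr_fun hh (Additive.ofMul x)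
  have finj : Function.Injective f := by
    refine injective_of_socle hM f fun x hx h1 => ?_
    have h2 := hf ⟨x, (memM x).2 hx⟩
    change f x = _ at h2
    rw [h1] at h2
    have h3 : e ⟨x, (memM x).2 hx⟩ = 1 := Subtype.ext h2.symm
    rw [map_eq_one_iff e e.injective] at h3
    exact congrArg Subtype.val h3
  have fsurj : f.range = ⊤ := by
    refine eq_top_of_socle_le hN.isPGroup _ ?_ ?_
    · rintro _ ⟨x, rfl⟩
      obtain ⟨y, rfl⟩ := hd x
      exact ⟨f y, ⟨y, rfl⟩, (map_pow f y p).symm⟩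
    · intro x hx
      refine ⟨e.symm ⟨x, (memN x).2 hx⟩, ?_⟩
      rw [hf, e.apply_symm_apply]
  exact ⟨MulEquiv.ofBijective f ⟨finj, MonoidHom.range_eq_top.1 fsurj⟩⟩

/-- Induction: the fibres of x ↦ x^(p^n), from the p^(n+1)-torsion to the socle, are translates of
subsets of the p^n-torsion. -/
theorem finite_torsion {p : ℕ} {M : Type*} [CommGroup M] (hfin : Finite {x : M // x ^ p = 1})
    (n : ℕ) : Finite {x : M // x ^ p ^ n = 1} := by
  induction n with
  | zero => 
    have : Subsingleton {x : M // x ^ p ^ 0 = 1} :=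
      ⟨fun x y => Subtype.ext (by simpa using x.2.trans y.2.symm)⟩
    infer_instance
  | succ n ih =>
    let f : {x : M // x ^ p ^ (n + 1) = 1} → {x : M // x ^ p = 1} :=
      fun x => ⟨x.1 ^ p ^ n, by rw [← pow_mul, ← pow_succ, x.2]⟩
    refine Set.finite_univ_iff.1 (Set.Finite.preimage' (f := f) (Set.toFinite Set.univ) fun y _ => ?_)
    by_cases h : ∃ x, f x = y
    · obtain ⟨x, hx⟩ := h
      refine Set.Finite.subset (Set.Finite.preimage (f := fun z : {x : M // x ^ p ^ (n + 1) = 1} =>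
        z.1 * x.1⁻¹) ?_ (show ({x : M | x ^ p ^ n = 1} : Set M).Finite from ih)) ?_
      · intro a _ b _ hab
        exact Subtype.ext (mul_right_cancel hab)
      · intro z hz
        have h1 : f z = f x := hz.trans hx.symm
        have h2 : z.1 ^ p ^ n = x.1 ^ p ^ n := congrArg Subtype.val h1
        simp only [Set.mem_preimage, Set.mem_ofPred_eq]
        rw [mul_pow, inv_pow, h2, mul_inv_cancel]
    · convert Set.finite_empty
      ext z
      simp only [Set.mem_preimage, Set.mem_singleton_iff, Set.mem_empty_iff_false, iff_false]
      exact fun hz => h ⟨z, hz⟩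

/-- An abelian `p`-group with finite socle has a divisible subgroup of the form `M ^ (p ^ n)`. -/
theorem exists_divisible_range {p : ℕ} {M : Type*} [CommGroup M] (hM : IsPGroup p M)
    (hfin : Finite {x : M // x ^ p = 1}) :
    ∃ n : ℕ, ∀ x : M, ∃ y : M, (y ^ p ^ n) ^ p = x ^ p ^ n := by
  -- The socles of the groups M^(p^n) decrease inside a finite set, so they stabilize at some n.
  let s : ℕ → Set M := fun n => {x : M | x ^ p = 1 ∧ ∃ y : M, y ^ p ^ n = x}
  have hs : ∀ n, (s n).Finite := fun n =>
    Set.Finite.subset (s := {x : M | x ^ p = 1}) hfin fun x hx => hx.1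
  have hanti : Antitone s := by
    refine antitone_nat_of_succ_le fun n x hx => ⟨hx.1, ?_⟩
    obtain ⟨y, hy⟩ := hx.2
    exact ⟨y ^ p, by rw [← pow_mul, ← pow_succ', hy]⟩
  obtain ⟨n, hn⟩ : ∃ n, ∀ m, n ≤ m → s m = s n := by
    obtain ⟨n, hn⟩ := WellFounded.has_min (measure fun n => (s n).ncard).wf Set.univ ⟨0, trivial⟩
    refine ⟨n, fun m hm => Set.eq_of_subset_of_ncard_le (hanti hm) ?_ (hs n)⟩
    exact not_lt.1 (hn.2 m trivial)
  refine ⟨n, ?_⟩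
  have key : ∀ k : ℕ, ∀ x : M, (x ^ p ^ n) ^ p ^ k = 1 → ∃ y : M, (y ^ p ^ n) ^ p = x ^ p ^ n := by
    intro k
    induction k with
    | zero => intro x hx; exact ⟨1, by rw [pow_zero, pow_one] at hx; simp [hx]⟩
    | succ k ih =>
      intro x hx
      have h1 : (x ^ p ^ n) ^ p ^ k ∈ s n := by
        refine ⟨by rw [← pow_mul, ← pow_succ, hx], x ^ p ^ k, ?_⟩
        rw [← pow_mul, ← pow_mul, mul_comm]
      rw [← hn (n + k + 1) (by omega)] at h1
      obtain ⟨-, z, hz⟩ := h1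
      -- By stability, (x^(p^n))^(p^k) is a p^(n+k+1)-th power of some z; dividing x by z^p lowers
      -- the exponent of x^(p^n) by one factor of p.
      obtain ⟨y, hy⟩ := ih (x * (z ^ p)⁻¹) (by
        rw [mul_pow, mul_pow, ← hz, inv_pow, inv_pow, ← pow_mul, ← pow_mul,
          show p * (p ^ n * p ^ k) = p ^ (n + k + 1) by ring, mul_inv_cancel])
      refine ⟨y * z, ?_⟩
      rw [mul_pow, mul_pow, hy, mul_pow, inv_pow, ← pow_mul, ← pow_mul, mul_comm p, 
        inv_mul_cancel_right]
  intro x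
  obtain ⟨k, hk⟩ := hM (x ^ p ^ n)
  exact key k x hk

end Tori

/-! ### Sizes of subgroups of a discrete `p`-toral group -/

section Sizes

/-- `T` is a normal discrete `p`-torus of rank `r` and of `p`-power index in `S`. -/
structure IsToralPair (p : ℕ) {S : Type*} [Group S] (T : Subgroup S) (r : ℕ) : Prop where
  normal : T.Normal
  torus : IsDiscreteTorusOfRank p r T
  index : ∃ k : ℕ, T.index = p ^ k

/-- Every element of the subgroup `E` has a `p`-th root in `E`. -/
def PDivisible (p : ℕ) {S : Type*} [Group S] (E : Subgroup S) : Prop :=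
  ∀ d ∈ E, ∃ e ∈ E, e ^ p = d

/-- `D` is a normal discrete `p`-torus of rank `r` and of index `n` (a power of `p`) in `K`. -/
structure IsComponent (p : ℕ) {S : Type*} [Group S] (K D : Subgroup S) (r n : ℕ) : Prop where
  le : D ≤ K
  normal : (D.subgroupOf K).Normal
  torus : IsDiscreteTorusOfRank p r D
  relIndex : D.relIndex K = n
  pow : ∃ k : ℕ, n = p ^ k

variable {p : ℕ} [hp : Fact p.Prime] {S : Type*} [Group S]

theorem IsDiscreteTorusOfRank.of_equiv {p r : ℕ} {M N : Type*} [Group M] [Group N]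
    (h : IsDiscreteTorusOfRank p r M) (e : M ≃* N) : IsDiscreteTorusOfRank p r N := by
  obtain ⟨f⟩ := h
  exact ⟨e.symm.trans f⟩

theorem IsDiscreteTorusOfRank.pDivisible {r : ℕ} {D : Subgroup S}
    (h : IsDiscreteTorusOfRank p r D) : PDivisible p D := by
  intro d hd
  obtain ⟨y, hy⟩ := h.exists_pow_eq ⟨d, hd⟩
  exact ⟨y, y.2, by simpa using congrArg Subtype.val hy⟩

theorem PDivisible.exists_pow {E : Subgroup S} (h : PDivisible p E) (k : ℕ) :
    ∀ d ∈ E, ∃ e ∈ E, e ^ p ^ k = d := by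
  induction k with
  | zero => intro d hd; exact ⟨d, hd, by simp⟩
  | succ k ih =>
    intro d hd
    obtain ⟨y, hy, rfl⟩ := ih d hd
    obtain ⟨z, hz, rfl⟩ := h y hy
    exact ⟨z, hz, by rw [pow_succ', pow_mul]⟩

theorem hasToralSize_iff {K : Subgroup S} {r n : ℕ} :
    HasToralSize p K r n ↔ ∃ D, IsComponent p K D r n := by
  constructor
  · rintro ⟨T, hT, hr, hn, hk⟩
    have e : (T.map K.subtype).subgroupOf K = T :=
      Subgroup.comap_map_eq_self_of_injective K.subtype_injective T
    exact ⟨T.map K.subtype, Subgroup.map_subtype_le T, by rw [e]; exact hT,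
      hr.of_equiv (T.equivMapOfInjective _ K.subtype_injective),
      by rw [Subgroup.relIndex, e, hn], hk⟩
  · rintro ⟨D, h⟩
    exact ⟨D.subgroupOf K, h.normal, h.torus.of_equiv (Subgroup.subgroupOfEquivOfLe h.le).symm,
      h.relIndex, h.pow⟩

/-- A discrete `p`-torus is contained in every subgroup which meets it in finite index. -/
theorem IsDiscreteTorusOfRank.le_of_relIndex_ne_zero {r : ℕ} {E H : Subgroup S}
    (h : IsDiscreteTorusOfRank p r E) (hi : H.relIndex E ≠ 0) : E ≤ H := by
  let iE : CommGroup E := { (inferInstance : Group E) with mul_comm := h.mul_comm }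
  intro e he
  obtain ⟨f, hf⟩ := exists_pow_eq_of_prime (M := E) h.isPGroup h.exists_pow_eq _ hi ⟨e, he⟩
  have h1 : f ^ (H.subgroupOf E).index ∈ H.subgroupOf E := by
    have : (H.subgroupOf E).Normal := inferInstance
    exact Subgroup.pow_index_mem _ f
  have h2 : f ^ (H.subgroupOf E).index = ⟨e, he⟩ := hf
  rw [h2, Subgroup.mem_subgroupOf] at h1
  exact h1

theorem IsComponent.unique {K D D' : Subgroup S} {r n r' n' : ℕ} (h : IsComponent p K D r n)
    (h' : IsComponent p K D' r' n') : D = D' := by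
  have aux : ∀ {D D' : Subgroup S} {r n r' n' : ℕ} (_ : IsComponent p K D r n)
    (_ : IsComponent p K D' r' n'), D ≤ D' := by
    intro D D' r n r' n' h h'
    refine h.torus.le_of_relIndex_ne_zero fun h0 => ?_
    have h2 := Subgroup.relIndex_eq_zero_of_le_right h.le h0
    rw [h'.relIndex] at h2
    obtain ⟨k, rfl⟩ := h'.pow
    exact pow_ne_zero k hp.out.ne_zero h2
  exact le_antisymm (aux h h') (aux h' h)

theorem IsDiscreteTorusOfRank.finite_socle {r : ℕ} {M : Type*} [Group M]
    (h : IsDiscreteTorusOfRank p r M) : Finite {x : M // x ^ p = 1} :=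
  Nat.finite_of_card_ne_zero (by rw [h.card_socle]; exact pow_ne_zero _ hp.out.ne_zero)

theorem rank_unique {r r' : ℕ} {M : Type*} [Group M]
    (h : IsDiscreteTorusOfRank p r M) (h' : IsDiscreteTorusOfRank p r' M) : r = r' :=
  Nat.pow_right_injective hp.out.two_le (h.card_socle.symm.trans h'.card_socle)

theorem rank_le_of_le {r r' : ℕ} {D E : Subgroup S} (hD : IsDiscreteTorusOfRank p r D)
    (hE : IsDiscreteTorusOfRank p r' E) (hle : D ≤ E) : r ≤ r' := by
  have := hE.finite_socle
  have h : Nat.card {x : D // x ^ p = 1} ≤ Nat.card {x : E // x ^ p = 1} := by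
    refine Nat.card_le_card_of_injective
      (fun x => ⟨Subgroup.inclusion hle x.1, by rw [← map_pow, x.2, map_one]⟩) ?_
    intro x y hxy
    exact Subtype.ext (Subgroup.inclusion_injective hle (congrArg Subtype.val hxy))
  rw [hD.card_socle, hE.card_socle] at h
  exact (Nat.pow_le_pow_iff_right hp.out.one_lt).1 h

theorem eq_of_rank_eq {r : ℕ} {D E : Subgroup S} (hD : IsDiscreteTorusOfRank p r D)
    (hE : IsDiscreteTorusOfRank p r E) (hle : D ≤ E) : D = E := by
  have := hE.finite_socle
  have h : Function.Bijective (fun x : {x : D // x ^ p = 1} =>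
      (⟨Subgroup.inclusion hle x.1, by rw [← map_pow, x.2, map_one]⟩ : {x : E // x ^ p = 1})) := by
    refine (Nat.bijective_iff_injective_and_card _).2 ⟨?_, by rw [hD.card_socle, hE.card_socle]⟩
    intro x y hxy
    exact Subtype.ext (Subgroup.inclusion_injective hle (congrArg Subtype.val hxy))
  let iE : CommGroup E := { (inferInstance : Group E) with mul_comm := hE.mul_comm }
  have key : D.subgroupOf E = ⊤ := by
    refine eq_top_of_socle_le (p := p) hE.isPGroup _ ?_ ?_
    · rintro d hd
      obtain ⟨e, he, h2⟩ := hD.pDivisible d (Subgroup.mem_subgroupOf.1 hd)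
      exact ⟨⟨e, hle he⟩, Subgroup.mem_subgroupOf.2 he, Subtype.ext (by simpa using h2)⟩
    · intro x hx
      obtain ⟨y, hy⟩ := h.2 ⟨x, hx⟩
      have : Subgroup.inclusion hle y.1 = x := congrArg Subtype.val hy
      rw [← this, Subgroup.mem_subgroupOf]
      exact y.1.2
  exact le_antisymm hle (Subgroup.subgroupOf_eq_top.1 key)

namespace IsToralPair

variable {T : Subgroup S} {r : ℕ}

theorem index_ne_zero (h : IsToralPair p T r) : T.index ≠ 0 := by
  obtain ⟨k, hk⟩ := h.index
  rw [hk]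
  exact pow_ne_zero k hp.out.ne_zero

theorem isPGroup (h : IsToralPair p T r) : IsPGroup p S := by
  intro s
  have := h.normal
  obtain ⟨k, hk⟩ := h.index
  have h1 : s ^ p ^ k ∈ T := hk ▸ Subgroup.pow_index_mem T s
  obtain ⟨n, hn⟩ := h.torus.isPGroup ⟨_, h1⟩
  refine ⟨k + n, ?_⟩
  rw [pow_add, pow_mul]
  simpa using congrArg Subtype.val hn

theorem le_of_pDivisible (h : IsToralPair p T r) {E : Subgroup S} (hE : PDivisible p E) :
    E ≤ T := by
  intro e he
  have := h.normal
  obtain ⟨k, hk⟩ := h.index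
  obtain ⟨f, -, rfl⟩ := hE.exists_pow k e he
  exact hk ▸ Subgroup.pow_index_mem T f

/-- K ∩ T is abelian with finite socle, so some power subgroup of it is divisible, of finite index,
and hence a torus. This gives every subgroup a size. -/
theorem exists_component (h : IsToralPair p T r) (K : Subgroup S) :
    ∃ D r' n, IsComponent p K D r' n ∧ D ≤ T := by
  have hTn := h.normal
  let M : Subgroup S := K ⊓ T
  let iM : CommGroup M := { (inferInstance : Group M) with
    mul_comm := fun x y => Subtype.ext (by
      simpa using congrArg Subtype.val (h.torus.mul_comm ⟨x, x.2.2⟩ ⟨y, y.2.2⟩)) }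
  have hM : IsPGroup p M := h.isPGroup.to_subgroup M
  have hfin : Finite {x : M // x ^ p = 1} := by
    have := h.torus.finite_socle
    refine Finite.of_injective (β := {x : T // x ^ p = 1})
      (fun x => ⟨⟨x.1, x.1.2.2⟩, Subtype.ext (by simpa using congrArg Subtype.val x.2)⟩) ?_
    intro x y hxy
    have := congrArg (fun z : {x : T // x ^ p = 1} => (z.1 : S)) hxy
    exact Subtype.ext (Subtype.ext this)
  obtain ⟨n, hn⟩ := exists_divisible_range hM hfin
  let D' : Subgroup M := (powMonoidHom (p ^ n) : M →* M).range
  have hD'div : ∀ x : D', ∃ y, y ^ p = x := by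
    rintro ⟨_, x, rfl⟩
    obtain ⟨y, hy⟩ := hn x
    exact ⟨⟨y ^ p ^ n, y, rfl⟩, Subtype.ext hy⟩
  have hD'fin : Finite (M ⧸ D') := by
    have := finite_torsion hfin n
    refine Finite.of_surjective
      (fun x : {x : M // x ^ p ^ n = 1} => (QuotientGroup.mk x.1 : M ⧸ D')) ?_
    rintro ⟨x⟩
    have key : ∀ k : ℕ, ∃ y : M, (y ^ p ^ k) ^ p ^ n = x ^ p ^ n := by
      intro k
      induction k with
      | zero => exact ⟨x, by simp⟩
      | succ k ih =>
        obtain ⟨y, hy⟩ := ih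
        obtain ⟨z, hz⟩ := hn y
        refine ⟨z, ?_⟩
        rw [← hy, ← pow_mul, ← pow_mul, show p ^ (k + 1) * p ^ n = p ^ n * p * p ^ k by ring,
          pow_mul, pow_mul, hz, ← pow_mul, mul_comm (p ^ n)]
    obtain ⟨y, hy⟩ := key n
    refine ⟨⟨x * (y ^ p ^ n)⁻¹, by rw [mul_pow, inv_pow, hy, mul_inv_cancel]⟩, ?_⟩
    refine QuotientGroup.eq.2 ⟨y, ?_⟩
    change y ^ p ^ n = _
    group
  obtain ⟨s, hs⟩ : ∃ s, Nat.card {x : D' // x ^ p = 1} = p ^ s := by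
    have : Finite {x : D' // x ^ p = 1} := by
      refine Finite.of_injective (β := {x : M // x ^ p = 1})
        (fun x => ⟨x.1, by simpa using congrArg Subtype.val x.2⟩) ?_
      intro x y hxy
      have h1 : (x.1 : M) = y.1 := congrArg (fun z : {x : M // x ^ p = 1} => (z : M)) hxy
      exact Subtype.ext (Subtype.ext h1)
    let N : Subgroup D' := (powMonoidHom p : D' →* D').ker
    have e : {x : D' // x ^ p = 1} ≃ N := Equiv.subtypeEquivRight fun x => Iff.rfl
    have : Finite N := Finite.of_equiv _ e
    obtain ⟨s, hs⟩ := IsPGroup.iff_card.1 ((hM.to_subgroup D').to_subgroup N)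
    exact ⟨s, (Nat.card_congr e).trans hs⟩
  have hD't := isDiscreteTorusOfRank_of_divisible (hM.to_subgroup D') hD'div hs
  let D : Subgroup S := D'.map M.subtype
  have hDM : D ≤ M := Subgroup.map_subtype_le D'
  have hDM' : D.subgroupOf M = D' := Subgroup.comap_map_eq_self_of_injective M.subtype_injective D'
  have hDnorm : (D.subgroupOf K).Normal := by
    refine ⟨fun x hx g => ?_⟩
    obtain ⟨_, ⟨y, rfl⟩, hy⟩ := Subgroup.mem_subgroupOf.1 hx
    refine Subgroup.mem_subgroupOf.2 ⟨_, ⟨⟨g * y * (g : S)⁻¹, ?_⟩, rfl⟩, ?_⟩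
    · exact ⟨K.mul_mem (K.mul_mem g.2 y.2.1) (K.inv_mem g.2), hTn.conj_mem _ y.2.2 _⟩
    · have hy' : (y : S) ^ p ^ n = x := hy
      change ((g : S) * y * (g : S)⁻¹) ^ p ^ n = g * x * (g : S)⁻¹
      rw [conj_pow, hy']
  have hne : D.relIndex K ≠ 0 := by
    rw [← Subgroup.relIndex_mul_relIndex D M K hDM inf_le_left]
    refine mul_ne_zero ?_ ?_
    · rw [Subgroup.relIndex, hDM']
      exact Subgroup.index_ne_zero_of_finite
    · rw [show M = K ⊓ T from rfl, Subgroup.inf_relIndex_left]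
      exact fun h0 => h.index_ne_zero (Subgroup.index_eq_zero_of_relIndex_eq_zero h0)
  have : (D.subgroupOf K).FiniteIndex := ⟨hne⟩
  obtain ⟨j, hj⟩ := (h.isPGroup.to_subgroup K).index (D.subgroupOf K)
  exact ⟨D, s, p ^ j, ⟨hDM.trans inf_le_left, hDnorm,
    hD't.of_equiv (D'.equivMapOfInjective _ M.subtype_injective), hj, j, rfl⟩,
    hDM.trans inf_le_right⟩

theorem isComponent (h : IsToralPair p T r) {K : Subgroup S} (hK : T ≤ K) :
    IsComponent p K T r (T.relIndex K) := by
  have hn := h.normal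
  obtain ⟨k, hk⟩ := h.index
  refine ⟨hK, inferInstance, h.torus, rfl, ?_⟩
  have h1 := Subgroup.relIndex_dvd_index_of_normal T K
  rw [hk] at h1
  obtain ⟨j, -, hj⟩ := (Nat.dvd_prime_pow hp.out).1 h1
  exact ⟨j, hj⟩

/-- The rank of T is the largest possible, and a subgroup reaching it contains T; only then do the
indices need comparison. -/
theorem toralSizeLE (h : IsToralPair p T r) {H K : Subgroup S} (hK : T ≤ K)
    (hHK : T ≤ H → T.relIndex H ≤ T.relIndex K) : ToralSizeLE p H K := by
  obtain ⟨D, r', n', hD, hDT⟩ := h.exists_component H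
  refine ⟨r', n', r, _, hasToralSize_iff.2 ⟨D, hD⟩, hasToralSize_iff.2 ⟨T, h.isComponent hK⟩, ?_⟩
  rcases (rank_le_of_le hD.torus h.torus hDT).lt_or_eq with h1 | h1
  · exact Or.inl h1
  · subst h1
    obtain rfl := eq_of_rank_eq hD.torus h.torus hDT
    exact Or.inr ⟨rfl, hD.relIndex ▸ hHK hD.le⟩

theorem toralSizeLE_top (h : IsToralPair p T r) (H : Subgroup S) :
    ToralSizeLE p H (⊤ : Subgroup S) := by
  refine h.toralSizeLE le_top fun _ => ?_
  rw [Subgroup.relIndex_top_right]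
  exact Nat.le_of_dvd (Nat.pos_of_ne_zero h.index_ne_zero)
    (have := h.normal; Subgroup.relIndex_dvd_index_of_normal T H)

theorem le_of_toralSizeLE (h : IsToralPair p T r) {H K : Subgroup S} (hH : T ≤ H)
    (hHK : ToralSizeLE p H K) : T ≤ K := by
  obtain ⟨r₁, n₁, r₂, n₂, h1, h2, h3⟩ := hHK
  obtain ⟨D, hD⟩ := hasToralSize_iff.1 h1
  obtain ⟨E, hE⟩ := hasToralSize_iff.1 h2
  obtain rfl := hD.unique (h.isComponent hH)
  have hr := rank_unique hD.torus h.torus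
  have hET := h.le_of_pDivisible hE.torus.pDivisible
  have h4 := rank_le_of_le hE.torus h.torus hET
  have h5 : r₂ = r := by omega
  rw [← h5] at h
  exact (eq_of_rank_eq hE.torus h.torus hET) ▸ hE.le

/-- Among the members containing T the indices are bounded by that of T in S. The member `i₀`
ensures that there is one; the members not containing T have smaller rank. -/
theorem exists_maximal (h : IsToralPair p T r) {ι : Type*} (K : ι → Subgroup S) (i₀ : ι)
    (h₀ : T ≤ K i₀) : ∃ i, T ≤ K i ∧ ∀ j, ToralSizeLE p (K j) (K i) := by
  have hn := h.normal
  let s : Set ℕ := {n | ∃ i, T ≤ K i ∧ T.relIndex (K i) = n}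
  have hs : s.Nonempty := ⟨_, i₀, h₀, rfl⟩
  have hb : BddAbove s := by
    refine ⟨T.index, ?_⟩
    rintro _ ⟨i, -, rfl⟩
    exact Nat.le_of_dvd (Nat.pos_of_ne_zero h.index_ne_zero)
      (Subgroup.relIndex_dvd_index_of_normal T _)
  obtain ⟨i, hi, hin⟩ := Nat.sSup_mem hs hb
  refine ⟨i, hi, fun j => h.toralSizeLE hi fun hj => ?_⟩
  rw [hin]
  exact le_csSup hb ⟨j, hj, rfl⟩

/-- A subgroup of finite index has the same identity component, so both sizes are that of H with the
index multiplied by the common factor. -/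
theorem toralSizeLE_of_relIndex_eq (h : IsToralPair p T r) {H K₁ K₂ : Subgroup S} (h₁ : H ≤ K₁)
    (h₂ : H ≤ K₂) (hne : H.relIndex K₁ ≠ 0) (he : H.relIndex K₁ = H.relIndex K₂) :
    ToralSizeLE p K₁ K₂ := by
  obtain ⟨D, s, n, hD, -⟩ := h.exists_component H
  have aux : ∀ {K : Subgroup S} (_ : H ≤ K) (_ : H.relIndex K ≠ 0),
      HasToralSize p K s (D.relIndex H * H.relIndex K) := by
    intro K hK hne
    obtain ⟨E, s', n', hE, -⟩ := h.exists_component K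
    have hEH : E ≤ H := hE.torus.le_of_relIndex_ne_zero fun h0 =>
      hne (Subgroup.relIndex_eq_zero_of_le_right hE.le h0)
    have hDE : D ≤ E := by
      refine hD.torus.le_of_relIndex_ne_zero fun h0 => ?_
      have h2 := Subgroup.relIndex_eq_zero_of_le_right (hD.le.trans hK) h0
      rw [hE.relIndex] at h2
      obtain ⟨k, rfl⟩ := hE.pow
      exact pow_ne_zero k hp.out.ne_zero h2
    have hED : E ≤ D := by
      refine hE.torus.le_of_relIndex_ne_zero fun h0 => ?_
      have h2 := Subgroup.relIndex_eq_zero_of_le_right hEH h0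
      rw [hD.relIndex] at h2
      obtain ⟨k, rfl⟩ := hD.pow
      exact pow_ne_zero k hp.out.ne_zero h2
    obtain rfl := le_antisymm hDE hED
    rw [Subgroup.relIndex_mul_relIndex _ _ _ hD.le hK, rank_unique hD.torus hE.torus, hE.relIndex]
    exact hasToralSize_iff.2 ⟨D, hE⟩
  exact ⟨s, _, s, _, aux h₁ hne, aux h₂ (he ▸ hne), Or.inr ⟨rfl, by rw [he]⟩⟩

end IsToralPair

end Sizes

/-! ### Morphisms of a fusion system as functions `S → S` -/

namespace FusionSystem

variable {S : Type*} [Group S] (F : FusionSystem S)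

/-- The restriction of `f : S → S` to `P` is a morphism of `F`. -/
def Mor (P : Subgroup S) (f : S → S) : Prop :=
  ∃ φ ∈ F.Hom P ⊤, ∀ x : P, f x = φ x

/-- The restriction of `f : S → S` to `P` is an isomorphism from `P` to `Q` in `F`. -/
def Iso (P Q : Subgroup S) (f : S → S) : Prop :=
  F.Mor P f ∧ ∀ y, y ∈ Q ↔ ∃ x ∈ P, f x = y

variable {F}

theorem mor_conj (P : Subgroup S) (g : S) : F.Mor P fun x => g * x * g⁻¹ :=
  ⟨_, F.conj_mem P ⊤ g fun _ _ => Subgroup.mem_top _, fun _ => rfl⟩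

theorem incl_mem {P Q : Subgroup S} (h : P ≤ Q) : Subgroup.inclusion h ∈ F.Hom P Q := by
  have h0 : ∀ x ∈ P, 1 * x * 1⁻¹ ∈ Q := fun x hx => by simpa using h hx
  have h1 := F.conj_mem P Q 1 h0
  have e : conjHom P Q 1 h0 = Subgroup.inclusion h := by
    ext x
    simp [conjHom]
  rwa [e] at h1

theorem mor_id (P : Subgroup S) : F.Mor P id :=
  ⟨_, incl_mem le_top, fun _ => rfl⟩

theorem exists_mor {P Q : Subgroup S} {φ : P →* Q} (hφ : φ ∈ F.Hom P Q) :
    ∃ f, F.Mor P f ∧ ∀ x : P, f x = φ x := by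
  classical
  -- The value 1 outside P is arbitrary: `Mor P` only sees the restriction to P.
  let f : S → S := fun x => if h : x ∈ P then φ ⟨x, h⟩ else 1
  have hf : ∀ x : P, f x = φ x := fun x => by simp [f]
  exact ⟨f, ⟨_, F.comp_mem hφ (incl_mem le_top), hf⟩, hf⟩

namespace Mor

variable {P Q : Subgroup S} {f g : S → S}

theorem congr (h : F.Mor P f) (hfg : ∀ x ∈ P, g x = f x) : F.Mor P g := by
  obtain ⟨φ, hφ, hf⟩ := h
  exact ⟨φ, hφ, fun x => (hfg x x.2).trans (hf x)⟩

theorem restrict (h : F.Mor P f) (hQ : Q ≤ P) : F.Mor Q f := by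
  obtain ⟨φ, hφ, hf⟩ := h
  exact ⟨_, F.comp_mem (incl_mem hQ) hφ, fun x => hf ⟨x, hQ x.2⟩⟩

theorem map_mul (h : F.Mor P f) {x y : S} (hx : x ∈ P) (hy : y ∈ P) : f (x * y) = f x * f y := by
  obtain ⟨φ, hφ, hf⟩ := h
  have := hf (⟨x, hx⟩ * ⟨y, hy⟩)
  rw [_root_.map_mul, Subgroup.coe_mul, Subgroup.coe_mul, ← hf, ← hf] at this
  exact this

theorem map_one (h : F.Mor P f) : f 1 = 1 := by
  have := h.map_mul P.one_mem P.one_mem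
  rw [mul_one] at this
  exact left_eq_mul.1 this

theorem map_inv (h : F.Mor P f) {x : S} (hx : x ∈ P) : f x⁻¹ = (f x)⁻¹ := by
  have := h.map_mul hx (P.inv_mem hx)
  rw [mul_inv_cancel, h.map_one] at this
  exact (inv_eq_of_mul_eq_one_right this.symm).symm

theorem map_pow (h : F.Mor P f) {x : S} (hx : x ∈ P) (n : ℕ) : f (x ^ n) = f x ^ n := by
  induction n with
  | zero => rw [pow_zero, pow_zero, h.map_one]
  | succ n ih => rw [pow_succ, pow_succ, h.map_mul (P.pow_mem hx n) hx, ih]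

theorem inj (h : F.Mor P f) {x y : S} (hx : x ∈ P) (hy : y ∈ P) (hxy : f x = f y) : x = y := by
  obtain ⟨φ, hφ, hf⟩ := h
  have h1 := F.injective_of_mem hφ (a₁ := ⟨x, hx⟩) (a₂ := ⟨y, hy⟩)
    (Subtype.ext (by rw [← hf, ← hf]; exact hxy))
  exact congrArg Subtype.val h1

theorem eq_one (h : F.Mor P f) {x : S} (hx : x ∈ P) (h1 : f x = 1) : x = 1 :=
  h.inj hx P.one_mem (h1.trans h.map_one.symm)

theorem exists_hom (h : F.Mor P f) (hQ : ∀ x ∈ P, f x ∈ Q) :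
    ∃ φ ∈ F.Hom P Q, ∀ x : P, (φ x : S) = f x := by
  obtain ⟨φ, hφ, hf⟩ := h
  have h1 := F.range_mem hφ
  have hle : ((⊤ : Subgroup S).subtype.comp φ).range ≤ Q := by
    rintro _ ⟨x, rfl⟩
    have := hQ x x.2
    rwa [hf] at this
  exact ⟨_, F.comp_mem h1 (incl_mem hle), fun x => (hf x).symm⟩

theorem comp (hf : F.Mor P f) (hg : F.Mor Q g) (h : ∀ x ∈ P, f x ∈ Q) :
    F.Mor P fun x => g (f x) := by
  obtain ⟨φ, hφ, hφf⟩ := hf.exists_hom h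
  obtain ⟨ψ, hψ, hψg⟩ := hg
  refine ⟨_, F.comp_mem hφ hψ, fun x => ?_⟩
  change g (f x) = _
  rw [← hφf x, hψg]
  rfl

theorem exists_iso (h : F.Mor P f) : ∃ Q, F.Iso P Q f := by
  obtain ⟨φ, hφ, hf⟩ := h
  refine ⟨((⊤ : Subgroup S).subtype.comp φ).range, ⟨φ, hφ, hf⟩, fun y => ⟨?_, ?_⟩⟩
  · rintro ⟨x, rfl⟩
    exact ⟨x, x.2, hf x⟩
  · rintro ⟨x, hx, rfl⟩
    exact ⟨⟨x, hx⟩, (hf ⟨x, hx⟩).symm⟩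

end Mor

namespace Iso

variable {P Q R : Subgroup S} {f g : S → S}

theorem mem (h : F.Iso P Q f) {x : S} (hx : x ∈ P) : f x ∈ Q := (h.2 _).2 ⟨x, hx, rfl⟩

theorem exists_mem (h : F.Iso P Q f) {y : S} (hy : y ∈ Q) : ∃ x ∈ P, f x = y := (h.2 y).1 hy

theorem congr (h : F.Iso P Q f) (hfg : ∀ x ∈ P, g x = f x) : F.Iso P Q g := by
  refine ⟨h.1.congr hfg, fun y => (h.2 y).trans ⟨?_, ?_⟩⟩
  · rintro ⟨x, hx, rfl⟩; exact ⟨x, hx, hfg x hx⟩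
  · rintro ⟨x, hx, rfl⟩; exact ⟨x, hx, (hfg x hx).symm⟩

theorem refl (P : Subgroup S) : F.Iso P P id :=
  ⟨mor_id P, fun y => ⟨fun hy => ⟨y, hy, rfl⟩, by rintro ⟨x, hx, rfl⟩; exact hx⟩⟩

theorem trans (h : F.Iso P Q f) (h' : F.Iso Q R g) : F.Iso P R fun x => g (f x) := by
  refine ⟨h.1.comp h'.1 fun x hx => h.mem hx, fun z => ⟨fun hz => ?_, ?_⟩⟩
  · obtain ⟨y, hy, rfl⟩ := h'.exists_mem hz
    obtain ⟨x, hx, rfl⟩ := h.exists_mem hy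
    exact ⟨x, hx, rfl⟩
  · rintro ⟨x, hx, rfl⟩
    exact h'.mem (h.mem hx)

theorem exists_mulEquiv (h : F.Iso P Q f) :
    ∃ e : P ≃* Q, e.toMonoidHom ∈ F.Hom P Q ∧ ∀ x : P, (e x : S) = f x := by
  obtain ⟨φ, hφ, hf⟩ := h.1.exists_hom fun x hx => h.mem hx
  have hb : Function.Bijective φ := by
    refine ⟨F.injective_of_mem hφ, fun y => ?_⟩
    obtain ⟨x, hx, hxy⟩ := h.exists_mem y.2
    exact ⟨⟨x, hx⟩, Subtype.ext ((hf _).trans hxy)⟩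
  exact ⟨MulEquiv.ofBijective φ hb, hφ, hf⟩

end Iso

theorem exists_iso_of_mulEquiv {P Q : Subgroup S} (e : P ≃* Q) (he : e.toMonoidHom ∈ F.Hom P Q) :
    ∃ f, F.Iso P Q f ∧ ∀ x : P, f x = e x := by
  obtain ⟨f, hf, hfe⟩ := exists_mor he
  refine ⟨f, ⟨hf, fun y => ⟨fun hy => ?_, ?_⟩⟩, hfe⟩
  · exact ⟨e.symm ⟨y, hy⟩, (e.symm ⟨y, hy⟩).2, by rw [hfe]; simp⟩
  · rintro ⟨x, hx, rfl⟩
    exact hfe ⟨x, hx⟩ ▸ (e ⟨x, hx⟩).2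

theorem Iso.exists_symm {P Q : Subgroup S} {f : S → S} (h : F.Iso P Q f) :
    ∃ g, F.Iso Q P g ∧ (∀ x ∈ P, g (f x) = x) ∧ ∀ y ∈ Q, f (g y) = y := by
  obtain ⟨e, he, hf⟩ := h.exists_mulEquiv
  obtain ⟨g, hg, hge⟩ := exists_iso_of_mulEquiv e.symm (F.symm_mem he)
  refine ⟨g, hg, fun x hx => ?_, fun y hy => ?_⟩
  · have := hge (e ⟨x, hx⟩)
    rw [hf] at this
    simpa using this
  · have := hge ⟨y, hy⟩
    have h2 := hf (e.symm ⟨y, hy⟩)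
    rw [← this] at h2
    rw [← h2]
    simp

theorem Iso.isConj {P Q : Subgroup S} {f : S → S} (h : F.Iso P Q f) : F.IsConj P Q := by
  obtain ⟨e, he, -⟩ := h.exists_mulEquiv
  exact ⟨e, he⟩

theorem Iso.isConj_symm {P Q : Subgroup S} {f : S → S} (h : F.Iso P Q f) : F.IsConj Q P := by
  obtain ⟨g, hg, -⟩ := h.exists_symm
  exact hg.isConj

theorem IsConj.exists_iso {P Q : Subgroup S} (h : F.IsConj P Q) : ∃ f, F.Iso P Q f := by
  obtain ⟨e, he⟩ := h
  obtain ⟨f, hf, -⟩ := exists_iso_of_mulEquiv e he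
  exact ⟨f, hf⟩

theorem exists_iso_of_mem_aut {P : Subgroup S} {α : MulAut P} (h : α ∈ F.aut P) :
    ∃ f, F.Iso P P f ∧ ∀ x : P, f x = α x :=
  exists_iso_of_mulEquiv α h

theorem Iso.exists_mem_aut {P : Subgroup S} {f : S → S} (h : F.Iso P P f) :
    ∃ α ∈ F.aut P, ∀ x : P, (α x : S) = f x :=
  h.exists_mulEquiv

theorem normalizerMonoidHom_coe {P : Subgroup S} (s : Subgroup.normalizer (P : Set S)) (x : P) :
    (P.normalizerMonoidHom s x : S) = s * x * (s : S)⁻¹ := rfl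

theorem mem_autS {P : Subgroup S} {α : MulAut P} :
    α ∈ autS P ↔ ∃ s ∈ Subgroup.normalizer (P : Set S), ∀ x : P, (α x : S) = s * x * s⁻¹ := by
  constructor
  · rintro ⟨s, rfl⟩
    exact ⟨s, s.2, fun x => rfl⟩
  · rintro ⟨s, hs, h⟩
    exact ⟨⟨s, hs⟩, MulEquiv.ext fun x => Subtype.ext (h x).symm⟩

theorem autS_le_aut (P : Subgroup S) : autS P ≤ F.aut P := by
  rintro _ ⟨s, rfl⟩
  have h := F.conj_mem P P s fun x hx => (Subgroup.mem_normalizer_iff.1 s.2 x).1 hx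
  exact h

/-- An isomorphism onto a receptive subgroup extends to each subgroup of elements `s`, normalizing
the domain, whose conjugation action is transported to an action by conjugation. -/
theorem Receptive.exists_extension {P Q : Subgroup S} {f : S → S} (hP : F.Receptive P)
    (hf : F.Iso Q P f) (K : Subgroup S)
    (hK : ∀ s ∈ K, s ∈ Subgroup.normalizer (Q : Set S) ∧
      ∃ t : S, ∀ x ∈ Q, f (s * x * s⁻¹) = t * f x * t⁻¹) :
    ∃ g, F.Mor K g ∧ ∀ x ∈ Q, x ∈ K → g x = f x := by
  obtain ⟨e, he, hef⟩ := hf.exists_mulEquiv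
  obtain ⟨ψ, hψ, hle, hext⟩ := hP Q e he
  obtain ⟨g, hg, hgψ⟩ := exists_mor hψ
  have hKe : K ≤ extender e := by
    intro s hs
    obtain ⟨hsQ, t, ht⟩ := hK s hs
    refine ⟨⟨s, hsQ⟩, ?_, rfl⟩
    change MulAut.congr e (Q.normalizerMonoidHom ⟨s, hsQ⟩) ∈ autS P
    have key : ∀ x : P,
        ((MulAut.congr e (Q.normalizerMonoidHom ⟨s, hsQ⟩)) x : S) = t * x * t⁻¹ := by
      intro x
      have h1 : (MulAut.congr e (Q.normalizerMonoidHom ⟨s, hsQ⟩)) x =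
        e (Q.normalizerMonoidHom ⟨s, hsQ⟩ (e.symm x)) := rfl
      rw [h1, hef, normalizerMonoidHom_coe, ht _ (e.symm x).2, ← hef, e.apply_symm_apply]
    refine mem_autS.2 ⟨t, ?_, key⟩
    have h2 : ∀ x ∈ P, t * x * t⁻¹ ∈ P := fun x hx => key ⟨x, hx⟩ ▸ Subtype.mem _
    have h3 : ∀ x ∈ P, t⁻¹ * x * t ∈ P := by
      intro x hx
      have h4 := key ((MulAut.congr e (Q.normalizerMonoidHom ⟨s, hsQ⟩))⁻¹ ⟨x, hx⟩)
      rw [MulAut.apply_inv_self] at h4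
      have h5 : t⁻¹ * x * t =
          ((MulAut.congr e (Q.normalizerMonoidHom ⟨s, hsQ⟩))⁻¹ ⟨x, hx⟩ : P) := by
        change x = _ at h4
        generalize (((MulAut.congr e (Q.normalizerMonoidHom ⟨s, hsQ⟩))⁻¹ ⟨x, hx⟩ : P) : S) = y at h4
        rw [h4]
        group
      rw [h5]
      exact Subtype.mem _
    refine Subgroup.mem_normalizer_iff.2 fun x => ⟨h2 x, fun hx => ?_⟩
    have := h3 _ hx
    group at this
    simpa using this
  refine ⟨g, hg.restrict hKe, fun x hx hxK => ?_⟩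
  rw [hgψ ⟨x, hKe hxK⟩]
  have h6 := hext ⟨x, hx⟩
  have h7 : (Subgroup.inclusion hle ⟨x, hx⟩ : extender e) = ⟨x, hKe hxK⟩ := rfl
  rw [h7] at h6
  rw [h6]
  exact hef ⟨x, hx⟩

/-- Variant of `Receptive.exists_extension` where only the elements of a set of generators of the
larger subgroup have to be considered. -/
theorem Receptive.exists_extension_sup {P Q V : Subgroup S} {f : S → S}
    (hP : F.Receptive P) (hf : F.Iso Q P f)
    (hV : ∀ s ∈ V, s ∈ Subgroup.normalizer (Q : Set S) ∧
      ∃ t : S, ∀ x ∈ Q, f (s * x * s⁻¹) = t * f x * t⁻¹) :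
    ∃ g, F.Mor (Q ⊔ V) g ∧ ∀ x ∈ Q, g x = f x := by
  have hQN : Q ≤ Subgroup.normalizer (Q : Set S) := Subgroup.le_normalizer
  obtain ⟨g, hg, hgf⟩ := hP.exists_extension hf (Q ⊔ V) (by
    intro s hs
    refine Subgroup.closure_induction (p := fun s _ => s ∈ Subgroup.normalizer (Q : Set S) ∧
      ∃ t : S, ∀ x ∈ Q, f (s * x * s⁻¹) = t * f x * t⁻¹) ?_ ?_ ?_ ?_
      ((Subgroup.sup_eq_closure Q _ ▸ hs : s ∈ Subgroup.closure ((Q : Set S) ∪ V)))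
    · rintro s (hs | hs)
      · refine ⟨hQN hs, f s, fun x hx => ?_⟩
        rw [hf.1.map_mul (Q.mul_mem hs hx) (Q.inv_mem hs), hf.1.map_mul hs hx, hf.1.map_inv hs]
      · exact hV s hs
    · exact ⟨Subgroup.one_mem _, 1, fun x _ => by simp⟩
    · rintro s s' - - ⟨h1, t, ht⟩ ⟨h1', t', ht'⟩
      refine ⟨Subgroup.mul_mem _ h1 h1', t * t', fun x hx => ?_⟩
      have h2 := ht _ ((Subgroup.mem_normalizer_iff.1 h1' x).1 hx)
      rw [ht' x hx] at h2
      rw [show s * s' * x * (s * s')⁻¹ = s * (s' * x * s'⁻¹) * s⁻¹ by group, h2]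
      group
    · rintro s - ⟨h1, t, ht⟩
      refine ⟨Subgroup.inv_mem _ h1, t⁻¹, fun x hx => ?_⟩
      have h2 := ht _ ((Subgroup.mem_normalizer_iff.1 (Subgroup.inv_mem _ h1) x).1 hx)
      rw [show s * (s⁻¹ * x * s⁻¹⁻¹) * s⁻¹ = x by group] at h2
      rw [h2]
      group)
  exact ⟨g, hg, fun x hx => hgf x hx ((le_sup_left : Q ≤ Q ⊔ V) hx)⟩

/-- An isomorphism onto a receptive subgroup extends to the centralizer of its domain. -/
theorem Receptive.exists_extension_centralizer {P Q : Subgroup S} {f : S → S}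
    (hP : F.Receptive P) (hf : F.Iso Q P f) :
    ∃ g, F.Mor (Q ⊔ Subgroup.centralizer (Q : Set S)) g ∧ ∀ x ∈ Q, g x = f x := by
  refine hP.exists_extension_sup hf fun s hs => ⟨Subgroup.centralizer_le_normalizer _ hs, 1,
    fun x hx => ?_⟩
  rw [← Subgroup.mem_centralizer_iff.1 hs x hx]
  simp

/-- A map which is a morphism on each member of an increasing sequence of subgroups is a morphism
on the union. -/
theorem IsSaturated.mor_iSup {p : ℕ} (hF : F.IsSaturated p) {P : ℕ → Subgroup S}
    (hP : Monotone P) {f : S → S} (hf : ∀ n, F.Mor (P n) f) : F.Mor (⨆ n, P n) f := by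
  have hmem : ∀ {x}, x ∈ ⨆ n, P n → ∃ n, x ∈ P n := fun hx =>
    (Subgroup.mem_iSup_of_directed hP.directed_le).1 hx
  let φ : ↥(⨆ n, P n) →* (⊤ : Subgroup S) :=
    { toFun := fun x => ⟨f x, Subgroup.mem_top _⟩
      map_one' := Subtype.ext (hf 0).map_one
      map_mul' := fun x y => by
        obtain ⟨m, hm⟩ := hmem x.2
        obtain ⟨n, hn⟩ := hmem y.2
        exact Subtype.ext ((hf (max m n)).map_mul (hP (le_max_left m n) hm)
          (hP (le_max_right m n) hn)) }
  refine ⟨φ, hF.continuity P hP φ fun i => ?_, fun x => rfl⟩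
  obtain ⟨ψ, hψ, hψf⟩ := hf i
  convert hψ using 1
  ext x
  exact hψf x

/-! ### Sylow subgroups of Aut_F(P) for abelian P -/

section Automized

variable {p : ℕ} [hp : Fact p.Prime] {P : Subgroup S}

/-- Inn(P) is trivial for abelian P, so Out_F(P) is Aut_F(P) itself. -/
theorem exists_sylow_of_fullyAutomized (hab : ∀ x ∈ P, ∀ y ∈ P, x * y = y * x)
    (h : F.FullyAutomized p P) : Finite (F.aut P) ∧
      ∃ T : Sylow p (F.aut P), (T : Subgroup (F.aut P)) = (autS P).subgroupOf (F.aut P) := by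
  have hinn : innS P = ⊥ := by
    rw [eq_bot_iff]
    rintro _ ⟨x, rfl⟩
    refine Subgroup.mem_bot.2 (MulEquiv.ext fun y => Subtype.ext ?_)
    change (x : S) * y * (x : S)⁻¹ = y
    rw [hab x x.2 y y.2, mul_inv_cancel_right]
  let q := QuotientGroup.mk' ((innS P).subgroupOf (F.aut P))
  have hq : Function.Injective q := by
    rw [← MonoidHom.ker_eq_bot_iff, QuotientGroup.ker_mk', hinn]
    exact Subgroup.bot_subgroupOf _
  obtain ⟨hfin, T, hT⟩ := h
  refine ⟨Finite.of_injective q hq, T.comapOfInjective q hq ?_, ?_⟩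
  · rw [MonoidHom.range_eq_top.2 (QuotientGroup.mk'_surjective _)]
    exact le_top
  · rw [Sylow.coe_comapOfInjective, hT, outS]
    exact Subgroup.comap_map_eq_self_of_injective hq _

theorem isPGroup_autS (hS : IsPGroup p S) (P : Subgroup S) : IsPGroup p (autS P) :=
  IsPGroup.of_surjective (hS.to_subgroup _) _ P.normalizerMonoidHom.rangeRestrict_surjective

/-- Up to an `F`-automorphism of `P`, an isomorphism onto a fully normalized abelian subgroup `P`
extends to the normalizer of its domain. -/
theorem IsSaturated.exists_extension_normalizer (hF : F.IsSaturated p) (hS : IsPGroup p S)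
    (hab : ∀ x ∈ P, ∀ y ∈ P, x * y = y * x) (hP : F.FullyNormalized p P) {Q : Subgroup S}
    {f : S → S} (hf : F.Iso Q P f) :
    ∃ α k, F.Iso P P α ∧ F.Mor (Subgroup.normalizer (Q : Set S)) k ∧
      ∀ x ∈ Q, k x = α (f x) := by
  obtain ⟨hauto, hcent⟩ := hF.sylow P hP
  obtain ⟨hfin, T, hT⟩ := exists_sylow_of_fullyAutomized hab hauto
  obtain ⟨e, he, hef⟩ := hf.exists_mulEquiv
  let V : Subgroup (F.aut P) := ((autS Q).map (MulAut.congr e).toMonoidHom).subgroupOf (F.aut P)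
  have hVle : (autS Q).map (MulAut.congr e).toMonoidHom ≤ F.aut P := by
    rintro _ ⟨v, hv, rfl⟩
    exact F.comp_mem (F.symm_mem he) (F.comp_mem (autS_le_aut Q hv) he)
  have hV : IsPGroup p V :=
    IsPGroup.comap_of_injective ((isPGroup_autS hS Q).map _) _ (Subgroup.subtype_injective _)
  obtain ⟨T', hT'⟩ := hV.exists_le_sylow
  -- The p-group f Aut_S(Q) f⁻¹ lies in a Sylow subgroup T' of Aut_F(P); conjugating T' to Aut_S(P)
  -- by α makes the extension domain of α ∘ f all of N_S(Q).
  obtain ⟨α, hα⟩ := MulAction.exists_smul_eq (F.aut P) T' T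
  obtain ⟨a, ha, haα⟩ := exists_iso_of_mem_aut α.2
  have hfa := hf.trans ha
  have hrec := hF.extension P hcent
  obtain ⟨k, hk, hkf⟩ := hrec.exists_extension hfa (Subgroup.normalizer (Q : Set S)) (by
    intro s hs
    refine ⟨hs, ?_⟩
    have h1 : MulAut.congr e (Q.normalizerMonoidHom ⟨s, hs⟩) ∈
        (autS Q).map (MulAut.congr e).toMonoidHom := ⟨_, ⟨_, rfl⟩, rfl⟩
    have h2 : (⟨_, hVle h1⟩ : F.aut P) ∈ (T' : Subgroup (F.aut P)) :=
      hT' (Subgroup.mem_subgroupOf.2 h1)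
    have h3 : α * ⟨_, hVle h1⟩ * α⁻¹ ∈ (T : Subgroup (F.aut P)) := by
      rw [← hα]
      exact Subgroup.smul_mem_pointwise_smul _ (MulAut.conj α) _ h2
    rw [hT, Subgroup.mem_subgroupOf] at h3
    obtain ⟨t, -, ht⟩ := mem_autS.1 h3
    refine ⟨t, fun x hx => ?_⟩
    have h4 := ht (α.1 (e ⟨x, hx⟩))
    have h5 : (α * ⟨_, hVle h1⟩ * α⁻¹ : F.aut P).1 (α.1 (e ⟨x, hx⟩)) =
        α.1 (e (Q.normalizerMonoidHom ⟨s, hs⟩ ⟨x, hx⟩)) := by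
      change α.1 (e (Q.normalizerMonoidHom ⟨s, hs⟩ (e.symm (α.1⁻¹ (α.1 (e ⟨x, hx⟩)))))) = _
      rw [MulAut.inv_apply_self, e.symm_apply_apply]
    rw [h5, ← haα, ← haα, hef, hef] at h4
    exact h4)
  exact ⟨a, k, ha, hk, fun x hx => hkf x hx (Subgroup.le_normalizer hx)⟩

end Automized

end FusionSystem

/-! ### Groups with an abelian subgroup of index `p` -/

section OneSub

variable {p : ℕ} [hp : Fact p.Prime] {M : Type*} [AddCommGroup M]

/-- Modulo p, (1 − σ)^p is 1 + (−σ)^p, which vanishes because p is odd and σ^p = 1. -/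
theorem exists_one_sub_pow_prime_eq (hodd : Odd p) {σ : AddMonoid.End M} (hσ : σ ^ p = 1) :
    ∃ c : AddMonoid.End M, (1 - σ) ^ p = (p : AddMonoid.End M) * c := by
  obtain ⟨c, hc⟩ := Commute.exists_add_pow_prime_eq hp.out
    (show Commute (1 : AddMonoid.End M) (-σ) from Commute.one_left _)
  refine ⟨-σ * c, ?_⟩
  rw [sub_eq_add_neg, hc, hodd.neg_pow, hσ, one_pow, add_neg_cancel, zero_add, mul_one, mul_assoc]

theorem one_sub_pow_apply_eq_zero (hodd : Odd p) {σ : AddMonoid.End M} (hσ : σ ^ p = 1) (k : ℕ) :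
    ∀ m : M, p ^ k • m = 0 → ((1 - σ) ^ (p * k)) m = 0 := by
  obtain ⟨c, hc⟩ := exists_one_sub_pow_prime_eq hodd hσ
  rw [pow_mul, hc]
  induction k with
  | zero => intro m hm; simpa using hm
  | succ k ih =>
    intro m hm
    rw [pow_succ]
    refine ih _ ?_
    change p ^ k • (p • c m) = 0
    rw [← mul_nsmul', ← pow_succ, ← map_nsmul, hm, map_zero]

end OneSub

/-- `S` is a nonabelian group with a normal abelian subgroup `A` of index `p`, and a normal
discrete `p`-torus `T` of rank `r` and `p`-power index. -/
structure IndexPSetup (p : ℕ) {S : Type*} [Group S] (A T : Subgroup S) (r : ℕ) : Prop where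
  pair : IsToralPair p T r
  comm : ∀ a ∈ A, ∀ b ∈ A, a * b = b * a
  normal : A.Normal
  index : A.index = p
  nonab : ¬ ∀ x y : S, x * y = y * x

/-- The set `[A, S]` of commutators `[a, s]` where `a ∈ A`. -/
def commSet {S : Type*} [Group S] (A : Subgroup S) : Set S :=
  {w | ∃ a ∈ A, ∃ s : S, a * s * a⁻¹ * s⁻¹ = w}

/-- The subgroup of elements of `A` that are central modulo the center of `S`. -/
def secondCenter {S : Type*} [Group S] (A : Subgroup S) : Subgroup S where
  carrier := {b | b ∈ A ∧ ∀ s : S, b * s * b⁻¹ * s⁻¹ ∈ Subgroup.center S}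
  one_mem' := ⟨A.one_mem, fun s => by simp⟩
  mul_mem' := by
    rintro a b ⟨ha, ha'⟩ ⟨hb, hb'⟩
    refine ⟨A.mul_mem ha hb, fun s => ?_⟩
    have h := Subgroup.mul_mem _ (ha' s) (hb' s)
    have h2 := Subgroup.mem_center_iff.1 (hb' s) a
    rwa [show a * b * s * (a * b)⁻¹ * s⁻¹ = a * s * a⁻¹ * s⁻¹ * (b * s * b⁻¹ * s⁻¹) by
      calc a * b * s * (a * b)⁻¹ * s⁻¹ = a * (b * s * b⁻¹ * s⁻¹) * s * a⁻¹ * s⁻¹ := by group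
        _ = (b * s * b⁻¹ * s⁻¹) * (a * s * a⁻¹ * s⁻¹) := by rw [h2]; group
        _ = _ := (Subgroup.mem_center_iff.1 (hb' s) _).symm]
  inv_mem' := by
    rintro a ⟨ha, ha'⟩
    refine ⟨A.inv_mem ha, fun s => ?_⟩
    have h2 := Subgroup.mem_center_iff.1 (ha' s) a
    have h3 : a⁻¹ * s * a⁻¹⁻¹ * s⁻¹ = (a * s * a⁻¹ * s⁻¹)⁻¹ := by
      rw [eq_inv_iff_mul_eq_one]
      have h4 := Subgroup.mem_center_iff.1 (ha' s) (a⁻¹ * s * a⁻¹⁻¹ * s⁻¹)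
      rw [h4]
      calc a * s * a⁻¹ * s⁻¹ * (a⁻¹ * s * a⁻¹⁻¹ * s⁻¹)
          = (a * s * a⁻¹ * s⁻¹) * a⁻¹ * (s * a * s⁻¹) := by group
        _ = a⁻¹ * (a * s * a⁻¹ * s⁻¹) * (s * a * s⁻¹) := by
            rw [Subgroup.mem_center_iff.1 (ha' s) a⁻¹]
        _ = 1 := by group
    rw [h3]
    exact Subgroup.inv_mem _ (ha' s)

namespace IndexPSetup

open scoped IsMulCommutative

variable {p : ℕ} [hp : Fact p.Prime] {S : Type*} [Group S] {A T : Subgroup S} {r : ℕ}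

theorem torus_le (h : IndexPSetup p A T r) : T ≤ A :=
  h.pair.torus.le_of_relIndex_ne_zero fun h0 =>
    hp.out.ne_zero (h.index ▸ Subgroup.index_eq_zero_of_relIndex_eq_zero h0)

theorem exists_notMem (h : IndexPSetup p A T r) : ∃ y, y ∉ A := by
  by_contra! hA
  exact h.nonab fun x y => h.comm x (hA x) y (hA y)

theorem exists_mul_pow (h : IndexPSetup p A T r) {y : S} (hy : y ∉ A) (s : S) :
    ∃ a ∈ A, ∃ i : ℕ, s = a * y ^ i := by
  have := h.normal
  have hc : Nat.card (S ⧸ A) = p := h.index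
  have h1 : (QuotientGroup.mk y : S ⧸ A) ≠ 1 := fun h0 => hy ((QuotientGroup.eq_one_iff y).1 h0)
  obtain ⟨i, hi⟩ := mem_powers_of_prime_card hc h1 (g' := (QuotientGroup.mk s : S ⧸ A))
  refine ⟨s * (y ^ i)⁻¹, ?_, i, by group⟩
  rw [← QuotientGroup.eq_one_iff, QuotientGroup.mk_mul, QuotientGroup.mk_inv,
    QuotientGroup.mk_pow]
  rw [← hi, mul_inv_cancel]

theorem pow_mem (h : IndexPSetup p A T r) (y : S) : y ^ p ∈ A := by
  have := h.normal
  exact h.index ▸ Subgroup.pow_index_mem A y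

theorem conj_mem (h : IndexPSetup p A T r) {a : S} (ha : a ∈ A) (s : S) : s * a * s⁻¹ ∈ A :=
  h.normal.conj_mem a ha s

theorem commutator_mem (h : IndexPSetup p A T r) {a : S} (ha : a ∈ A) (s : S) :
    a * s * a⁻¹ * s⁻¹ ∈ A := by
  have := A.mul_mem ha (h.conj_mem (A.inv_mem ha) s)
  convert this using 1
  group

/-- S is generated by the abelian group A and y. -/
theorem mem_center_of_comm (h : IndexPSetup p A T r) {y a : S} (hy : y ∉ A) (ha : a ∈ A)
    (hc : a * y = y * a) : a ∈ Subgroup.center S := by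
  rw [Subgroup.mem_center_iff]
  intro s
  obtain ⟨b, hb, i, rfl⟩ := h.exists_mul_pow hy s
  have h1 : Commute a (y ^ i) := (show Commute a y from hc).pow_right i
  have h2 : Commute a b := h.comm a ha b hb
  exact ((h2.mul_right h1).eq).symm

/-- A central element outside A would make A central, and S abelian. -/
theorem center_le (h : IndexPSetup p A T r) : Subgroup.center S ≤ A := by
  intro z hz
  by_contra hzA
  refine h.nonab fun x y => ?_
  have hA : ∀ a ∈ A, a ∈ Subgroup.center S := fun a ha =>
    h.mem_center_of_comm hzA ha (Subgroup.mem_center_iff.1 hz a)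
  obtain ⟨a, ha, i, rfl⟩ := h.exists_mul_pow hzA x
  exact (Subgroup.mem_center_iff.1
    (Subgroup.mul_mem _ (hA a ha) (Subgroup.pow_mem _ hz i)) y).symm

theorem mem_of_comm (h : IndexPSetup p A T r) {a s : S} (ha : a ∈ A)
    (haz : a ∉ Subgroup.center S) (hs : a * s = s * a) : s ∈ A := by
  by_contra hsA
  exact haz (h.mem_center_of_comm hsA ha hs)

theorem mem_centralizer {y s : S} : s ∈ Subgroup.centralizer {y} ↔ y * s = s * y := by
  rw [Subgroup.mem_centralizer_iff]
  simp

theorem self_mem_centralizer (y : S) : y ∈ Subgroup.centralizer {y} :=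
  mem_centralizer.2 rfl

theorem center_le_centralizer (y : S) : Subgroup.center S ≤ Subgroup.centralizer {y} :=
  fun _ hz => mem_centralizer.2 (Subgroup.mem_center_iff.1 hz y)

theorem mem_center_of_mem_centralizer (h : IndexPSetup p A T r) {y s : S} (hy : y ∉ A)
    (hs : s ∈ Subgroup.centralizer {y}) (hsA : s ∈ A) : s ∈ Subgroup.center S :=
  h.mem_center_of_comm hy hsA (mem_centralizer.1 hs).symm

theorem exists_eq_mul_pow_of_mem_centralizer (h : IndexPSetup p A T r) {y s : S} (hy : y ∉ A)
    (hs : s ∈ Subgroup.centralizer {y}) : ∃ z ∈ Subgroup.center S, ∃ i : ℕ, s = z * y ^ i := by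
  obtain ⟨a, ha, i, rfl⟩ := h.exists_mul_pow hy s
  refine ⟨a, h.mem_center_of_comm hy ha ?_, i, rfl⟩
  have h1 := mem_centralizer.1 hs
  have h2 : y * a * y ^ i = a * y * y ^ i := by
    rw [mul_assoc, h1, mul_assoc, mul_assoc, ← pow_succ, ← pow_succ']
  exact (mul_right_cancel h2).symm

/-- C_S(y) = Z(S)⟨y⟩. -/
theorem centralizer_comm (h : IndexPSetup p A T r) {y : S} (hy : y ∉ A) :
    ∀ s ∈ Subgroup.centralizer {y}, ∀ t ∈ Subgroup.centralizer {y}, s * t = t * s := by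
  intro s hs t ht
  obtain ⟨z, hz, i, rfl⟩ := h.exists_eq_mul_pow_of_mem_centralizer hy hs
  have h1 : Commute t y := (mem_centralizer.1 ht).symm
  have h2 : Commute t z := Subgroup.mem_center_iff.1 hz t
  exact (h2.mul_right (h1.pow_right i)).symm.eq

/-- The centralizer of an abelian subgroup not contained in `A`. -/
theorem centralizer_coe_eq (h : IndexPSetup p A T r) {R : Subgroup S} {y : S} (hy : y ∉ A)
    (hyR : y ∈ R) (hR : ∀ x ∈ R, ∀ x' ∈ R, x * x' = x' * x) :
    Subgroup.centralizer (R : Set S) = Subgroup.centralizer {y} := by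
  ext s
  constructor
  · intro hs
    exact mem_centralizer.2 (Subgroup.mem_centralizer_iff.1 hs y hyR)
  · intro hs
    refine Subgroup.mem_centralizer_iff.2 fun x hx => ?_
    exact h.centralizer_comm hy x (mem_centralizer.2 (hR y hyR x hx)) s hs

theorem centralizer_coe_eq_center (h : IndexPSetup p A T r) {R : Subgroup S} {y a : S} (hy : y ∉ A)
    (hyR : y ∈ R) (ha : a ∈ A) (haZ : a ∉ Subgroup.center S) (haR : a ∈ R) :
    Subgroup.centralizer (R : Set S) = Subgroup.center S := by
  refine le_antisymm (fun s hs => ?_) (Subgroup.center_le_centralizer _)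
  have hs' := Subgroup.mem_centralizer_iff.1 hs
  exact h.mem_center_of_comm hy (h.mem_of_comm ha haZ (hs' a haR)) (hs' y hyR).symm

theorem relIndex_eq (h : IndexPSetup p A T r) {K : Subgroup S} (hK : ¬ K ≤ A) :
    A.relIndex K = p := by
  have := h.normal
  have h1 := Subgroup.relIndex_dvd_index_of_normal A K
  rw [h.index] at h1
  rcases (Nat.dvd_prime hp.out).1 h1 with h2 | h2
  · exact absurd (Subgroup.relIndex_eq_one.1 h2) hK
  · exact h2

/-- Z(S) = A ∩ C_S(y), and A has index p. -/
theorem center_relIndex_centralizer (h : IndexPSetup p A T r) {y : S} (hy : y ∉ A) :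
    (Subgroup.center S).relIndex (Subgroup.centralizer {y}) = p := by
  have h1 : Subgroup.center S = A ⊓ Subgroup.centralizer {y} :=
    le_antisymm (le_inf h.center_le (center_le_centralizer y))
      fun s hs => h.mem_center_of_mem_centralizer hy hs.2 hs.1
  rw [h1, Subgroup.inf_relIndex_right, h.relIndex_eq]
  exact fun hle => hy (hle (self_mem_centralizer y))

theorem pow_mem_center (h : IndexPSetup p A T r) {y : S} (hy : y ∉ A) :
    y ^ p ∈ Subgroup.center S :=
  h.mem_center_of_comm hy (h.pow_mem y) ((Commute.refl y).pow_left p).eq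

theorem commutator_mul (h : IndexPSetup p A T r) {a b s : S} (ha : a ∈ A) (hb : b ∈ A) :
    a * b * s * (a * b)⁻¹ * s⁻¹ = a * s * a⁻¹ * s⁻¹ * (b * s * b⁻¹ * s⁻¹) := by
  have h1 := h.comm _ (h.commutator_mem hb s) _ (h.commutator_mem ha s)
  rw [← h1]
  have h2 := h.comm a ha _ (h.commutator_mem hb s)
  calc a * b * s * (a * b)⁻¹ * s⁻¹ = a * (b * s * b⁻¹ * s⁻¹) * (s * a⁻¹ * s⁻¹) := by group
    _ = _ := by rw [h2]; group

/-- Each commutator `[a, s]` with `a ∈ A` is of the form `[a', y]` for a fixed `y ∉ A`. -/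
theorem exists_commutator_eq (h : IndexPSetup p A T r) {y a : S} (hy : y ∉ A) (ha : a ∈ A)
    (s : S) : ∃ a' ∈ A, a' * y * a'⁻¹ * y⁻¹ = a * s * a⁻¹ * s⁻¹ := by
  obtain ⟨c, hc, i, rfl⟩ := h.exists_mul_pow hy s
  have key : ∀ i : ℕ, ∃ a' ∈ A, a' * y * a'⁻¹ * y⁻¹ = a * y ^ i * a⁻¹ * (y ^ i)⁻¹ := by
    intro i
    induction i with
    | zero => exact ⟨1, A.one_mem, by simp⟩
    | succ i ih =>
      obtain ⟨a', ha', he⟩ := ih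
      refine ⟨a' * (y ^ i * a * (y ^ i)⁻¹), A.mul_mem ha' (h.conj_mem ha _), ?_⟩
      rw [h.commutator_mul ha' (h.conj_mem ha _), he, pow_succ]
      group
  obtain ⟨a', ha', he⟩ := key i
  refine ⟨a', ha', he.trans ?_⟩
  have h1 := h.commutator_mem ha (y ^ i)
  have h2 := h.comm c hc _ h1
  calc a * y ^ i * a⁻¹ * (y ^ i)⁻¹ = c * (a * y ^ i * a⁻¹ * (y ^ i)⁻¹) * c⁻¹ := by rw [h2]; group
    _ = (c * a) * y ^ i * a⁻¹ * (y ^ i)⁻¹ * c⁻¹ := by group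
    _ = _ := by rw [h.comm c hc a ha]; group

theorem mem_commSet (h : IndexPSetup p A T r) {y w : S} (hy : y ∉ A) :
    w ∈ commSet A ↔ ∃ a ∈ A, a * y * a⁻¹ * y⁻¹ = w := by
  constructor
  · rintro ⟨a, ha, s, rfl⟩
    exact h.exists_commutator_eq hy ha s
  · rintro ⟨a, ha, rfl⟩
    exact ⟨a, ha, y, rfl⟩

theorem mem_secondCenter_of_commutator (h : IndexPSetup p A T r) {y b : S} (hy : y ∉ A)
    (hb : b ∈ A) (hby : b * y * b⁻¹ * y⁻¹ ∈ Subgroup.center S) : b ∈ secondCenter A := by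
  refine ⟨hb, fun s => ?_⟩
  obtain ⟨c, hc, i, rfl⟩ := h.exists_mul_pow hy s
  have key : ∀ i : ℕ, b * y ^ i * b⁻¹ * (y ^ i)⁻¹ ∈ Subgroup.center S := by
    intro i
    induction i with
    | zero => simp
    | succ i ih =>
      have h1 := Subgroup.mem_center_iff.1 hby (y ^ i)
      have h2 : b * y ^ (i + 1) * b⁻¹ * (y ^ (i + 1))⁻¹ =
          (b * y ^ i * b⁻¹ * (y ^ i)⁻¹) * (b * y * b⁻¹ * y⁻¹) := by
        rw [pow_succ]
        calc b * (y ^ i * y) * b⁻¹ * (y ^ i * y)⁻¹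
            = (b * y ^ i * b⁻¹) * (b * y * b⁻¹ * y⁻¹) * (y ^ i)⁻¹ := by group
          _ = (b * y ^ i * b⁻¹) * ((b * y * b⁻¹ * y⁻¹) * (y ^ i)⁻¹) := by group
          _ = (b * y ^ i * b⁻¹) * ((y ^ i)⁻¹ * (b * y * b⁻¹ * y⁻¹)) := by
            rw [Subgroup.mem_center_iff.1 hby (y ^ i)⁻¹]
          _ = _ := by group
      rw [h2]
      exact Subgroup.mul_mem _ ih hby
  have h1 := key i
  have h2 := h.comm b hb c hc
  have h3 : b * (c * y ^ i) * b⁻¹ * (c * y ^ i)⁻¹ = b * y ^ i * b⁻¹ * (y ^ i)⁻¹ := by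
    calc b * (c * y ^ i) * b⁻¹ * (c * y ^ i)⁻¹ = (b * c) * y ^ i * b⁻¹ * (y ^ i)⁻¹ * c⁻¹ := by group
      _ = c * (b * y ^ i * b⁻¹ * (y ^ i)⁻¹) * c⁻¹ := by rw [h2]; group
      _ = _ := by rw [Subgroup.mem_center_iff.1 h1 c]; group
  rw [h3]
  exact h1

theorem mem_normalizer_iff_secondCenter (h : IndexPSetup p A T r) {y b : S} (hy : y ∉ A)
    (hb : b ∈ A) : b ∈ Subgroup.normalizer (Subgroup.centralizer {y} : Set S) ↔
      b ∈ secondCenter A := by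
  constructor
  · intro hn
    refine h.mem_secondCenter_of_commutator hy hb ?_
    refine h.mem_center_of_mem_centralizer hy ?_ (h.commutator_mem hb y)
    exact Subgroup.mul_mem _ ((Subgroup.mem_normalizer_iff.1 hn y).1 (self_mem_centralizer y))
      (Subgroup.inv_mem _ (self_mem_centralizer y))
  · intro hb2
    have aux : ∀ b ∈ secondCenter A, ∀ x ∈ Subgroup.centralizer {y},
        b * x * b⁻¹ ∈ Subgroup.centralizer {y} := by
      intro b hb x hx
      have := Subgroup.mul_mem _ (center_le_centralizer y (hb.2 x)) hx
      simpa using this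
    refine Subgroup.mem_normalizer_iff.2 fun x => ⟨aux b hb2 x, fun hx => ?_⟩
    have := aux b⁻¹ (Subgroup.inv_mem _ hb2) _ hx
    group at this
    simpa using this

/-- N_S(C_S(y)) meets A in the second center, which does not depend on y. Hence all these
normalizers have the same size. -/
theorem normalizer_relIndex (h : IndexPSetup p A T r) {y : S} (hy : y ∉ A) :
    secondCenter A ≤ Subgroup.normalizer (Subgroup.centralizer {y} : Set S) ∧
      (secondCenter A).relIndex (Subgroup.normalizer (Subgroup.centralizer {y} : Set S)) = p := by
  have h1 : secondCenter A = A ⊓ Subgroup.normalizer (Subgroup.centralizer {y} : Set S) := by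
    ext b
    constructor
    · intro hb
      exact ⟨hb.1, (h.mem_normalizer_iff_secondCenter hy hb.1).2 hb⟩
    · rintro ⟨hb, hb'⟩
      exact (h.mem_normalizer_iff_secondCenter hy hb).1 hb'
  refine ⟨h1 ▸ inf_le_right, ?_⟩
  rw [h1, Subgroup.inf_relIndex_right, h.relIndex_eq]
  exact fun hle => hy (hle (Subgroup.le_normalizer (self_mem_centralizer y)))

theorem isMulCommutative (h : IndexPSetup p A T r) : IsMulCommutative A :=
  ⟨⟨fun a b => Subtype.ext (h.comm a a.2 b b.2)⟩⟩

variable (A) in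
/-- Conjugation by `s`, as an endomorphism of the additive group of `A`. -/
def conjEnd [A.Normal] [IsMulCommutative A] (s : S) : AddMonoid.End (Additive A) :=
  MonoidHom.toAdditive (MulAut.conjNormal s : MulAut A).toMonoidHom

theorem conjEnd_pow [A.Normal] [IsMulCommutative A] (s : S) (n : ℕ) : conjEnd A s ^ n = conjEnd A (s ^ n) := by
  induction n with
  | zero =>
    ext a
    change (a.toMul : S) = s ^ 0 * a.toMul * (s ^ 0)⁻¹
    simp
  | succ n ih =>
    rw [pow_succ, ih]
    ext a
    change s ^ n * (s * a.toMul * s⁻¹) * (s ^ n)⁻¹ = s ^ (n + 1) * a.toMul * (s ^ (n + 1))⁻¹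
    rw [pow_succ]
    group

theorem conjEnd_eq_one (h : IndexPSetup p A T r) [A.Normal] [IsMulCommutative A] {s : S} (hs : s ∈ A) :
    conjEnd A s = 1 := by
  ext a
  change s * (a.toMul : S) * s⁻¹ = a.toMul
  rw [h.comm s hs _ a.toMul.2, mul_inv_cancel_right]

/-- On A written additively, a ↦ [a,y] is 1 − σ with σ conjugation by y. Since σ^p = 1, this
operator is nilpotent on elements of bounded exponent. -/
theorem exists_iterate_commutator_eq_one (h : IndexPSetup p A T r) (hodd : Odd p) (y : S) {a : S}
    (ha : a ∈ A) : ∃ n : ℕ, (fun a => a * y * a⁻¹ * y⁻¹)^[n] a = 1 := by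
  have := h.normal
  have := h.isMulCommutative
  obtain ⟨k, hk⟩ := h.pair.isPGroup a
  have h1 : p ^ k • (Additive.ofMul ⟨a, ha⟩ : Additive A) = 0 :=
    congrArg Additive.ofMul (Subtype.ext (by simpa using hk) : (⟨a, ha⟩ : A) ^ p ^ k = 1)
  have hσ : conjEnd A y ^ p = 1 := by
    rw [conjEnd_pow, h.conjEnd_eq_one (h.pow_mem y)]
  have h2 := one_sub_pow_apply_eq_zero hodd hσ k _ h1
  have key : ∀ (n : ℕ) (a : Additive A), ((((1 - conjEnd A y) ^ n) a).toMul : S) =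
      (fun a => a * y * a⁻¹ * y⁻¹)^[n] (a.toMul : S) := by
    intro n
    induction n with
    | zero => intro a; rfl
    | succ n ih =>
      intro a
      rw [pow_succ, Function.iterate_succ_apply]
      refine (ih _).trans ?_
      congr 1
      change (a.toMul : S) / (y * a.toMul * y⁻¹) = _
      rw [div_eq_mul_inv]
      group
  exact ⟨p * k, (key _ (Additive.ofMul ⟨a, ha⟩)).symm.trans (by rw [h2]; rfl)⟩

/-- Some element of `A` is central modulo the center, but not central. -/
theorem exists_mem_secondCenter (h : IndexPSetup p A T r) (hodd : Odd p) :
    ∃ b ∈ secondCenter A, b ∉ Subgroup.center S := by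
  obtain ⟨y, hy⟩ := h.exists_notMem
  obtain ⟨a, ha, haz⟩ : ∃ a ∈ A, a ∉ Subgroup.center S := by
    by_contra! hA
    refine h.nonab fun x x' => ?_
    obtain ⟨a, ha, i, rfl⟩ := h.exists_mul_pow hy x
    obtain ⟨b, hb, j, rfl⟩ := h.exists_mul_pow hy x'
    have h1 : ∀ t, Commute t a := Subgroup.mem_center_iff.1 (hA a ha)
    have h2 : ∀ t, Commute t b := Subgroup.mem_center_iff.1 (hA b hb)
    exact ((h1 _).symm.mul_left ((h2 _).mul_right ((Commute.refl y).pow_pow i j))).eq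
  by_contra! hZ
  obtain ⟨n, hn⟩ := h.exists_iterate_commutator_eq_one hodd y ha
  -- Otherwise a ↦ [a,y] would preserve noncentrality, against its local nilpotence.
  have key : ∀ n : ℕ, ∀ a ∈ A, a ∉ Subgroup.center S →
      (fun a => a * y * a⁻¹ * y⁻¹)^[n] a ∉ Subgroup.center S := by
    intro n
    induction n with
    | zero => intro a _ haz; exact haz
    | succ n ih =>
      intro a ha haz
      rw [Function.iterate_succ_apply]
      refine ih _ (h.commutator_mem ha y) fun hc => haz ?_
      exact hZ a (h.mem_secondCenter_of_commutator hy ha hc)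
  exact key n a ha haz (hn ▸ Subgroup.one_mem _)

end IndexPSetup

/-! ### Extending morphisms, and normal subgroups -/

namespace IsToralPair

variable {p : ℕ} [hp : Fact p.Prime] {S : Type*} [Group S] {T : Subgroup S} {r : ℕ}

theorem finite_torsion_of_comm (h : IsToralPair p T r) {K : Subgroup S}
    (hK : ∀ x ∈ K, ∀ y ∈ K, x * y = y * x) (n : ℕ) :
    ({x : S | x ∈ K ∧ x ^ p ^ n = 1} : Set S).Finite := by
  have hn := h.normal
  have : T.FiniteIndex := ⟨h.index_ne_zero⟩
  let iT : CommGroup T := { (inferInstance : Group T) with mul_comm := h.torus.mul_comm }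
  have hT := finite_torsion (M := T) (p := p) h.torus.finite_socle n
  have hT' : ({x : S | x ∈ T ∧ x ^ p ^ n = 1} : Set S).Finite := by
    refine Set.Finite.subset (Set.finite_range fun x : {x : T // x ^ p ^ n = 1} => (x.1 : S)) ?_
    rintro x ⟨hx, hx'⟩
    exact ⟨⟨⟨x, hx⟩, Subtype.ext (by simpa using hx')⟩, rfl⟩
  let E := {x : S // x ∈ K ∧ x ^ p ^ n = 1}
  let f : E → S ⧸ T := fun x => QuotientGroup.mk x.1
  have hE : Finite E := by
    refine Set.finite_univ_iff.1
      (Set.Finite.preimage' (f := f) (Set.toFinite Set.univ) fun y _ => ?_)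
    by_cases hy : ∃ x, f x = y
    · obtain ⟨x, hx⟩ := hy
      refine Set.Finite.subset (Set.Finite.preimage (f := fun z : E => x.1⁻¹ * z.1) ?_ hT') ?_
      · intro a _ b _ hab
        exact Subtype.ext (mul_left_cancel hab)
      · intro z hz
        have h1 : f x = f z := hx.trans hz.symm
        refine ⟨QuotientGroup.eq.1 h1, ?_⟩
        have hc : Commute (x.1⁻¹) z.1 := hK _ (K.inv_mem x.2.1) _ z.2.1
        rw [hc.mul_pow, inv_pow, x.2.2, z.2.2, inv_one, one_mul]
    · convert Set.finite_empty
      ext z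
      simp only [Set.mem_preimage, Set.mem_singleton_iff, Set.mem_empty_iff_false, iff_false]
      exact fun hz => hy ⟨z, hz⟩
  exact hE

end IsToralPair

namespace FusionSystem

variable {S : Type*} [Group S] {F : FusionSystem S}

/-- A morphism from an abelian group to itself is surjective. -/
theorem Mor.iso_of_mapsTo {p : ℕ} [hp : Fact p.Prime] {T : Subgroup S} {r : ℕ}
    (h : IsToralPair p T r) {K : Subgroup S} (hK : ∀ x ∈ K, ∀ y ∈ K, x * y = y * x) {g : S → S}
    (hg : F.Mor K g) (hgK : ∀ x ∈ K, g x ∈ K) : F.Iso K K g := by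
  refine ⟨hg, fun y => ⟨fun hy => ?_, by rintro ⟨x, hx, rfl⟩; exact hgK x hx⟩⟩
  obtain ⟨n, hn⟩ := h.isPGroup y
  -- The p^n-torsion of K is finite and mapped injectively into itself, so y has a preimage there.
  have hfin := h.finite_torsion_of_comm hK n
  have : Finite {x : S // x ∈ K ∧ x ^ p ^ n = 1} := hfin
  let f : {x : S // x ∈ K ∧ x ^ p ^ n = 1} → {x : S // x ∈ K ∧ x ^ p ^ n = 1} := fun x =>
    ⟨g x.1, hgK _ x.2.1, by rw [← hg.map_pow x.2.1, x.2.2, hg.map_one]⟩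
  have hf : Function.Injective f := fun a b hab =>
    Subtype.ext (hg.inj a.2.1 b.2.1 (congrArg Subtype.val hab))
  obtain ⟨x, hx⟩ := Finite.surjective_of_injective hf ⟨y, hy, hn⟩
  exact ⟨x.1, x.2.1, congrArg Subtype.val hx⟩

theorem Mor.mem_of_mem_sup {P Q K : Subgroup S} {g : S → S} (hg : F.Mor (P ⊔ Q) g)
    (hP : ∀ x ∈ P, g x ∈ K) (hQ : ∀ x ∈ Q, g x ∈ K) : ∀ x ∈ P ⊔ Q, g x ∈ K := by
  intro x hx
  have hx' : x ∈ Subgroup.closure ((P : Set S) ∪ Q) := Subgroup.sup_eq_closure P Q ▸ hx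
  refine (Subgroup.closure_induction (p := fun x _ => x ∈ P ⊔ Q ∧ g x ∈ K) ?_ ?_ ?_ ?_ hx').2
  · rintro x (hx | hx)
    · exact ⟨(le_sup_left : P ≤ P ⊔ Q) hx, hP x hx⟩
    · exact ⟨(le_sup_right : Q ≤ P ⊔ Q) hx, hQ x hx⟩
  · exact ⟨Subgroup.one_mem _, hg.map_one.symm ▸ K.one_mem⟩
  · rintro x y - - ⟨hx, hx'⟩ ⟨hy, hy'⟩
    exact ⟨Subgroup.mul_mem _ hx hy, hg.map_mul hx hy ▸ K.mul_mem hx' hy'⟩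
  · rintro x - ⟨hx, hx'⟩
    exact ⟨Subgroup.inv_mem _ hx, hg.map_inv hx ▸ K.inv_mem hx'⟩

theorem isNormal_of_exists_extension {Q : Subgroup S}
    (H : ∀ (R R' : Subgroup S) (f : S → S), F.Iso R R' f → ∃ g, F.Mor (Q ⊔ R) g ∧
      (∀ x ∈ R, g x = f x) ∧ ∀ y, y ∈ Q ↔ ∃ x ∈ Q, g x = y) : F.IsNormal Q := by
  intro R R' φ hφ
  obtain ⟨f, hf, hfφ⟩ := exists_mor hφ
  obtain ⟨R₁, hR₁⟩ := hf.exists_iso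
  obtain ⟨g, hg, hgf, hgQ⟩ := H R R₁ f hR₁
  obtain ⟨ψ, hψ, hψg⟩ := hg.exists_hom (Q := Q ⊔ R') (hg.mem_of_mem_sup
    (fun x hx => (le_sup_left : Q ≤ Q ⊔ R') ((hgQ _).2 ⟨x, hx, rfl⟩))
    (fun x hx => (le_sup_right : R' ≤ Q ⊔ R') (by
      rw [hgf x hx, hfφ ⟨x, hx⟩]
      exact Subtype.mem _)))
  refine ⟨ψ, hψ, ⟨le_sup_right, fun x => ?_⟩, ?_⟩
  · rw [hψg, ← hfφ]
    exact hgf x x.2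
  · ext y
    rw [hgQ y]
    constructor
    · rintro ⟨x, hx, rfl⟩
      exact ⟨x, Subgroup.mem_subgroupOf.1 hx, (hψg x).symm⟩
    · rintro ⟨x, hx, rfl⟩
      exact ⟨⟨x, (le_sup_left : Q ≤ Q ⊔ R) hx⟩, Subgroup.mem_subgroupOf.2 hx, hψg _⟩

/-- It suffices to extend morphisms onto receptive subgroups: given R ≅ R₁, both are mapped to a
receptive conjugate R', and one extension is composed with the inverse of the other. -/
theorem isNormal_of_receptive {Q : Subgroup S}
    (H₁ : ∀ R : Subgroup S, ∃ R' f, F.Iso R R' f ∧ F.Receptive R')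
    (H₂ : ∀ (R R' : Subgroup S) (f : S → S), F.Iso R R' f → F.Receptive R' →
      ∃ g, F.Mor (Q ⊔ R) g ∧ (∀ x ∈ R, g x = f x) ∧ ∀ y, y ∈ Q ↔ ∃ x ∈ Q, g x = y) :
    F.IsNormal Q := by
  refine isNormal_of_exists_extension fun R R₁ f hf => ?_
  obtain ⟨R', f₂, hf₂, hR'⟩ := H₁ R₁
  obtain ⟨g₁, hg₁, hgf₁, hgQ₁⟩ := H₂ R R' _ (hf.trans hf₂) hR'
  obtain ⟨g₂, hg₂, hgf₂, hgQ₂⟩ := H₂ R₁ R' f₂ hf₂ hR'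
  obtain ⟨K, hK⟩ := hg₂.exists_iso
  obtain ⟨k, hk, hkg, hgk⟩ := hK.exists_symm
  have hQK : ∀ x ∈ Q, x ∈ K := fun x hx => by
    obtain ⟨y, hy, rfl⟩ := (hgQ₂ x).1 hx
    exact hK.mem ((le_sup_left : Q ≤ Q ⊔ R₁) hy)
  have hRK : ∀ x ∈ R', x ∈ K := fun x hx => by
    obtain ⟨y, hy, rfl⟩ := hf₂.exists_mem hx
    rw [← hgf₂ y hy]
    exact hK.mem ((le_sup_right : R₁ ≤ Q ⊔ R₁) hy)
  have hmap : ∀ x ∈ Q ⊔ R, g₁ x ∈ K := hg₁.mem_of_mem_sup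
    (fun x hx => hQK _ ((hgQ₁ _).2 ⟨x, hx, rfl⟩))
    (fun x hx => hRK _ (by rw [hgf₁ x hx]; exact hf₂.mem (hf.mem hx)))
  refine ⟨_, hg₁.comp hk.1 hmap, fun x hx => ?_, fun y => ⟨fun hy => ?_, ?_⟩⟩
  · have h1 := hf.mem hx
    change k (g₁ x) = f x
    rw [hgf₁ x hx, ← hgf₂ _ h1, hkg _ ((le_sup_right : R₁ ≤ Q ⊔ R₁) h1)]
  · have h1 : g₂ y ∈ Q := (hgQ₂ _).2 ⟨y, hy, rfl⟩
    obtain ⟨x, hx, hxy⟩ := (hgQ₁ _).1 h1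
    refine ⟨x, hx, ?_⟩
    rw [hxy, hkg _ ((le_sup_left : Q ≤ Q ⊔ R₁) hy)]
  · rintro ⟨x, hx, rfl⟩
    have h1 : g₁ x ∈ Q := (hgQ₁ _).2 ⟨x, hx, rfl⟩
    obtain ⟨y, hy, hxy⟩ := (hgQ₂ _).1 h1
    change k (g₁ x) ∈ Q
    rw [← hxy, hkg _ ((le_sup_left : Q ≤ Q ⊔ R₁) hy)]
    exact hy

variable {p : ℕ} [hp : Fact p.Prime] {T : Subgroup S} {r : ℕ}

/-- A centralizer containing T has full rank, which provides a conjugate of maximal size whose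
centralizer again contains T. -/
theorem exists_fullyCentralized (h : IsToralPair p T r) {R R₀ : Subgroup S} {f : S → S}
    (hf : F.Iso R R₀ f) (hT : T ≤ Subgroup.centralizer (R₀ : Set S)) :
    ∃ R' g, F.Iso R R' g ∧ F.FullyCentralized p R' ∧ T ≤ Subgroup.centralizer (R' : Set S) := by
  obtain ⟨⟨R', g, hg⟩, hTR, hmax⟩ := h.exists_maximal
    (fun i : {R' : Subgroup S // ∃ g, F.Iso R R' g} => Subgroup.centralizer (i.1 : Set S))
    ⟨R₀, f, hf⟩ hT
  refine ⟨R', g, hg, fun Q hQ => ?_, hTR⟩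
  obtain ⟨k, hk⟩ := hQ.exists_iso
  exact hmax ⟨Q, _, hg.trans hk⟩

theorem exists_fullyNormalized (h : IsToralPair p T r) {R R₀ : Subgroup S} {f : S → S}
    (hf : F.Iso R R₀ f) (hT : T ≤ Subgroup.normalizer (R₀ : Set S)) :
    ∃ R' g, F.Iso R R' g ∧ F.FullyNormalized p R' := by
  obtain ⟨⟨R', g, hg⟩, hTR, hmax⟩ := h.exists_maximal
    (fun i : {R' : Subgroup S // ∃ g, F.Iso R R' g} => Subgroup.normalizer (i.1 : Set S))
    ⟨R₀, f, hf⟩ hT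
  refine ⟨R', g, hg, fun Q hQ => ?_⟩
  obtain ⟨k, hk⟩ := hQ.exists_iso
  exact hmax ⟨Q, _, hg.trans hk⟩

/-- The image of T is divisible, hence contained in T. -/
theorem Mor.iso_torus (h : IsToralPair p T r) {g : S → S} (hg : F.Mor T g) : F.Iso T T g := by
  refine hg.iso_of_mapsTo h (fun x hx y hy => ?_) ?_
  · simpa using congrArg Subtype.val (h.torus.mul_comm ⟨x, hx⟩ ⟨y, hy⟩)
  · obtain ⟨Q, hQ⟩ := hg.exists_iso
    have hQT : Q ≤ T := h.le_of_pDivisible fun d hd => by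
      obtain ⟨x, hx, rfl⟩ := hQ.exists_mem hd
      obtain ⟨y, hy, rfl⟩ := h.torus.pDivisible x hx
      exact ⟨g y, hQ.mem hy, (hg.map_pow hy p).symm⟩
    exact fun x hx => hQT (hQ.mem hx)

/-- A central T lies in every centralizer, so each isomorphism onto a receptive subgroup extends
over it. -/
theorem IsSaturated.isNormal_torus_of_le_center (hF : F.IsSaturated p) (h : IsToralPair p T r)
    (hT : T ≤ Subgroup.center S) : F.IsNormal T := by
  refine isNormal_of_receptive (fun R => ?_) fun R R' f hf hR' => ?_
  · obtain ⟨R', g, hg, hR', -⟩ := exists_fullyCentralized h (Iso.refl (F := F) R)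
      (hT.trans (Subgroup.center_le_centralizer _))
    exact ⟨R', g, hg, hF.extension R' hR'⟩
  · obtain ⟨g, hg, hgf⟩ := hR'.exists_extension_centralizer hf
    have hle : T ⊔ R ≤ R ⊔ Subgroup.centralizer (R : Set S) :=
      sup_le ((hT.trans (Subgroup.center_le_centralizer _)).trans le_sup_right) le_sup_left
    have hg' := hg.restrict hle
    exact ⟨g, hg', hgf, (hg'.restrict le_sup_left).iso_torus h |>.2⟩

end FusionSystem

/-! ### Fusion systems over groups with an abelian subgroup of index `p` -/

/-- A saturated fusion system, without nontrivial normal subgroups, over a group `S` with an abelian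
subgroup `A` of index `p` and a noncentral torus `T`. -/
structure FusionSetup (p : ℕ) {S : Type*} [Group S] (F : FusionSystem S) (A T : Subgroup S)
    (r : ℕ) : Prop where
  base : IndexPSetup p A T r
  noncentral : ¬ T ≤ Subgroup.center S
  saturated : F.IsSaturated p
  odd : Odd p
  eq_bot_of_isNormal : ∀ P, F.IsNormal P → P = ⊥

/-- `Q` is a central subgroup which is invariant under `Aut_F(A)`. -/
structure CentralInvariant {S : Type*} [Group S] (F : FusionSystem S) (A Q : Subgroup S) :
    Prop where
  le_center : Q ≤ Subgroup.center S
  map_mem : ∀ g, F.Mor A g → ∀ q ∈ Q, g q ∈ Q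

namespace FusionSetup

open FusionSystem

variable {p : ℕ} [hp : Fact p.Prime] {S : Type*} [Group S] {F : FusionSystem S}
  {A T : Subgroup S} {r : ℕ}

/-- If g(a) ∉ A, then g(a) commutes with g(T) = T, which makes T central. -/
theorem iso_of_mor (h : FusionSetup p F A T r) {g : S → S} (hg : F.Mor A g) : F.Iso A A g := by
  refine hg.iso_of_mapsTo h.base.pair h.base.comm fun a ha => ?_
  by_contra hga
  refine h.noncentral fun t ht => ?_
  obtain ⟨t', ht', rfl⟩ := (hg.restrict h.base.torus_le).iso_torus h.base.pair |>.exists_mem ht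
  have ht'A := h.base.torus_le ht'
  refine h.base.mem_center_of_comm hga (h.base.torus_le ht) ?_
  rw [← hg.map_mul ht'A ha, ← hg.map_mul ha ht'A, h.base.comm _ ht'A _ ha]

/-- T contains a noncentral element of A, and its centralizer lies in A. So being contained in A is
visible in the rank of the centralizer, and passes to fully centralized conjugates. -/
theorem torus_le_centralizer_iff (h : FusionSetup p F A T r) {R : Subgroup S} :
    T ≤ Subgroup.centralizer (R : Set S) ↔ R ≤ A := by
  constructor
  · intro hR x hx
    obtain ⟨t, ht, htZ⟩ := SetLike.not_le_iff_exists.1 h.noncentral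
    exact h.base.mem_of_comm (h.base.torus_le ht) htZ
      (Subgroup.mem_centralizer_iff.1 (hR ht) x hx).symm
  · intro hR t ht
    exact Subgroup.mem_centralizer_iff.2 fun x hx => h.base.comm x (hR hx) t (h.base.torus_le ht)

theorem exists_receptive_le (h : FusionSetup p F A T r) {R R₀ : Subgroup S} {f : S → S}
    (hf : F.Iso R R₀ f) (hR₀ : R₀ ≤ A) :
    ∃ R' g, F.Iso R R' g ∧ F.Receptive R' ∧ R' ≤ A := by
  obtain ⟨R', g, hg, hR', hT⟩ := exists_fullyCentralized h.base.pair hf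
    (h.torus_le_centralizer_iff.2 hR₀)
  exact ⟨R', g, hg, h.saturated.extension R' hR', h.torus_le_centralizer_iff.1 hT⟩

theorem exists_comm_iff (h : FusionSetup p F A T r) {R : Subgroup S} (hR : ¬ R ≤ A) :
    ((∀ x ∈ R, ∀ y ∈ R, x * y = y * x) →
      (Subgroup.center S).relIndex (Subgroup.centralizer (R : Set S)) = p) ∧
    ((¬ ∀ x ∈ R, ∀ y ∈ R, x * y = y * x) →
      (Subgroup.center S).relIndex (Subgroup.centralizer (R : Set S)) = 1) := by
  obtain ⟨y, hyR, hy⟩ := SetLike.not_le_iff_exists.1 hR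
  constructor
  · intro hc
    rw [h.base.centralizer_coe_eq hy hyR hc, h.base.center_relIndex_centralizer hy]
  · intro hc
    obtain ⟨a, ha, haR, haZ⟩ : ∃ a ∈ A, a ∈ R ∧ a ∉ Subgroup.center S := by
      by_contra! hcon
      have key : ∀ x ∈ R, x ∈ Subgroup.centralizer {y} := by
        intro x hx
        obtain ⟨a, ha, i, rfl⟩ := h.base.exists_mul_pow hy x
        have haR : a ∈ R := by simpa using R.mul_mem hx (R.inv_mem (R.pow_mem hyR i))
        exact Subgroup.mul_mem _
          (IndexPSetup.center_le_centralizer y (hcon a ha haR))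
          (Subgroup.pow_mem _ (IndexPSetup.self_mem_centralizer y) i)
      exact hc fun x hx x' hx' => h.base.centralizer_comm hy x (key x hx) x' (key x' hx')
    rw [h.base.centralizer_coe_eq_center hy hyR ha haZ haR, Subgroup.relIndex_self]

/-- For a subgroup not in A, the centralizer contains Z(S) with index p or 1 according to whether
the subgroup is abelian, which is invariant under conjugacy. -/
theorem fullyCentralized_of_forall_not_le (h : FusionSetup p F A T r) {R : Subgroup S}
    (hR : ∀ Q g, F.Iso R Q g → ¬ Q ≤ A) : F.FullyCentralized p R := by
  intro Q hQ
  obtain ⟨g, hg⟩ := hQ.exists_iso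
  have h1 := h.exists_comm_iff (hR R _ (Iso.refl R))
  have h2 := h.exists_comm_iff (hR Q g hg)
  have hiff : (∀ x ∈ R, ∀ y ∈ R, x * y = y * x) ↔ ∀ x ∈ Q, ∀ y ∈ Q, x * y = y * x := by
    constructor
    · intro hc x hx y hy
      obtain ⟨x, hx', rfl⟩ := hg.exists_mem hx
      obtain ⟨y, hy', rfl⟩ := hg.exists_mem hy
      rw [← hg.1.map_mul hx' hy', ← hg.1.map_mul hy' hx', hc x hx' y hy']
    · intro hc x hx y hy
      refine hg.1.inj (R.mul_mem hx hy) (R.mul_mem hy hx) ?_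
      rw [hg.1.map_mul hx hy, hg.1.map_mul hy hx, hc _ (hg.mem hx) _ (hg.mem hy)]
  have hZ := Subgroup.center_le_centralizer (G := S)
  by_cases hc : ∀ x ∈ R, ∀ y ∈ R, x * y = y * x
  · have h3 := h1.1 hc
    have h4 := h2.1 (hiff.1 hc)
    exact h.base.pair.toralSizeLE_of_relIndex_eq (hZ _) (hZ _) (h4.trans_ne hp.out.ne_zero)
      (h4.trans h3.symm)
  · have h3 := h1.2 hc
    have h4 := h2.2 (mt hiff.2 hc)
    exact h.base.pair.toralSizeLE_of_relIndex_eq (hZ _) (hZ _) (h4.trans_ne one_ne_zero)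
      (h4.trans h3.symm)

theorem exists_receptive (h : FusionSetup p F A T r) (R : Subgroup S) :
    ∃ R' f, F.Iso R R' f ∧ F.Receptive R' := by
  by_cases hR : ∃ Q g, F.Iso R Q g ∧ Q ≤ A
  · obtain ⟨Q, g, hg, hQ⟩ := hR
    obtain ⟨R', f, hf, hR', -⟩ := h.exists_receptive_le hg hQ
    exact ⟨R', f, hf, hR'⟩
  · push Not at hR
    exact ⟨R, _, Iso.refl R, h.saturated.extension R (h.fullyCentralized_of_forall_not_le hR)⟩

/-- Isomorphisms between subgroups of `A` extend to `A`. -/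
theorem exists_extension_of_le (h : FusionSetup p F A T r) {W W' : Subgroup S} {f : S → S}
    (hf : F.Iso W W' f) (hW : W ≤ A) (hW' : W' ≤ A) :
    ∃ g, F.Iso A A g ∧ ∀ x ∈ W, g x = f x := by
  obtain ⟨R, f₂, hf₂, hR, -⟩ := h.exists_receptive_le (Iso.refl (F := F) W') hW'
  have hA : ∀ {V : Subgroup S}, V ≤ A → A ≤ V ⊔ Subgroup.centralizer (V : Set S) := by
    intro V hV a ha
    refine (le_sup_right : _ ≤ V ⊔ Subgroup.centralizer (V : Set S)) ?_
    exact Subgroup.mem_centralizer_iff.2 fun x hx => h.base.comm x (hV hx) a ha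
  obtain ⟨g₁, hg₁, hgf₁⟩ := hR.exists_extension_centralizer (hf.trans hf₂)
  obtain ⟨g₂, hg₂, hgf₂⟩ := hR.exists_extension_centralizer hf₂
  have i₁ := h.iso_of_mor (hg₁.restrict (hA hW))
  have i₂ := h.iso_of_mor (hg₂.restrict (hA hW'))
  obtain ⟨k, hk, hkg, -⟩ := i₂.exists_symm
  refine ⟨_, i₁.trans hk, fun x hx => ?_⟩
  rw [hgf₁ x hx, ← hgf₂ _ (hf.mem hx), hkg _ (hW' (hf.mem hx))]

theorem exists_extension_of_mem (h : FusionSetup p F A T r) {a : S} {f : S → S} (ha : a ∈ A)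
    (hf : F.Mor (Subgroup.zpowers a) f) (hfa : f a ∈ A) : ∃ g, F.Iso A A g ∧ g a = f a := by
  obtain ⟨W, hW⟩ := hf.exists_iso
  have hle : Subgroup.zpowers a ≤ A := by simpa using ha
  have hWA : W ≤ A := by
    intro x hx
    obtain ⟨y, ⟨n, rfl⟩, rfl⟩ := hW.exists_mem hx
    cases n with
    | ofNat n =>
      change f (a ^ (n : ℤ)) ∈ A
      rw [zpow_natCast, hf.map_pow (Subgroup.mem_zpowers a)]
      exact A.pow_mem hfa n
    | negSucc n =>
      change f (a ^ (Int.negSucc n)) ∈ A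
      rw [zpow_negSucc, hf.map_inv (Subgroup.pow_mem _ (Subgroup.mem_zpowers a) _),
        hf.map_pow (Subgroup.mem_zpowers a)]
      exact A.inv_mem (A.pow_mem hfa _)
  obtain ⟨g, hg, hgf⟩ := h.exists_extension_of_le hW hle hWA
  exact ⟨g, hg, hgf a (Subgroup.mem_zpowers a)⟩

theorem zpowers_iso {a : S} {f : S → S} (hf : F.Mor (Subgroup.zpowers a) f) :
    F.Iso (Subgroup.zpowers a) (Subgroup.zpowers (f a)) f := by
  have key : ∀ n : ℤ, f (a ^ n) = f a ^ n := by
    intro n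
    cases n with
    | ofNat n => 
      change f (a ^ (n : ℤ)) = f a ^ (n : ℤ)
      rw [zpow_natCast, zpow_natCast, hf.map_pow (Subgroup.mem_zpowers a)]
    | negSucc n =>
      rw [zpow_negSucc, zpow_negSucc, hf.map_inv (Subgroup.pow_mem _ (Subgroup.mem_zpowers a) _),
        hf.map_pow (Subgroup.mem_zpowers a)]
  refine ⟨hf, fun y => ⟨?_, ?_⟩⟩
  · rintro ⟨n, rfl⟩
    exact ⟨a ^ n, ⟨n, rfl⟩, key n⟩
  · rintro ⟨_, ⟨n, rfl⟩, rfl⟩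
    exact ⟨n, (key n).symm⟩

/-- Its centralizer is S, so it is fully centralized. -/
theorem receptive_of_le_center (h : FusionSetup p F A T r) {R : Subgroup S}
    (hR : R ≤ Subgroup.center S) : F.Receptive R := by
  refine h.saturated.extension R fun Q _ => ?_
  rw [show Subgroup.centralizer (R : Set S) = ⊤ from
    Subgroup.centralizer_eq_top_iff_subset.2 hR]
  exact h.base.pair.toralSizeLE_top _

/-- Fusion of central elements is controlled by `Aut_F(S)`. -/
theorem exists_mor_top (h : FusionSetup p F A T r) {z : S} {f : S → S}
    (hz : z ∈ Subgroup.center S) (hf : F.Mor (Subgroup.zpowers z) f)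
    (hfz : f z ∈ Subgroup.center S) : ∃ g, F.Mor ⊤ g ∧ g z = f z := by
  have hle : ∀ {x : S}, x ∈ Subgroup.center S → Subgroup.zpowers x ≤ Subgroup.center S :=
    fun hx => by simpa using hx
  obtain ⟨g, hg, hgf⟩ := (h.receptive_of_le_center (hle hfz)).exists_extension_centralizer
    (zpowers_iso hf)
  refine ⟨g, hg.restrict ?_, hgf z (Subgroup.mem_zpowers z)⟩
  rw [show Subgroup.centralizer (Subgroup.zpowers z : Set S) = ⊤ from
    Subgroup.centralizer_eq_top_iff_subset.2 (hle hz)]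
  exact le_sup_right

/-- A morphism between central elements is realized by one defined on S, and this restricts to A,
whose automorphisms preserve Q. -/
theorem mem_of_mor (h : FusionSetup p F A T r) {Q P : Subgroup S} (hQ : CentralInvariant F A Q)
    {q : S} {f : S → S} (hq : q ∈ Q) (hqP : q ∈ P) (hf : F.Mor P f)
    (hfq : f q ∈ Subgroup.center S) : f q ∈ Q := by
  obtain ⟨g, hg, hgq⟩ := h.exists_mor_top (hQ.le_center hq)
    (hf.restrict (Subgroup.zpowers_le.2 hqP)) hfq
  rw [← hgq]
  exact hQ.map_mem g (hg.restrict le_top) q hq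

/-- A morphism from `C_S(y)` to `A` extends to the normalizer of `C_S(y)`, up to an
automorphism of `A`. -/
theorem exists_extension_into (h : FusionSetup p F A T r) {y : S} {θ : S → S}
    (hθ : F.Mor (Subgroup.centralizer {y}) θ) (hθA : ∀ x ∈ Subgroup.centralizer {y}, θ x ∈ A) :
    ∃ g k, F.Iso A A g ∧ F.Mor (Subgroup.normalizer (Subgroup.centralizer {y} : Set S)) k ∧
      ∀ x ∈ Subgroup.centralizer {y}, k x = g (θ x) := by
  obtain ⟨P, hP⟩ := hθ.exists_iso
  have hPA : P ≤ A := fun x hx => by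
    obtain ⟨x, hx', rfl⟩ := hP.exists_mem hx
    exact hθA x hx'
  have hTC := h.torus_le_centralizer_iff.2 hPA
  obtain ⟨R, j, hj, hR⟩ := exists_fullyNormalized h.base.pair (Iso.refl (F := F) P)
    (hTC.trans (Subgroup.centralizer_le_normalizer _))
  -- The fully normalized conjugate R is fully centralized, so C_S(R) has full rank like C_S(P) and
  -- contains T.
  have hRA : R ≤ A := h.torus_le_centralizer_iff.1
    (h.base.pair.le_of_toralSizeLE hTC ((h.saturated.sylow R hR).2 P hj.isConj_symm))
  obtain ⟨α, k, hα, hk, hkα⟩ := h.saturated.exists_extension_normalizer h.base.pair.isPGroup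
    (fun x hx y hy => h.base.comm x (hRA hx) y (hRA hy)) hR (hP.trans hj)
  obtain ⟨g, hg, hgα⟩ := h.exists_extension_of_le (hj.trans hα) hPA hRA
  exact ⟨g, k, hg, hk, fun x hx => (hkα x hx).trans (hgα _ (hP.mem hx)).symm⟩

/-! ### Morphisms from C_S(y) into A, extended to the normalizer -/

section Into

variable {y : S} {θ g k : S → S}

/-- If k(b) ∈ A then k(b) commutes with k(y) ∈ A, so b commutes with y ∉ A and is central. -/
theorem notMem_of_secondCenter (h : FusionSetup p F A T r) (hy : y ∉ A)
    (hk : F.Mor (Subgroup.normalizer (Subgroup.centralizer {y} : Set S)) k)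
    (hkA : ∀ x ∈ Subgroup.centralizer {y}, k x ∈ A) {b : S} (hb : b ∈ secondCenter A)
    (hbZ : b ∉ Subgroup.center S) : k b ∉ A := by
  intro hkb
  have hyC := IndexPSetup.self_mem_centralizer y
  have hyN := Subgroup.le_normalizer (H := Subgroup.centralizer {y}) hyC
  have hbN := (h.base.normalizer_relIndex hy).1 hb
  refine hbZ (h.base.mem_center_of_comm hy hb.1 (hk.inj (Subgroup.mul_mem _ hbN hyN)
    (Subgroup.mul_mem _ hyN hbN) ?_))
  rw [hk.map_mul hbN hyN, hk.map_mul hyN hbN, h.base.comm _ hkb _ (hkA y hyC)]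

/-- For b in the second center but not central, k(b) ∉ A commutes with k(z) ∈ A. -/
theorem map_center_mem (h : FusionSetup p F A T r) (hy : y ∉ A)
    (hk : F.Mor (Subgroup.normalizer (Subgroup.centralizer {y} : Set S)) k)
    (hkA : ∀ x ∈ Subgroup.centralizer {y}, k x ∈ A) {z : S} (hz : z ∈ Subgroup.center S) :
    k z ∈ Subgroup.center S := by
  obtain ⟨b, hb, hbZ⟩ := h.base.exists_mem_secondCenter h.odd
  have hkb := h.notMem_of_secondCenter hy hk hkA hb hbZ
  have hbN := (h.base.normalizer_relIndex hy).1 hb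
  have hzC := IndexPSetup.center_le_centralizer y hz
  have hzN := Subgroup.le_normalizer (H := Subgroup.centralizer {y}) hzC
  refine h.base.mem_center_of_comm hkb (hkA z hzC) ?_
  rw [← hk.map_mul hbN hzN, ← hk.map_mul hzN hbN, Subgroup.mem_center_iff.1 hz b]

/-- If θ(y) ∈ Q, then the extension k to the normalizer, which is θ up to Aut_F(A), sends y into Q
and hence into the center; so y would commute with the whole second center. -/
theorem notMem_of_into (h : FusionSetup p F A T r) (hy : y ∉ A)
    (hθ : F.Mor (Subgroup.centralizer {y}) θ) (hθA : ∀ x ∈ Subgroup.centralizer {y}, θ x ∈ A)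
    {Q : Subgroup S} (hQ : CentralInvariant F A Q) : θ y ∉ Q := by
  intro hyQ
  obtain ⟨g, k, hg, hk, hkg⟩ := h.exists_extension_into hθ hθA
  have hkA : ∀ x ∈ Subgroup.centralizer {y}, k x ∈ A := fun x hx => by
    rw [hkg x hx]
    exact hg.mem (hθA x hx)
  obtain ⟨b, hb, hbZ⟩ := h.base.exists_mem_secondCenter h.odd
  have hyC := IndexPSetup.self_mem_centralizer y
  have hyN := Subgroup.le_normalizer (H := Subgroup.centralizer {y}) hyC
  have hbN := (h.base.normalizer_relIndex hy).1 hb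
  have hky : k y ∈ Subgroup.center S := by
    rw [hkg y hyC]
    exact hQ.le_center (hQ.map_mem g hg.1 _ hyQ)
  refine hbZ (h.base.mem_center_of_comm hy hb.1 (hk.inj (Subgroup.mul_mem _ hbN hyN)
    (Subgroup.mul_mem _ hyN hbN) ?_))
  rw [hk.map_mul hbN hyN, hk.map_mul hyN hbN, Subgroup.mem_center_iff.1 hky]

end Into

end FusionSetup

/-! ### The group `Z(S) ∩ [A, S]` -/

namespace IndexPSetup

variable {p : ℕ} [hp : Fact p.Prime] {S : Type*} [Group S] {A T : Subgroup S} {r : ℕ}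

theorem commutator_pow (h : IndexPSetup p A T r) {b s : S} (hb : b ∈ A) (i : ℕ) :
    b ^ i * s * (b ^ i)⁻¹ * s⁻¹ = (b * s * b⁻¹ * s⁻¹) ^ i := by
  induction i with
  | zero => simp
  | succ i ih => rw [pow_succ, h.commutator_mul (A.pow_mem hb i) hb, ih, pow_succ]

theorem commutator_pow_right {b s : S} (hb : b ∈ secondCenter A) (i : ℕ) :
    b * s ^ i * b⁻¹ * (s ^ i)⁻¹ = (b * s * b⁻¹ * s⁻¹) ^ i := by
  have hc := Subgroup.mem_center_iff.1 (hb.2 s)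
  have h1 : b * s * b⁻¹ = (b * s * b⁻¹ * s⁻¹) * s := by group
  have h2 : Commute (b * s * b⁻¹ * s⁻¹) s := (hc s).symm
  have h3 : b * s ^ i * b⁻¹ = (b * s * b⁻¹) ^ i := (conj_pow (i := i)).symm
  rw [h3, h1, h2.mul_pow, mul_inv_cancel_right, mul_inv_cancel_right]

variable (A) in
/-- The subgroup `Z(S) ∩ [A, S]`. -/
def centerComm (h : IndexPSetup p A T r) : Subgroup S where
  carrier := {w | w ∈ commSet A ∧ w ∈ Subgroup.center S}
  one_mem' := ⟨⟨1, A.one_mem, 1, by simp⟩, Subgroup.one_mem _⟩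
  mul_mem' := by
    rintro v w ⟨hv, hv'⟩ ⟨hw, hw'⟩
    obtain ⟨y, hy⟩ := h.exists_notMem
    obtain ⟨a, ha, rfl⟩ := (h.mem_commSet hy).1 hv
    obtain ⟨b, hb, rfl⟩ := (h.mem_commSet hy).1 hw
    exact ⟨⟨a * b, A.mul_mem ha hb, y, h.commutator_mul ha hb⟩, Subgroup.mul_mem _ hv' hw'⟩
  inv_mem' := by
    rintro v ⟨⟨a, ha, y, rfl⟩, hv'⟩
    refine ⟨⟨a⁻¹, A.inv_mem ha, y, ?_⟩, Subgroup.inv_mem _ hv'⟩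
    rw [eq_comm, inv_eq_iff_mul_eq_one, ← h.commutator_mul ha (A.inv_mem ha)]
    simp

theorem mem_centerComm (h : IndexPSetup p A T r) {w : S} :
    w ∈ centerComm A h ↔ w ∈ commSet A ∧ w ∈ Subgroup.center S := Iff.rfl

theorem commutator_mem_centerComm (h : IndexPSetup p A T r) {b : S} (hb : b ∈ secondCenter A)
    (s : S) : b * s * b⁻¹ * s⁻¹ ∈ centerComm A h :=
  ⟨⟨b, hb.1, s, rfl⟩, hb.2 s⟩

theorem exists_secondCenter_of_mem (h : IndexPSetup p A T r) {y w : S} (hy : y ∉ A)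
    (hw : w ∈ centerComm A h) : ∃ b ∈ secondCenter A, b * y * b⁻¹ * y⁻¹ = w := by
  obtain ⟨b, hb, rfl⟩ := (h.mem_commSet hy).1 hw.1
  exact ⟨b, h.mem_secondCenter_of_commutator hy hb hw.2, rfl⟩

theorem commutator_ne_one (h : IndexPSetup p A T r) {y b : S} (hy : y ∉ A)
    (hb : b ∈ secondCenter A) (hbZ : b ∉ Subgroup.center S) : b * y * b⁻¹ * y⁻¹ ≠ 1 := by
  intro h1
  refine hbZ (h.mem_center_of_comm hy hb.1 ?_)
  rw [mul_inv_eq_one, mul_inv_eq_iff_eq_mul] at h1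
  exact h1

/-- [b,y]^p = [b,y^p] for b in the second center, and y^p is central. -/
theorem pow_eq_one_of_mem_centerComm (h : IndexPSetup p A T r) {w : S}
    (hw : w ∈ centerComm A h) : w ^ p = 1 := by
  obtain ⟨y, hy⟩ := h.exists_notMem
  obtain ⟨b, hb, rfl⟩ := h.exists_secondCenter_of_mem hy hw
  rw [← commutator_pow_right hb, Subgroup.mem_center_iff.1 (h.pow_mem_center hy) b]
  group

theorem exists_mem_centerComm_ne_one (h : IndexPSetup p A T r) (hodd : Odd p) :
    ∃ w ∈ centerComm A h, w ≠ 1 := by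
  obtain ⟨y, hy⟩ := h.exists_notMem
  obtain ⟨b, hb, hbZ⟩ := h.exists_mem_secondCenter hodd
  exact ⟨_, h.commutator_mem_centerComm hb y, h.commutator_ne_one hy hb hbZ⟩

/-- `Z(S) ∩ [A, S]` is generated by each of its nontrivial elements. -/
def CenterCommCyclic (h : IndexPSetup p A T r) : Prop :=
  ∀ w ∈ centerComm A h, w ≠ 1 → ∀ w' ∈ centerComm A h, ∃ i : ℕ, w' = w ^ i

end IndexPSetup

namespace FusionSetup

open FusionSystem IndexPSetup

variable {p : ℕ} [hp : Fact p.Prime] {S : Type*} [Group S] {F : FusionSystem S}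
  {A T : Subgroup S} {r : ℕ}

/-- The extension to the normalizer embeds `secondCenter A` modulo Z(S) into S/A, of order p, and b
↦ [b,y] maps this quotient onto Z(S) ∩ [A,S]. -/
theorem centerCommCyclic_of_into (h : FusionSetup p F A T r) {y : S} {θ : S → S} (hy : y ∉ A)
    (hθ : F.Mor (Subgroup.centralizer {y}) θ) (hθA : ∀ x ∈ Subgroup.centralizer {y}, θ x ∈ A) :
    h.base.CenterCommCyclic := by
  obtain ⟨g, k, hg, hk, hkg⟩ := h.exists_extension_into hθ hθA
  have hkA : ∀ x ∈ Subgroup.centralizer {y}, k x ∈ A := fun x hx => by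
    rw [hkg x hx]
    exact hg.mem (hθA x hx)
  intro w hw hw1 w' hw'
  obtain ⟨b, hb, rfl⟩ := h.base.exists_secondCenter_of_mem hy hw
  obtain ⟨b', hb', rfl⟩ := h.base.exists_secondCenter_of_mem hy hw'
  have hbZ : b ∉ Subgroup.center S := fun hbZ => hw1 (by
    rw [← Subgroup.mem_center_iff.1 hbZ y]; group)
  have hkb := h.notMem_of_secondCenter hy hk hkA hb hbZ
  obtain ⟨a, ha, i, hi⟩ := h.base.exists_mul_pow hkb (k b')
  have hN := (h.base.normalizer_relIndex hy).1
  have hc : b' * (b ^ i)⁻¹ ∈ secondCenter A :=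
    Subgroup.mul_mem _ hb' (Subgroup.inv_mem _ (Subgroup.pow_mem _ hb i))
  have hcZ : b' * (b ^ i)⁻¹ ∈ Subgroup.center S := by
    by_contra hcZ
    refine h.notMem_of_secondCenter hy hk hkA hc hcZ ?_
    rw [hk.map_mul (hN hb') (Subgroup.inv_mem _ (Subgroup.pow_mem _ (hN hb) i)),
      hk.map_inv (Subgroup.pow_mem _ (hN hb) i), hk.map_pow (hN hb), hi, mul_inv_cancel_right]
    exact ha
  refine ⟨i, ?_⟩
  have h1 : b' = b' * (b ^ i)⁻¹ * b ^ i := by group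
  rw [← h.base.commutator_pow hb.1, h1, h.base.commutator_mul hc.1 (A.pow_mem hb.1 i),
    ← Subgroup.mem_center_iff.1 hcZ y]
  group

/-- If `C_S(y)` is not `F`-conjugate to a subgroup of `A`, and `y ∉ A` is conjugate to a central
element, then it is so under an automorphism of `C_S(y)`. -/
theorem exists_automorphism (h : FusionSetup p F A T r) {y : S} {f : S → S} (hy : y ∉ A)
    (hf : F.Mor (Subgroup.centralizer {y}) f) (hfy : f y ∈ Subgroup.center S)
    (hno : ∀ Q g, F.Iso (Subgroup.centralizer {y}) Q g → ¬ Q ≤ A) :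
    F.FullyNormalized p (Subgroup.centralizer {y}) ∧
    ∃ β, F.Iso (Subgroup.centralizer {y}) (Subgroup.centralizer {y}) β ∧
      β y ∈ Subgroup.center S ∧ ∀ Q, CentralInvariant F A Q → f y ∈ Q → β y ∈ Q := by
  set P := Subgroup.centralizer {y} with hPdef
  have hyP : y ∈ P := self_mem_centralizer y
  have hPc := h.base.centralizer_comm hy
  have hrec := h.saturated.extension P (h.fullyCentralized_of_forall_not_le hno)
  -- A conjugate Q of P is abelian and has an element y' ∉ A, so Q ≤ C_S(y'). The inverse
  -- isomorphism extends to C_S(y') with image commuting with y, hence inside P; so nothing is added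
  -- to Q.
  have hconj : ∀ Q g, F.Iso P Q g → ∃ y', y' ∉ A ∧ Q = Subgroup.centralizer {y'} := by
    intro Q g hg
    obtain ⟨y', hy'Q, hy'⟩ := SetLike.not_le_iff_exists.1 (hno Q g hg)
    have hQc : ∀ x ∈ Q, ∀ x' ∈ Q, x * x' = x' * x := by
      intro x hx x' hx'
      obtain ⟨u, hu, rfl⟩ := hg.exists_mem hx
      obtain ⟨u', hu', rfl⟩ := hg.exists_mem hx'
      rw [← hg.1.map_mul hu hu', ← hg.1.map_mul hu' hu, hPc u hu u' hu']
    refine ⟨y', hy', le_antisymm (fun x hx => mem_centralizer.2 (hQc _ hy'Q _ hx)) ?_⟩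
    obtain ⟨g', hg', hgg', hg'g⟩ := hg.exists_symm
    obtain ⟨k, hk, hkg⟩ := hrec.exists_extension_centralizer hg'
    rw [h.base.centralizer_coe_eq hy' hy'Q hQc] at hk
    have hle : Q ≤ Q ⊔ Subgroup.centralizer {y'} := le_sup_left
    intro s hs
    have hs' : s ∈ Q ⊔ Subgroup.centralizer {y'} :=
      (le_sup_right : Subgroup.centralizer {y'} ≤ Q ⊔ Subgroup.centralizer {y'}) hs
    have h1 : k s ∈ P := by
      refine mem_centralizer.2 ?_
      have h2 := hg.mem hyP
      have h3 : k (g y) = y := (hkg _ h2).trans (hgg' y hyP)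
      have h4 := h.base.centralizer_comm hy' s hs (g y) (mem_centralizer.2 (hQc _ hy'Q _ h2))
      have h5 := congrArg k h4
      rw [hk.map_mul hs' (hle h2), hk.map_mul (hle h2) hs', h3] at h5
      exact h5.symm
    obtain ⟨q, hq, hqs⟩ := hg'.exists_mem h1
    rw [← hkg q hq] at hqs
    rw [← hk.inj (hle hq) hs' hqs]
    exact hq
  have hFN : F.FullyNormalized p P := by
    intro Q hQ
    obtain ⟨g, hg⟩ := hQ.exists_iso
    obtain ⟨y', hy', rfl⟩ := hconj Q g hg
    obtain ⟨h1, h2⟩ := h.base.normalizer_relIndex hy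
    obtain ⟨h3, h4⟩ := h.base.normalizer_relIndex hy'
    exact h.base.pair.toralSizeLE_of_relIndex_eq h3 h1 (h4.trans_ne hp.out.ne_zero)
      (h4.trans h2.symm)
  refine ⟨hFN, ?_⟩
  obtain ⟨P', hP'⟩ := hf.exists_iso
  obtain ⟨y', hy', rfl⟩ := hconj P' f hP'
  obtain ⟨f', hf', hf'f, hff'⟩ := hP'.exists_symm
  obtain ⟨β, k, hβ, hk, hkβ⟩ := h.saturated.exists_extension_normalizer h.base.pair.isPGroup
    hPc hFN hf'
  have hfyP' := hP'.mem hyP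
  have hN : Subgroup.centralizer {y'} ≤
    Subgroup.normalizer (Subgroup.centralizer {y'} : Set S) := Subgroup.le_normalizer
  have hkf : ∀ x ∈ P, k (f x) = β x := fun x hx => by rw [hkβ _ (hP'.mem hx), hf'f x hx]
  have hkiso : F.Iso (Subgroup.centralizer {y'}) P k := (hf'.trans hβ).congr hkβ
  obtain ⟨b, hb, hbZ⟩ := h.base.exists_mem_secondCenter h.odd
  have hZ2 := (h.base.normalizer_relIndex hy').1
  -- If k(z) ∉ A, then k(b), which commutes with k(z), lies in Z(S)⟨y⟩ = P. So k(b) commutes with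
  -- k(y'), and b would be central.
  have hkZ : ∀ z ∈ Subgroup.center S, k z ∈ Subgroup.center S := by
    intro z hz
    have hzP' := center_le_centralizer y' hz
    have hkzP := hkiso.mem hzP'
    refine h.base.mem_center_of_mem_centralizer hy hkzP ?_
    by_contra hkzA
    obtain ⟨c, hc, i, hi⟩ := h.base.exists_mul_pow hy (k b)
    have hkN : ∀ b ∈ secondCenter A, ∀ x ∈ P, k b * x * (k b)⁻¹ ∈ P := by
      intro b hb x hx
      obtain ⟨u, hu, rfl⟩ := hkiso.exists_mem hx
      have h1 := hk.map_mul (Subgroup.mul_mem _ (hZ2 hb) (hN hu)) (Subgroup.inv_mem _ (hZ2 hb))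
      rw [hk.map_mul (hZ2 hb) (hN hu), hk.map_inv (hZ2 hb)] at h1
      rw [← h1]
      exact hkiso.mem ((Subgroup.mem_normalizer_iff.1 (hZ2 hb) u).1 hu)
    have h2 : k b * k z = k z * k b := by
      rw [← hk.map_mul (hZ2 hb) (hN hzP'), ← hk.map_mul (hN hzP') (hZ2 hb),
        Subgroup.mem_center_iff.1 hz b]
    have h3 : c * k z = k z * c := by
      have h4 : Commute (k z) (k b * (y ^ i)⁻¹) :=
        Commute.mul_right h2.symm ((show Commute (k z) (y ^ i) from
          hPc _ hkzP _ (Subgroup.pow_mem _ hyP i)).inv_right)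
      have h5 : c = k b * (y ^ i)⁻¹ := by rw [hi]; group
      rw [h5]
      exact h4.symm.eq
    have hcZ := h.base.mem_center_of_comm hkzA hc h3
    have hkbP : k b ∈ P := by
      rw [hi]
      exact Subgroup.mul_mem _ (center_le_centralizer y hcZ) (Subgroup.pow_mem _ hyP i)
    have hy'P' := self_mem_centralizer y'
    refine hbZ (h.base.mem_center_of_comm hy' hb.1 (hk.inj (Subgroup.mul_mem _ (hZ2 hb) (hN hy'P'))
      (Subgroup.mul_mem _ (hN hy'P') (hZ2 hb)) ?_))
    rw [hk.map_mul (hZ2 hb) (hN hy'P'), hk.map_mul (hN hy'P') (hZ2 hb),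
      hPc _ hkbP _ (hkiso.mem hy'P')]
  refine ⟨β, hβ, hkf y hyP ▸ hkZ _ hfy, fun Q hQ hfQ => ?_⟩
  rw [← hkf y hyP]
  exact h.mem_of_mor hQ hfQ (hN hfyP') hk (hkZ _ hfy)

end FusionSetup

/-! ### Automorphisms of `C_S(y)` moving the center -/

/-- The automorphisms in `G` of `P` which are trivial on `Z` and on `P / Z`. -/
def transvections {S : Type*} [Group S] {P : Subgroup S} (G : Subgroup (MulAut P))
    (Z : Subgroup S) : Subgroup G where
  carrier := {γ | (∀ x : P, (x : S) ∈ Z → γ.1 x = x) ∧ ∀ x : P, (γ.1 x : S) * (x : S)⁻¹ ∈ Z}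
  one_mem' := ⟨fun _ _ => rfl, fun x => by simp⟩
  mul_mem' := by
    rintro γ δ ⟨h1, h2⟩ ⟨h3, h4⟩
    refine ⟨fun x hx => ?_, fun x => ?_⟩
    · change γ.1 (δ.1 x) = x
      rw [h3 x hx, h1 x hx]
    · change (γ.1 (δ.1 x) : S) * (x : S)⁻¹ ∈ Z
      have h5 := Z.mul_mem (h2 (δ.1 x)) (h4 x)
      simpa [mul_assoc] using h5
  inv_mem' := by
    rintro γ ⟨h1, h2⟩
    have key : ∀ x : P, (γ⁻¹ : G).1 (γ.1 x) = x := fun x => MulAut.inv_apply_self P γ.1 x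
    have key' : ∀ x : P, γ.1 ((γ⁻¹ : G).1 x) = x := fun x => MulAut.apply_inv_self P γ.1 x
    refine ⟨fun x hx => ?_, fun x => ?_⟩
    · have := key x
      rwa [h1 x hx] at this
    · have h3 := Z.inv_mem (h2 ((γ⁻¹ : G).1 x))
      rw [key'] at h3
      simpa using h3

/-- The product of N and T is a p-group containing the Sylow subgroup T. -/
theorem le_of_le_normalizer {p : ℕ} {G : Type*} [Group G] (T : Sylow p G) {N : Subgroup G}
    (hN : IsPGroup p N) (hT : (T : Subgroup G) ≤ Subgroup.normalizer (N : Set G)) :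
    N ≤ (T : Subgroup G) := by
  have h1 := IsPGroup.to_sup_of_normal_right' T.isPGroup' hN hT
  have h2 := T.is_maximal' h1 le_sup_left
  exact le_sup_right.trans h2.le

theorem le_normalizer_transvections {S : Type*} [Group S] {P : Subgroup S}
    {G : Subgroup (MulAut P)} {Z : Subgroup S} {γ : G}
    (hγ : ∀ x : P, (x : S) ∈ Z → γ.1 x = x) :
    γ ∈ Subgroup.normalizer (transvections G Z : Set G) := by
  have key : ∀ δ : G, (∀ x : P, (x : S) ∈ Z → δ.1 x = x) → ∀ ν ∈ transvections G Z,
      δ * ν * δ⁻¹ ∈ transvections G Z := by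
    rintro δ hδ ν ⟨h1, h2⟩
    have e : ∀ x : P, δ.1 ((δ⁻¹ : G).1 x) = x := fun x => MulAut.apply_inv_self P δ.1 x
    have e' : ∀ x : P, (δ⁻¹ : G).1 (δ.1 x) = x := fun x => MulAut.inv_apply_self P δ.1 x
    have hδ' : ∀ x : P, (x : S) ∈ Z → (δ⁻¹ : G).1 x = x := fun x hx => by
      have := e' x
      rwa [hδ x hx] at this
    refine ⟨fun x hx => ?_, fun x => ?_⟩
    · change δ.1 (ν.1 ((δ⁻¹ : G).1 x)) = x
      rw [hδ' x hx, h1 x hx, hδ x hx]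
    · change (δ.1 (ν.1 ((δ⁻¹ : G).1 x)) : S) * (x : S)⁻¹ ∈ Z
      set u := (δ⁻¹ : G).1 x with hu
      have hx : x = δ.1 u := (e x).symm
      have h3 : ν.1 u = ⟨_, P.mul_mem (ν.1 u).2 (P.inv_mem u.2)⟩ * u := Subtype.ext (by simp)
      have h4 := hδ ⟨_, P.mul_mem (ν.1 u).2 (P.inv_mem u.2)⟩ (h2 u)
      rw [hx, h3, map_mul, h4]
      simpa using h2 u
  refine Subgroup.mem_normalizer_iff.2 fun ν => ⟨key γ hγ ν, fun hν => ?_⟩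
  have hγ' : ∀ x : P, (x : S) ∈ Z → (γ⁻¹ : G).1 x = x := fun x hx => by
    have e' : (γ⁻¹ : G).1 (γ.1 x) = x := MulAut.inv_apply_self P γ.1 x
    rwa [hγ x hx] at e'
  have := key γ⁻¹ hγ' _ hν
  simpa [mul_assoc] using this

namespace FusionSetup

open FusionSystem IndexPSetup

variable {p : ℕ} [hp : Fact p.Prime] {S : Type*} [Group S] {F : FusionSystem S}
  {A T : Subgroup S} {r : ℕ}

section Moving

variable {y : S} {β : S → S} {ZB : Subgroup S}

/-- Otherwise β restricts to an automorphism of the center, and β(y) ∈ Z(S) would force y ∈ Z(S). -/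
theorem exists_center_image_notMem (h : FusionSetup p F A T r) (hy : y ∉ A)
    (hβ : F.Iso (Subgroup.centralizer {y}) (Subgroup.centralizer {y}) β)
    (hβy : β y ∈ Subgroup.center S) : ∃ z ∈ Subgroup.center S, β z ∉ A := by
  by_contra! hcon
  have hZP := center_le_centralizer y
  have h1 : F.Iso (Subgroup.center S) (Subgroup.center S) β := by
    refine (hβ.1.restrict hZP).iso_of_mapsTo h.base.pair
      (fun x _ x' hx' => Subgroup.mem_center_iff.1 hx' x) fun z hz => ?_
    exact h.base.mem_center_of_mem_centralizer hy (hβ.mem (hZP hz)) (hcon z hz)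
  obtain ⟨z, hz, hzy⟩ := h1.exists_mem hβy
  have := hβ.1.inj (hZP hz) (self_mem_centralizer y) hzy
  exact hy (h.base.center_le (this ▸ hz))

open scoped Pointwise in
-- These automorphisms form a p-group because P^p ≤ Z ∩ β(Z). It is normalized by the Sylow subgroup
-- Aut_S(P), which centralizes Z, and by its conjugate under β, which centralizes β(Z). So it lies
-- in both, and acts trivially on Z and β(Z), which generate P.
theorem eq_one_of_mem_transvections (h : FusionSetup p F A T r) (hy : y ∉ A) {P : Subgroup S}
    (hPdef : P = Subgroup.centralizer {y}) (hFN : F.FullyNormalized p P) (hβ : F.Iso P P β)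
    (hβy : β y ∈ Subgroup.center S) (hZB : F.Iso (Subgroup.center S) ZB β)
    {γ : F.aut P}
    (hγ : γ ∈ transvections (F.aut P) (Subgroup.center S ⊓ ZB)) :
    γ = 1 := by
  have hPc : ∀ x ∈ P, ∀ x' ∈ P, x * x' = x' * x := hPdef ▸ h.base.centralizer_comm hy
  have hZP : Subgroup.center S ≤ P := hPdef ▸ center_le_centralizer y
  have hZBP : ZB ≤ P := fun x hx => by
    obtain ⟨z, hz, rfl⟩ := hZB.exists_mem hx
    exact hβ.mem (hZP hz)
  obtain ⟨hfin, Y, hY⟩ := exists_sylow_of_fullyAutomized hPc (h.saturated.sylow P hFN).1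
  set N := transvections (F.aut P) (Subgroup.center S ⊓ ZB)
  have hpow : ∀ x ∈ P, x ^ p ∈ Subgroup.center S := by
    intro x hx
    by_cases hxA : x ∈ A
    · exact Subgroup.pow_mem _ (h.base.mem_center_of_mem_centralizer hy (hPdef ▸ hx) hxA) p
    · exact h.base.pow_mem_center hxA
  have hpow' : ∀ x ∈ P, x ^ p ∈ Subgroup.center S ⊓ ZB := by
    intro x hx
    refine ⟨hpow x hx, ?_⟩
    obtain ⟨u, hu, rfl⟩ := hβ.exists_mem hx
    rw [← hβ.1.map_pow hu]
    exact hZB.mem (hpow u hu)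
  have hNp : IsPGroup p N := by
    rintro ⟨ν, hν⟩
    refine ⟨1, Subtype.ext (Subtype.ext (MulEquiv.ext fun x => Subtype.ext ?_))⟩
    obtain ⟨c, hc⟩ : ∃ c : P, c = ν.1 x * x⁻¹ := ⟨_, rfl⟩
    have hcZ : (c : S) ∈ Subgroup.center S ⊓ ZB := hc ▸ hν.2 x
    have hνx : ν.1 x = c * x := by rw [hc]; group
    have hcx : Commute c x := Subtype.ext (hPc _ c.2 _ x.2)
    have hcp : c ^ p = 1 := by
      have h1 := hν.1 (x ^ p) (by simpa using hpow' x x.2)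
      rw [map_pow, hνx, hcx.mul_pow] at h1
      exact mul_eq_right.1 h1
    have key : ∀ n : ℕ, (ν.1 ^ n) x = c ^ n * x := by
      intro n
      induction n with
      | zero => simp
      | succ n ih =>
        rw [pow_succ', MulAut.mul_apply, ih, map_mul, map_pow, hν.1 c hcZ, hνx, pow_succ, mul_assoc]
    have h2 := key p
    rw [hcp, one_mul] at h2
    rw [pow_one]
    exact congrArg Subtype.val h2
  have hYZ : ∀ u ∈ (Y : Subgroup (F.aut P)), ∀ x : P, (x : S) ∈ Subgroup.center S →
      u.1 x = x := by
    intro u hu x hx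
    rw [hY, Subgroup.mem_subgroupOf] at hu
    obtain ⟨s, -, hs⟩ := mem_autS.1 hu
    refine Subtype.ext ((hs x).trans ?_)
    rw [Subgroup.mem_center_iff.1 hx s, mul_inv_cancel_right]
  obtain ⟨b, hb, hbβ⟩ := hβ.exists_mem_aut
  let B : F.aut P := ⟨b, hb⟩
  have hY'Z : ∀ u ∈ (B • Y : Sylow p (F.aut P)), ∀ x : P, (x : S) ∈ ZB → u.1 x = x := by
    intro u hu x hx
    obtain ⟨z, hz, hzx⟩ := hZB.exists_mem hx
    have hu' : B⁻¹ * u * B ∈ (Y : Subgroup (F.aut P)) := by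
      have := Subgroup.mem_pointwise_smul_iff_inv_smul_mem.1
        (show u ∈ (MulAut.conj B) • (Y : Subgroup (F.aut P)) from hu)
      simpa [MulAut.smul_def] using this
    have h1 := hYZ _ hu' ⟨z, hZP hz⟩ hz
    have h2 : b ⟨z, hZP hz⟩ = x := Subtype.ext ((hbβ _).trans hzx)
    change b⁻¹ (u.1 (b ⟨z, hZP hz⟩)) = _ at h1
    rw [h2] at h1
    have h3 := congrArg b h1
    rwa [MulAut.apply_inv_self, h2] at h3
  have hNY : N ≤ (Y : Subgroup (F.aut P)) := le_of_le_normalizer Y hNp fun u hu =>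
    le_normalizer_transvections fun x hx => hYZ u hu x hx.1
  have hNY' : N ≤ ((B • Y : Sylow p (F.aut P)) : Subgroup (F.aut P)) :=
    le_of_le_normalizer _ hNp fun u hu => le_normalizer_transvections fun x hx => hY'Z u hu x hx.2
  obtain ⟨z₀, hz₀, hz₀A⟩ := h.exists_center_image_notMem hy (hPdef ▸ hβ) hβy
  refine Subtype.ext (MulEquiv.ext fun x => ?_)
  obtain ⟨a, ha, i, hi⟩ := h.base.exists_mul_pow hz₀A x
  have hβz := hβ.mem (hZP hz₀)
  have haP : a ∈ P := by
    have : a = x * (β z₀ ^ i)⁻¹ := by rw [hi]; group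
    rw [this]
    exact P.mul_mem x.2 (P.inv_mem (P.pow_mem hβz i))
  have haZ := h.base.mem_center_of_mem_centralizer hy (hPdef ▸ haP) ha
  have hx : x = ⟨a, haP⟩ * ⟨β z₀, hβz⟩ ^ i := Subtype.ext (by simpa using hi)
  rw [hx, map_mul, map_pow, hYZ γ (hNY hγ) _ haZ, hY'Z γ (hNY' hγ) ⟨β z₀, hβz⟩ (hZB.mem hz₀)]
  rfl

/-- Conjugation by an element of the second center, transported by `δ`, is trivial if its
commutators lie in the intersection of the center and its image. -/
theorem eq_one_of_conj (h : FusionSetup p F A T r) (hy : y ∉ A)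
    (hFN : F.FullyNormalized p (Subgroup.centralizer {y}))
    (hβ : F.Iso (Subgroup.centralizer {y}) (Subgroup.centralizer {y}) β)
    (hβy : β y ∈ Subgroup.center S) (hZB : F.Iso (Subgroup.center S) ZB β)
    {δ δ' : S → S} (hδ : F.Iso (Subgroup.centralizer {y}) (Subgroup.centralizer {y}) δ)
    (hδ' : F.Iso (Subgroup.centralizer {y}) (Subgroup.centralizer {y}) δ')
    (hδδ : ∀ x ∈ Subgroup.centralizer {y}, δ (δ' x) = x)
    (hδc : ∀ x ∈ Subgroup.center S ⊓ ZB, δ' x ∈ Subgroup.center S)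
    {b : S} (hb : b ∈ secondCenter A)
    (hbc : ∀ x ∈ Subgroup.centralizer {y}, δ (b * x * b⁻¹ * x⁻¹) ∈ Subgroup.center S ⊓ ZB) :
    ∀ x ∈ Subgroup.centralizer {y}, b * x * b⁻¹ * x⁻¹ = 1 := by
  set P := Subgroup.centralizer {y} with hPdef
  have hbN : ∀ x ∈ P, b * x * b⁻¹ ∈ P := fun x hx =>
    (Subgroup.mem_normalizer_iff.1 ((h.base.normalizer_relIndex hy).1 hb) x).1 hx
  have hc : F.Iso P P fun x => b * x * b⁻¹ :=
    (mor_conj P b).iso_of_mapsTo h.base.pair (h.base.centralizer_comm hy) hbN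
  have hZP : Subgroup.center S ≤ P := center_le_centralizer y
  have hiso := (hδ'.trans hc).trans hδ
  obtain ⟨γ, hγ, hγe⟩ := hiso.exists_mem_aut
  have hkey : ∀ x ∈ P, δ (b * δ' x * b⁻¹) = δ (b * δ' x * b⁻¹ * (δ' x)⁻¹) * x := by
    intro x hx
    have hx' := hδ'.mem hx
    have h1 := hδ.1.map_mul (P.mul_mem (hbN _ hx') (P.inv_mem hx')) hx'
    rwa [inv_mul_cancel_right, hδδ x hx] at h1
  have h1 : (⟨γ, hγ⟩ : F.aut P) = 1 := by
    refine h.eq_one_of_mem_transvections hy hPdef hFN hβ hβy hZB ⟨fun x hx => Subtype.ext ?_, fun x => ?_⟩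
    · refine (hγe x).trans ?_
      have h2 := Subgroup.mem_center_iff.1 (hδc x hx) b
      change δ (b * δ' x * b⁻¹) = x
      rw [h2, mul_inv_cancel_right, hδδ x x.2]
    · have h2 := (hγe x).trans (hkey x x.2)
      change (γ x : S) * _ ∈ _
      rw [h2, mul_inv_cancel_right]
      exact hbc _ (hδ'.mem x.2)
  intro x hx
  obtain ⟨u, hu, rfl⟩ := hδ'.exists_mem hx
  have h2 : γ ⟨u, hu⟩ = ⟨u, hu⟩ := by
    have := congrArg Subtype.val h1
    change γ = 1 at this
    rw [this]
    rfl
  have h3 := (hγe ⟨u, hu⟩).symm.trans (congrArg Subtype.val h2)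
  change δ (b * δ' u * b⁻¹) = u at h3
  rw [hkey u hu, mul_eq_right] at h3
  refine hδ.1.eq_one (P.mul_mem (hbN _ hx) (P.inv_mem hx)) h3

/-- Write w = [b,y]. If w ∈ β(Z), conjugation by b on C_S(y) is a transvection with commutators in Z
∩ β(Z); if β(w) ∈ A, its conjugate by β is one. Both are excluded since w ≠ 1. -/
theorem notMem_image_of_mem_centerComm (h : FusionSetup p F A T r) (hy : y ∉ A)
    (hFN : F.FullyNormalized p (Subgroup.centralizer {y}))
    (hβ : F.Iso (Subgroup.centralizer {y}) (Subgroup.centralizer {y}) β)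
    (hβy : β y ∈ Subgroup.center S) (hZB : F.Iso (Subgroup.center S) ZB β) {w : S}
    (hw : w ∈ centerComm A h.base) (hw1 : w ≠ 1) :
    w ∉ ZB ∧ β w ∉ A := by
  obtain ⟨b, hb, hbw⟩ := h.base.exists_secondCenter_of_mem hy hw
  have hyP := self_mem_centralizer y
  have hpow : ∀ x ∈ Subgroup.centralizer {y}, ∃ i : ℕ, b * x * b⁻¹ * x⁻¹ = w ^ i := by
    intro x hx
    obtain ⟨z, hz, i, rfl⟩ := h.base.exists_eq_mul_pow_of_mem_centralizer hy hx
    refine ⟨i, ?_⟩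
    rw [← hbw, ← commutator_pow_right hb]
    have h1 := Subgroup.mem_center_iff.1 hz b
    have h2 := Subgroup.mem_center_iff.1 hz (b * y ^ i * b⁻¹ * (y ^ i)⁻¹)
    calc b * (z * y ^ i) * b⁻¹ * (z * y ^ i)⁻¹ = (b * z) * y ^ i * b⁻¹ * (y ^ i)⁻¹ * z⁻¹ := by group
      _ = z * (b * y ^ i * b⁻¹ * (y ^ i)⁻¹) * z⁻¹ := by rw [h1]; group
      _ = _ := by rw [← h2]; group
  have hZP : Subgroup.center S ≤ Subgroup.centralizer {y} := center_le_centralizer y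
  constructor
  · intro hwB
    refine hw1 (hbw ▸ h.eq_one_of_conj hy hFN hβ hβy hZB (Iso.refl _) (Iso.refl _)
      (fun _ _ => rfl) (fun x hx => hx.1) hb (fun x hx => ?_) y hyP)
    obtain ⟨i, hi⟩ := hpow x hx
    rw [hi]
    exact Subgroup.pow_mem (Subgroup.center S ⊓ ZB) ⟨hw.2, hwB⟩ i
  · intro hwA
    obtain ⟨β', hβ', hβ'β, hββ'⟩ := hβ.exists_symm
    refine hw1 (hbw ▸ h.eq_one_of_conj hy hFN hβ hβy hZB hβ hβ' hββ' (fun x hx => ?_) hb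
      (fun x hx => ?_) y hyP)
    · obtain ⟨z, hz, rfl⟩ := hZB.exists_mem hx.2
      rw [hβ'β z (hZP hz)]
      exact hz
    · obtain ⟨i, hi⟩ := hpow x hx
      rw [hi, hβ.1.map_pow (hZP hw.2)]
      exact Subgroup.pow_mem (Subgroup.center S ⊓ ZB) ⟨h.base.mem_center_of_mem_centralizer hy (hβ.mem (hZP hw.2)) hwA,
        hZB.mem hw.2⟩ i

/-- The complement is Z ∩ β(Z). It meets Z(S) ∩ [A,S] trivially, so β⁻¹(w) ∉ A for every w ≠ 1 in
that group; since A has index p, Z is generated by w and Z ∩ β(Z). -/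
theorem centerCommCyclic_of_moving (h : FusionSetup p F A T r) (hy : y ∉ A)
    (hFN : F.FullyNormalized p (Subgroup.centralizer {y}))
    (hβ : F.Iso (Subgroup.centralizer {y}) (Subgroup.centralizer {y}) β)
    (hβy : β y ∈ Subgroup.center S) :
    h.base.CenterCommCyclic ∧ ∃ Z₁ ≤ Subgroup.center S, Disjoint (centerComm A h.base) Z₁ ∧
      (∀ z ∈ Subgroup.center S, ∃ w ∈ centerComm A h.base, ∃ z₁ ∈ Z₁, z = w * z₁) ∧
      ∀ z ∈ Z₁, ∃ z' ∈ Subgroup.center S, β z' = z := by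
  have hZP : Subgroup.center S ≤ Subgroup.centralizer {y} := center_le_centralizer y
  obtain ⟨ZB, hZB⟩ := (hβ.1.restrict hZP).exists_iso
  obtain ⟨β', hβ', hβ'β, hββ'⟩ := hβ.exists_symm
  have key : ∀ w ∈ centerComm A h.base, w ≠ 1 → ∀ z ∈ Subgroup.center S, ∃ i : ℕ,
      z * (w ^ i)⁻¹ ∈ Subgroup.center S ⊓ ZB := by
    intro w hw hw1 z hz
    have hwP := hZP hw.2
    have h1 : β' w ∉ A := by
      intro hA
      refine (h.notMem_image_of_mem_centerComm hy hFN hβ hβy hZB hw hw1).1 ?_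
      rw [← hββ' w hwP]
      exact hZB.mem (h.base.mem_center_of_mem_centralizer hy (hβ'.mem hwP) hA)
    obtain ⟨a, ha, i, hi⟩ := h.base.exists_mul_pow h1 (β' z)
    have hc : z * (w ^ i)⁻¹ ∈ Subgroup.center S :=
      Subgroup.mul_mem _ hz (Subgroup.inv_mem _ (Subgroup.pow_mem _ hw.2 i))
    refine ⟨i, hc, ?_⟩
    rw [← hββ' _ (hZP hc)]
    refine hZB.mem (h.base.mem_center_of_mem_centralizer hy (hβ'.mem (hZP hc)) ?_)
    rw [hβ'.1.map_mul (hZP hz) (Subgroup.inv_mem _ (Subgroup.pow_mem _ hwP i)),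
      hβ'.1.map_inv (Subgroup.pow_mem _ hwP i), hβ'.1.map_pow hwP, hi, mul_inv_cancel_right]
    exact ha
  have hdisj : ∀ w ∈ centerComm A h.base, w ∈ ZB → w = 1 := by
    intro w hw hwB
    by_contra hw1
    exact (h.notMem_image_of_mem_centerComm hy hFN hβ hβy hZB hw hw1).1 hwB
  refine ⟨fun w hw hw1 w' hw' => ?_, Subgroup.center S ⊓ ZB, inf_le_left, ?_, fun z hz => ?_,
    fun z hz => hZB.exists_mem hz.2⟩
  · obtain ⟨i, hi⟩ := key w hw hw1 w' hw'.2
    refine ⟨i, mul_inv_eq_one.1 (hdisj _ ?_ hi.2)⟩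
    exact Subgroup.mul_mem _ hw' (Subgroup.inv_mem _ (Subgroup.pow_mem _ hw i))
  · rw [Subgroup.disjoint_def]
    exact fun hw hz => hdisj _ hw hz.2
  · obtain ⟨w, hw, hw1⟩ := h.base.exists_mem_centerComm_ne_one h.odd
    obtain ⟨i, hi⟩ := key w hw hw1 z hz
    refine ⟨w ^ i, Subgroup.pow_mem _ hw i, _, hi, ?_⟩
    rw [Subgroup.mem_center_iff.1 hi.1 (w ^ i), inv_mul_cancel_right]

/-- Write β(y) = w z₁ with w ∈ Z(S) ∩ [A,S] and z₁ ∈ Z ∩ β(Z). Two opposite transvections on ⟨w,t⟩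
fixing z₁, as in SL₂(p), carry w z₁ to w² z₁. Both are central and Q is closed under fusion among
central elements, so w ∈ Q. -/
theorem centerComm_le_of_moving (h : FusionSetup p F A T r) (hy : y ∉ A)
    (hFN : F.FullyNormalized p (Subgroup.centralizer {y}))
    (hβ : F.Iso (Subgroup.centralizer {y}) (Subgroup.centralizer {y}) β)
    {Q : Subgroup S} (hQ : CentralInvariant F A Q) (hβy : β y ∈ Q) :
    centerComm A h.base ≤ Q := by
  set P := Subgroup.centralizer {y} with hPdef
  have hyP : y ∈ P := self_mem_centralizer y
  have hPc := h.base.centralizer_comm hy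
  have hZP : Subgroup.center S ≤ P := center_le_centralizer y
  have hβyZ := hQ.le_center hβy
  obtain ⟨hcyc, Z₁, hZ₁, -, hdec, hZ₁B⟩ := h.centerCommCyclic_of_moving hy hFN hβ hβyZ
  obtain ⟨ZB, hZB⟩ := (hβ.1.restrict hZP).exists_iso
  obtain ⟨β', hβ', hβ'β, hββ'⟩ := hβ.exists_symm
  obtain ⟨w, hw, z₁, hz₁, hq⟩ := hdec _ hβyZ
  obtain ⟨z₁', hz₁', hz₁e⟩ := hZ₁B z₁ hz₁
  have hw1 : w ≠ 1 := by
    rintro rfl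
    rw [one_mul, ← hz₁e] at hq
    exact hy (h.base.center_le (hβ.1.inj hyP (hZP hz₁') hq ▸ hz₁'))
  have hwP := hZP hw.2
  have hz₁P := hZP (hZ₁ hz₁)
  obtain ⟨b, hb, hbZ⟩ := h.base.exists_mem_secondCenter h.odd
  have hβw : β' w ∉ A := by
    intro hA
    refine (h.notMem_image_of_mem_centerComm hy hFN hβ hβyZ hZB hw hw1).1 ?_
    rw [← hββ' w hwP]
    exact hZB.mem (h.base.mem_center_of_mem_centralizer hy (hβ'.mem hwP) hA)
  set v := b * β' w * b⁻¹ * (β' w)⁻¹ with hv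
  have hvZ : v ∈ centerComm A h.base := h.base.commutator_mem_centerComm hb _
  have hv1 : v ≠ 1 := h.base.commutator_ne_one hβw hb hbZ
  have hvP := hZP hvZ.2
  have htA := (h.notMem_image_of_mem_centerComm hy hFN hβ hβyZ hZB hvZ hv1).2
  set t := β v with ht
  have htP : t ∈ P := hβ.mem hvP
  have htp : t ^ p = 1 := by
    rw [ht, ← hβ.1.map_pow hvP, h.base.pow_eq_one_of_mem_centerComm hvZ, hβ.1.map_one]
  have hconj : ∀ b ∈ secondCenter A, F.Iso P P fun x => b * x * b⁻¹ := fun b hb =>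
    (mor_conj P b).iso_of_mapsTo h.base.pair hPc fun x hx =>
      (Subgroup.mem_normalizer_iff.1 ((h.base.normalizer_relIndex hy).1 hb) x).1 hx
  obtain ⟨b₂, hb₂, hb₂t⟩ := h.base.exists_secondCenter_of_mem htA hw
  let τ : S → S := fun x => b₂ * x * b₂⁻¹
  have hτ : F.Iso P P τ := hconj b₂ hb₂
  have hτZ : ∀ z ∈ Subgroup.center S, τ z = z := fun z hz => by
    change b₂ * z * b₂⁻¹ = z
    rw [Subgroup.mem_center_iff.1 hz b₂, mul_inv_cancel_right]
  have hτt : τ t = w * t := by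
    change b₂ * t * b₂⁻¹ = w * t
    rw [← hb₂t]; group
  let τ' : S → S := fun x => β (b * β' x * b⁻¹)
  have hτ' : F.Iso P P τ' := (hβ'.trans (hconj b hb)).trans hβ
  have hτ'Z : ∀ z ∈ Subgroup.center S, τ' (β z) = β z := fun z hz => by
    change β (b * β' (β z) * b⁻¹) = β z
    rw [hβ'β z (hZP hz), Subgroup.mem_center_iff.1 hz b, mul_inv_cancel_right]
  have hτ't : τ' t = t := hτ'Z v hvZ.2
  have hτ'z : τ' z₁ = z₁ := hz₁e ▸ hτ'Z z₁' hz₁'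
  have hτ'w : τ' w = t * w := by
    change β (b * β' w * b⁻¹) = t * w
    have h1 : b * β' w * b⁻¹ = v * β' w := by rw [hv]; group
    rw [h1, hβ.1.map_mul hvP (hβ'.mem hwP), hββ' w hwP]
  have htw : Commute t w := hPc t htP w hwP
  -- Here τ sends t to wt, and τ' sends w to tw while fixing t and z₁. The map τ ∘ τ' produces w² z₁
  -- t, and each further τ' multiplies by t².
  have step : ∀ j : ℕ, ∃ f, F.Iso P P f ∧ f (w * z₁) = w ^ 2 * z₁ * t ^ (1 + 2 * j) := by
    intro j
    induction j with
    | zero =>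
      refine ⟨_, hτ'.trans hτ, ?_⟩
      rw [hτ'.1.map_mul hwP hz₁P, hτ'w, hτ'z, hτ.1.map_mul (P.mul_mem htP hwP) hz₁P,
        hτ.1.map_mul htP hwP, hτt, hτZ w hw.2, hτZ z₁ (hZ₁ hz₁), mul_zero, add_zero, pow_one,
        pow_two]
      have h1 := hPc z₁ hz₁P t htP
      calc w * t * w * z₁ = w * (t * w) * z₁ := by group
        _ = w * w * (t * z₁) := by rw [htw.eq]; group
        _ = w * w * z₁ * t := by rw [← h1]; group
    | succ j ih =>
      obtain ⟨f, hf, hfe⟩ := ih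
      refine ⟨_, hf.trans hτ', ?_⟩
      rw [hfe, hτ'.1.map_mul (P.mul_mem (P.pow_mem hwP 2) hz₁P) (P.pow_mem htP _),
        hτ'.1.map_mul (P.pow_mem hwP 2) hz₁P, hτ'.1.map_pow hwP, hτ'.1.map_pow htP, hτ'w, hτ'z,
        hτ't, htw.mul_pow, htw.pow_pow 2 2 |>.eq]
      have h1 : t ^ 2 * z₁ = z₁ * t ^ 2 := hPc _ (P.pow_mem htP 2) _ hz₁P
      rw [mul_assoc (w ^ 2), h1, show 1 + 2 * (j + 1) = 2 + (1 + 2 * j) by ring, pow_add t 2]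
      group
  obtain ⟨j, hj⟩ := h.odd
  obtain ⟨f, hf, hfe⟩ := step j
  -- As p is odd, the exponent 1 + 2j can be made equal to p, which kills t.
  rw [show 1 + 2 * j = p by omega, htp, mul_one] at hfe
  have hqQ : w * z₁ ∈ Q := hq ▸ hβy
  have hw2 : w ^ 2 * z₁ ∈ Q := by
    rw [← hfe]
    refine h.mem_of_mor hQ hqQ (P.mul_mem hwP hz₁P) hf.1 ?_
    rw [hfe]
    exact Subgroup.mul_mem _ (Subgroup.pow_mem _ hw.2 2) (hZ₁ hz₁)
  have hwQ : w ∈ Q := by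
    have := Q.mul_mem hw2 (Q.inv_mem hqQ)
    rwa [show w ^ 2 * z₁ * (w * z₁)⁻¹ = w by group] at this
  intro w' hw'
  obtain ⟨i, rfl⟩ := hcyc w hw hw1 w' hw'
  exact Q.pow_mem hwQ i

end Moving

end FusionSetup

/-! ### Invariant central subgroups, and strongly closed abelian subgroups -/

theorem Sylow.exists_conj_mem {p : ℕ} [hp : Fact p.Prime] {G : Type*} [Group G] [Finite G]
    (Y : Sylow p G) {K : Subgroup G} (hYK : (Y : Subgroup G) ≤ K) {x : G} (hx : x ∈ K) {n : ℕ}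
    (hxn : x ^ p ^ n = 1) : ∃ k ∈ K, k * x * k⁻¹ ∈ (Y : Subgroup G) := by
  have hpx : IsPGroup p (Subgroup.zpowers (⟨x, hx⟩ : K)) := by
    refine IsPGroup.of_card (n := (orderOf (⟨x, hx⟩ : K)).factorization p) ?_
    rw [Nat.card_zpowers]
    obtain ⟨k, -, hk⟩ := (Nat.dvd_prime_pow hp.out).1
      (orderOf_dvd_of_pow_eq_one (show (⟨x, hx⟩ : K) ^ p ^ n = 1 from Subtype.ext hxn))
    rw [hk, hp.out.factorization_pow, Finsupp.single_eq_same]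
  obtain ⟨X, hX⟩ := hpx.exists_le_sylow
  obtain ⟨k, hk⟩ := MulAction.exists_smul_eq K X (Y.subtype hYK)
  refine ⟨k, k.2, ?_⟩
  have h1 : k * ⟨x, hx⟩ * k⁻¹ ∈ (k • X : Sylow p K) :=
    ⟨⟨x, hx⟩, hX (Subgroup.mem_zpowers _), rfl⟩
  rw [hk] at h1
  exact Subgroup.mem_subgroupOf.1 h1

namespace FusionSetup

open FusionSystem IndexPSetup

variable {p : ℕ} [hp : Fact p.Prime] {S : Type*} [Group S] {F : FusionSystem S}
  {A T : Subgroup S} {r : ℕ}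

theorem centralizer_le_zpowers (h : FusionSetup p F A T r) {y : S} (hy : y ∉ A) :
    Subgroup.centralizer {y} ≤ Subgroup.zpowers y ⊔
      Subgroup.centralizer (Subgroup.zpowers y : Set S) := by
  rw [h.base.centralizer_coe_eq hy (Subgroup.mem_zpowers y)]
  · exact le_sup_right
  · rintro _ ⟨m, rfl⟩ _ ⟨n, rfl⟩
    exact zpow_mul_comm y m n

/-- If all conjugates of elements of Q stayed in A, they would be images under Aut_F(A) and so lie
in Q. Since Q is central, morphisms extend over Q, and Q would be normal in F. -/
theorem exists_conj_notMem (h : FusionSetup p F A T r) {Q : Subgroup S}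
    (hQ : CentralInvariant F A Q) (hne : Q ≠ ⊥) :
    ∃ c ∈ Q, ∃ f, F.Mor (Subgroup.zpowers c) f ∧ f c ∉ A := by
  by_contra! hcon
  refine hne (h.eq_bot_of_isNormal Q (isNormal_of_receptive h.exists_receptive ?_))
  intro R R' f hf hR'
  obtain ⟨g, hg, hgf⟩ := hR'.exists_extension_centralizer hf
  have hQc := hQ.le_center
  have hle : Q ⊔ R ≤ R ⊔ Subgroup.centralizer (R : Set S) :=
    sup_le ((hQc.trans (Subgroup.center_le_centralizer _)).trans le_sup_right) le_sup_left
  have hg' := hg.restrict hle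
  have hgQ : F.Mor Q g := hg'.restrict le_sup_left
  refine ⟨g, hg', hgf, (hgQ.iso_of_mapsTo h.base.pair
    (fun x hx y hy => Subgroup.mem_center_iff.1 (hQc hy) x) fun c hc => ?_).2⟩
  have hgc := hgQ.restrict (Subgroup.zpowers_le.2 hc)
  obtain ⟨k, hk, hkc⟩ := h.exists_extension_of_mem (h.base.center_le (hQc hc)) hgc
    (hcon c hc g hgc)
  rw [← hkc]
  exact hQ.map_mem k hk.1 c hc

/-- The inverse of f is followed to a receptive target and extended over C_S(f c). A central ⟨c⟩ is
already receptive, so then f(c) is sent back to c itself. -/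
theorem exists_mor_centralizer (h : FusionSetup p F A T r) {c : S} {f : S → S}
    (hc : c ∈ A) (hf : F.Mor (Subgroup.zpowers c) f) (hfc : f c ∉ A) :
    ∃ g, F.Mor (Subgroup.centralizer {f c}) g ∧ g (f c) ∈ A ∧
      (c ∈ Subgroup.center S → g (f c) = c) := by
  obtain ⟨f', hf', hf'f, -⟩ := (zpowers_iso hf).exists_symm
  have hff : f' (f c) = c := hf'f c (Subgroup.mem_zpowers c)
  have hyy := Subgroup.mem_zpowers (f c)
  by_cases hcZ : c ∈ Subgroup.center S
  · obtain ⟨g, hg, hgf⟩ := (h.receptive_of_le_center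
      (Subgroup.zpowers_le.2 hcZ)).exists_extension_centralizer hf'
    have h1 : g (f c) = c := (hgf _ hyy).trans hff
    exact ⟨g, hg.restrict (h.centralizer_le_zpowers hfc), h1.symm ▸ hc, fun _ => h1⟩
  · obtain ⟨R', k, hk, hR', hR'A⟩ := h.exists_receptive_le hf' (Subgroup.zpowers_le.2 hc)
    obtain ⟨g, hg, hgf⟩ := hR'.exists_extension_centralizer hk
    refine ⟨g, hg.restrict (h.centralizer_le_zpowers hfc), ?_, fun h => absurd h hcZ⟩
    rw [hgf _ hyy]
    exact hR'A (hk.mem hyy)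

/-- A nontrivial invariant central subgroup contains `Z(S) ∩ [A, S]`, which is then
a cyclic direct factor of the center. -/
theorem centerComm_le (h : FusionSetup p F A T r) {Q : Subgroup S}
    (hQ : CentralInvariant F A Q) (hne : Q ≠ ⊥) :
    centerComm A h.base ≤ Q ∧ ∃ Z₁ ≤ Subgroup.center S, Disjoint (centerComm A h.base) Z₁ ∧
      ∀ z ∈ Subgroup.center S, ∃ w ∈ centerComm A h.base, ∃ z₁ ∈ Z₁, z = w * z₁ := by
  obtain ⟨c, hc, f₀, hf₀, hy⟩ := h.exists_conj_notMem hQ hne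
  have hcZ := hQ.le_center hc
  obtain ⟨f, hf, -, hfc⟩ := h.exists_mor_centralizer (h.base.center_le hcZ) hf₀ hy
  replace hfc := hfc hcZ
  obtain ⟨y, hy0⟩ : ∃ y, y = f₀ c := ⟨_, rfl⟩
  rw [← hy0] at hy hf hfc
  have hyP := self_mem_centralizer y
  by_cases hno : ∃ Q g, F.Iso (Subgroup.centralizer {y}) Q g ∧ Q ≤ A
  -- If C_S(y) is conjugate into A, a map from it into A sending y into Q is produced in each
  -- subcase, against `notMem_of_into`.
  · exfalso
    obtain ⟨Q₀, g₀, hg₀, hQ₀⟩ := hno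
    by_cases hfA : ∀ x ∈ Subgroup.centralizer {y}, f x ∈ A
    · exact h.notMem_of_into hy hf hfA hQ (hfc ▸ hc)
    push Not at hfA
    obtain ⟨x₀, hx₀, hx₀A⟩ := hfA
    obtain ⟨P', hP'⟩ := hf.exists_iso
    obtain ⟨f', hf', -, -⟩ := hP'.exists_symm
    obtain ⟨R, θ, hθ, hR, hRA⟩ := h.exists_receptive_le (hf'.trans hg₀) hQ₀
    obtain ⟨k, hk, hkθ⟩ := hR.exists_extension_centralizer hθ
    have hPab := h.base.centralizer_comm hy
    have hP'ab : ∀ x ∈ P', ∀ x' ∈ P', x * x' = x' * x := by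
      intro x hx x' hx'
      obtain ⟨u, hu, rfl⟩ := hP'.exists_mem hx
      obtain ⟨u', hu', rfl⟩ := hP'.exists_mem hx'
      rw [← hf.map_mul hu hu', ← hf.map_mul hu' hu, hPab u hu u' hu']
    have hy' := hP'.mem hx₀
    have hcP' : c ∈ P' := hfc ▸ hP'.mem hyP
    have hCeq := h.base.centralizer_coe_eq hx₀A hy' hP'ab
    have hk' := hk.restrict (hCeq.symm.le.trans le_sup_right)
    have hP'C : P' ≤ Subgroup.centralizer {f x₀} := fun x hx =>
      mem_centralizer.2 (hP'ab _ hy' x hx)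
    -- In either case the image of c is shown to be central, hence in Q: by extending to the
    -- normalizer if k maps into A, and otherwise because k(c) ∈ A commutes with some k(s) ∉ A.
    by_cases hkA : ∀ x ∈ Subgroup.centralizer {f x₀}, k x ∈ A
    · obtain ⟨g', k', hg', hk'', hkg⟩ := h.exists_extension_into hk' hkA
      have hk'A : ∀ x ∈ Subgroup.centralizer {f x₀}, k' x ∈ A := fun x hx => by
        rw [hkg x hx]
        exact hg'.mem (hkA x hx)
      have hCN := Subgroup.le_normalizer (H := Subgroup.centralizer {f x₀})
      have h1 := h.mem_of_mor hQ hc (hCN (hP'C hcP')) hk'' (h.map_center_mem hx₀A hk'' hk'A hcZ)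
      refine h.notMem_of_into hy (hf.comp (hk''.restrict (hP'C.trans hCN)) fun x hx => hP'.mem hx)
        (fun x hx => hk'A _ (hP'C (hP'.mem hx))) hQ ?_
      rwa [hfc]
    · push Not at hkA
      obtain ⟨s, hs, hsA⟩ := hkA
      have hkc : k c ∈ A := by
        rw [hkθ c hcP']
        exact hRA (hθ.mem hcP')
      have hcC := hP'C hcP'
      have h2 : k c ∈ Subgroup.center S := by
        refine h.base.mem_center_of_comm hsA hkc ?_
        rw [← hk'.map_mul hcC hs, ← hk'.map_mul hs hcC, Subgroup.mem_center_iff.1 hcZ s]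
      have h1 := h.mem_of_mor hQ hc hcC hk' h2
      refine h.notMem_of_into hy (hf.comp hθ.1 fun x hx => hP'.mem hx)
        (fun x hx => hRA (hθ.mem (hP'.mem hx))) hQ ?_
      rwa [hfc, ← hkθ c hcP']
  · push Not at hno
    obtain ⟨hFN, β, hβ, hβy, hβQ⟩ := h.exists_automorphism hy hf (hfc ▸ hcZ) hno
    obtain ⟨-, Z₁, h1, h2, h3, -⟩ := h.centerCommCyclic_of_moving hy hFN hβ hβy
    exact ⟨h.centerComm_le_of_moving hy hFN hβ hQ (hβQ Q hQ (hfc ▸ hc)), Z₁, h1, h2, h3⟩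

/-- Either C_S(f₀ c) is conjugate into A, or its image has an element outside A. That element
commutes with the image of f₀(c), which is therefore central, and an automorphism moving f₀(c) into
the center exists. -/
theorem centerCommCyclic_of_conj_notMem (h : FusionSetup p F A T r) {c : S} {f₀ : S → S}
    (hc : c ∈ A) (hf₀ : F.Mor (Subgroup.zpowers c) f₀) (hy : f₀ c ∉ A) :
    h.base.CenterCommCyclic := by
  obtain ⟨f, hf, hfA, -⟩ := h.exists_mor_centralizer hc hf₀ hy
  by_cases hno : ∃ Q g, F.Iso (Subgroup.centralizer {f₀ c}) Q g ∧ Q ≤ A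
  · obtain ⟨Q, g, hg, hQ⟩ := hno
    exact h.centerCommCyclic_of_into hy hg.1 fun x hx => hQ (hg.mem hx)
  · push Not at hno
    obtain ⟨Q, hQ⟩ := hf.exists_iso
    obtain ⟨s, hs, hsA⟩ := SetLike.not_le_iff_exists.1 (hno Q f hQ)
    obtain ⟨s, hs', rfl⟩ := hQ.exists_mem hs
    have hyP := self_mem_centralizer (f₀ c)
    have hfZ : f (f₀ c) ∈ Subgroup.center S := by
      refine h.base.mem_center_of_comm hsA hfA ?_
      rw [← hf.map_mul hyP hs', ← hf.map_mul hs' hyP, mem_centralizer.1 hs']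
    obtain ⟨hFN, β, hβ, hβy, -⟩ := h.exists_automorphism hy hf hfZ hno
    exact (h.centerCommCyclic_of_moving hy hFN hβ hβy).1

theorem exists_sylow_aut (h : FusionSetup p F A T r) : Finite (F.aut A) ∧
    ∃ Y : Sylow p (F.aut A), (Y : Subgroup (F.aut A)) = (autS A).subgroupOf (F.aut A) := by
  refine exists_sylow_of_fullyAutomized h.base.comm (h.saturated.sylow A fun Q hQ => ?_).1
  have hn := h.base.normal
  rw [Subgroup.normalizer_eq_top_iff.2 hn]
  exact h.base.pair.toralSizeLE_top _

/-- Fusion between central elements comes from an endomorphism of S in F, which preserves A and so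
commutators of A with S. -/
theorem map_mem_centerComm (h : FusionSetup p F A T r) {g : S → S} (hg : F.Mor A g) {w : S}
    (hw : w ∈ centerComm A h.base) (hgw : g w ∈ Subgroup.center S) :
    g w ∈ centerComm A h.base := by
  have hwA := h.base.center_le hw.2
  obtain ⟨k, hk, hkw⟩ := h.exists_mor_top hw.2 (hg.restrict (Subgroup.zpowers_le.2 hwA)) hgw
  refine ⟨?_, hgw⟩
  obtain ⟨a, ha, s, hs⟩ := hw.1
  have hkA := h.iso_of_mor (hk.restrict le_top)
  refine ⟨k a, hkA.mem ha, k s, ?_⟩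
  rw [← hkw, ← hs]
  have ht : ∀ x : S, x ∈ (⊤ : Subgroup S) := fun x => Subgroup.mem_top x
  rw [hk.map_mul (ht _) (ht _), hk.map_mul (ht _) (ht _), hk.map_mul (ht _) (ht _),
    hk.map_inv (ht _), hk.map_inv (ht _)]

/-! ### If A is strongly closed, then A is normal in F -/

section StronglyClosed

/-- The elements of `A` whose commutator with `y` lies in `R`. -/
def commPreimage (h : FusionSetup p F A T r) (y : S) (R : Subgroup S) : Subgroup S where
  carrier := {b | b ∈ A ∧ b * y * b⁻¹ * y⁻¹ ∈ R}
  one_mem' := ⟨A.one_mem, by simp⟩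
  mul_mem' := fun ⟨ha, ha'⟩ ⟨hb, hb'⟩ =>
    ⟨A.mul_mem ha hb, (h.base.commutator_mul ha hb).symm ▸ R.mul_mem ha' hb'⟩
  inv_mem' := by
    rintro b ⟨hb, hb'⟩
    refine ⟨A.inv_mem hb, ?_⟩
    have h1 := h.base.commutator_mul (s := y) (A.inv_mem hb) hb
    rw [inv_mul_cancel] at h1
    have h2 : b⁻¹ * y * b⁻¹⁻¹ * y⁻¹ = (b * y * b⁻¹ * y⁻¹)⁻¹ :=
      eq_inv_of_mul_eq_one_left (by rw [← h1]; group)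
    exact h2 ▸ R.inv_mem hb'

variable {y : S} {R : Subgroup S} {f : S → S}

/-- The restriction of f to R ∩ A extends to γ ∈ Aut_F(A). A Sylow argument replaces γ by kγ, which
on R ∩ A is f followed by a conjugation in S and which carries the action of y to that of some s ∈
S; then kγ sends [b,y] to [kγ(b),s]. -/
theorem commutator_image_mem_commSet (h : FusionSetup p F A T r)
    (hsc : ∀ a ∈ A, ∀ f, F.Mor (Subgroup.zpowers a) f → f a ∈ A) (hf : F.Mor R f)
    (hyR : y ∈ R) (hfy : f y ∉ A) {b : S} (hb : b ∈ h.commPreimage y R) :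
    f (b * y * b⁻¹ * y⁻¹) ∈ commSet A := by
  obtain ⟨hbA, hbR⟩ := hb
  have hfW : F.Mor (R ⊓ A) f := hf.restrict inf_le_left
  obtain ⟨W', hW'⟩ := hfW.exists_iso
  have hW'A : W' ≤ A := fun x hx => by
    obtain ⟨u, hu, rfl⟩ := hW'.exists_mem hx
    exact hsc u hu.2 f (hf.restrict (Subgroup.zpowers_le.2 hu.1))
  obtain ⟨g, hg, hgf⟩ := h.exists_extension_of_le hW' inf_le_right hW'A
  have hconj : ∀ u ∈ R ⊓ A, y * u * y⁻¹ ∈ R ⊓ A := fun u hu =>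
    ⟨R.mul_mem (R.mul_mem hyR hu.1) (R.inv_mem hyR), h.base.conj_mem hu.2 y⟩
  have hfconj : ∀ u ∈ R ⊓ A, f (y * u * y⁻¹) = f y * f u * (f y)⁻¹ := fun u hu => by
    rw [hf.map_mul (R.mul_mem hyR hu.1) (R.inv_mem hyR), hf.map_mul hyR hu.1, hf.map_inv hyR]
  have hWn : ∀ s : S, ∀ w ∈ W', s * w * s⁻¹ ∈ W' := by
    intro s w hw
    obtain ⟨a, ha, i, rfl⟩ := h.base.exists_mul_pow hfy s
    have h1 : f y ^ i * w * (f y ^ i)⁻¹ ∈ W' := by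
      clear ha
      induction i with
      | zero => simpa using hw
      | succ i ih =>
        obtain ⟨u, hu, hue⟩ := hW'.exists_mem ih
        have h2 := hW'.mem (hconj u hu)
        rw [hfconj u hu, hue] at h2
        rwa [show f y ^ (i + 1) * w * (f y ^ (i + 1))⁻¹ =
          f y * (f y ^ i * w * (f y ^ i)⁻¹) * (f y)⁻¹ by rw [pow_succ']; group]
    have h2 := h.base.comm a ha _ (hW'A h1)
    rwa [show a * f y ^ i * w * (a * f y ^ i)⁻¹ = a * (f y ^ i * w * (f y ^ i)⁻¹) * a⁻¹ by group,
      h2, mul_inv_cancel_right]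
  -- K consists of the automorphisms acting on f(R ∩ A) as conjugation in S. It contains the Sylow
  -- subgroup Aut_S(A) and also γσγ⁻¹, which acts there as f(y).
  let K : Subgroup (F.aut A) :=
    { carrier := {k | ∃ s : S, ∀ w : A, (w : S) ∈ W' → (k.1 w : S) = s * w * s⁻¹}
      one_mem' := ⟨1, fun w _ => by simp⟩
      mul_mem' := by
        rintro k₁ k₂ ⟨s₁, h₁⟩ ⟨s₂, h₂⟩
        refine ⟨s₁ * s₂, fun w hw => ?_⟩
        have e := h₂ w hw
        have h3 := h₁ (k₂.1 w) (e ▸ hWn s₂ w hw)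
        refine h3.trans ?_
        rw [e]; group
      inv_mem' := by
        rintro k ⟨s, hs⟩
        refine ⟨s⁻¹, fun w hw => ?_⟩
        have h3 := hWn s⁻¹ w hw
        have h4 : k.1 ⟨_, hW'A h3⟩ = w := Subtype.ext ((hs ⟨_, hW'A h3⟩ h3).trans (by simp; group))
        have h5 : (k⁻¹ : F.aut A).1 w = ⟨_, hW'A h3⟩ :=
          (congrArg _ h4.symm).trans (MulAut.inv_apply_self A k.1 _)
        exact congrArg Subtype.val h5 }
  obtain ⟨hfin, Y, hY⟩ := h.exists_sylow_aut
  have hYK : (Y : Subgroup (F.aut A)) ≤ K := fun α hα => by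
    rw [hY, Subgroup.mem_subgroupOf] at hα
    obtain ⟨s, -, hs⟩ := mem_autS.1 hα
    exact ⟨s, fun w _ => hs w⟩
  obtain ⟨γ, hγ, hγg⟩ := hg.exists_mem_aut
  have hn := h.base.normal
  obtain ⟨σ, hσ, hσy⟩ : ∃ σ ∈ autS A, ∀ x : A, (σ x : S) = y * x * y⁻¹ :=
    ⟨A.normalizerMonoidHom ⟨y, by rw [Subgroup.normalizer_eq_top_iff.2 hn]; trivial⟩, ⟨_, rfl⟩,
      fun x => rfl⟩
  obtain ⟨n, hσn⟩ := isPGroup_autS h.base.pair.isPGroup A ⟨σ, hσ⟩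
  have hσn' : σ ^ p ^ n = 1 := congrArg Subtype.val hσn
  let γ' : F.aut A := ⟨γ, hγ⟩
  let σ' : F.aut A := ⟨σ, autS_le_aut A hσ⟩
  have hx : γ' * σ' * γ'⁻¹ ∈ K := by
    refine ⟨f y, fun w hw => ?_⟩
    obtain ⟨u, hu, hue⟩ := hW'.exists_mem hw
    have h1 : γ ⟨u, hu.2⟩ = w := Subtype.ext ((hγg _).trans ((hgf u hu).trans hue))
    change (γ (σ (γ⁻¹ w)) : S) = _
    rw [← h1, MulAut.inv_apply_self, hγg, hσy, hgf _ (hconj u hu), hfconj u hu, h1, hue]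
  have hxn : (γ' * σ' * γ'⁻¹) ^ p ^ n = 1 := by
    have h1 : σ' ^ p ^ n = 1 := Subtype.ext hσn'
    rw [conj_pow, h1, mul_one, mul_inv_cancel]
  obtain ⟨k, ⟨s', hs'⟩, hkY⟩ := Y.exists_conj_mem hYK hx hxn
  rw [hY, Subgroup.mem_subgroupOf] at hkY
  obtain ⟨s, -, hs⟩ := mem_autS.1 hkY
  have hδ : ∀ a : A, (k.1 (γ (σ a)) : S) = s * (k.1 (γ a) : S) * s⁻¹ := by
    intro a
    rw [← hs (k.1 (γ a))]
    change _ = ((k.1 (γ (σ (γ⁻¹ (k.1⁻¹ (k.1 (γ a)))))) : A) : S)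
    rw [MulAut.inv_apply_self, MulAut.inv_apply_self]
  have hwA := h.base.commutator_mem hbA y
  have hw : (⟨_, hwA⟩ : A) = ⟨b, hbA⟩ * σ ⟨b, hbA⟩⁻¹ :=
    Subtype.ext (by rw [Subgroup.coe_mul, hσy]; simp [mul_assoc])
  have h1 : (k.1 (γ ⟨_, hwA⟩) : S) ∈ commSet A := by
    refine ⟨k.1 (γ ⟨b, hbA⟩), Subtype.mem _, s, ?_⟩
    rw [hw, map_mul, map_mul, Subgroup.coe_mul, hδ, map_inv, map_inv, Subgroup.coe_inv]
    group
  have h2 : (γ ⟨_, hwA⟩ : S) = f (b * y * b⁻¹ * y⁻¹) := (hγg _).trans (hgf _ ⟨hbR, hwA⟩)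
  rw [hs' _ (h2 ▸ hW'.mem ⟨hbR, hwA⟩), h2] at h1
  obtain ⟨a, ha, t, ht⟩ := h1
  refine ⟨s'⁻¹ * a * s'⁻¹⁻¹, h.base.conj_mem ha _, s'⁻¹ * t * s', ?_⟩
  have h3 : f (b * y * b⁻¹ * y⁻¹) = s'⁻¹ * (a * t * a⁻¹ * t⁻¹) * s' := by rw [ht]; group
  rw [h3]; group

theorem notMem_of_stronglyClosed
    (hsc : ∀ a ∈ A, ∀ f, F.Mor (Subgroup.zpowers a) f → f a ∈ A) (hf : F.Mor R f) (hy : y ∉ A)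
    (hyR : y ∈ R) : f y ∉ A := by
  intro hfy
  obtain ⟨R', hR'⟩ := hf.exists_iso
  obtain ⟨k, hk, hkf, -⟩ := hR'.exists_symm
  refine hy ?_
  rw [← hkf y hyR]
  exact hsc _ hfy k (hk.1.restrict (Subgroup.zpowers_le.2 (hR'.mem hyR)))

/-- An s ∈ A with [s,y] ∈ R normalizes R, and f transports its action to conjugation by t ∈ A with
[t, f y] = f([s,y]). Receptivity of the image then applies. -/
theorem exists_extension_commPreimage (h : FusionSetup p F A T r)
    (hsc : ∀ a ∈ A, ∀ f, F.Mor (Subgroup.zpowers a) f → f a ∈ A) (hf : F.Mor R f) (hy : y ∉ A)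
    (hyR : y ∈ R) : ∃ g, F.Mor (R ⊔ h.commPreimage y R) g ∧ ∀ x ∈ R, g x = f x := by
  obtain ⟨R', hR'⟩ := hf.exists_iso
  have hfy := notMem_of_stronglyClosed hsc hf hy hyR
  have hrec : F.Receptive R' := by
    refine h.saturated.extension R' (h.fullyCentralized_of_forall_not_le fun Q g hg hQ => ?_)
    exact notMem_of_stronglyClosed hsc hg.1 hfy (hR'.mem hyR) (hQ (hg.mem (hR'.mem hyR)))
  have hdec : ∀ x ∈ R, ∃ a ∈ A, a ∈ R ∧ ∃ i : ℕ, x = a * y ^ i := by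
    intro x hx
    obtain ⟨a, ha, i, rfl⟩ := h.base.exists_mul_pow hy x
    exact ⟨a, ha, by simpa using R.mul_mem hx (R.inv_mem (R.pow_mem hyR i)), i, rfl⟩
  have hconj : ∀ s ∈ h.commPreimage y R, ∀ a ∈ A, ∀ i : ℕ,
      s * (a * y ^ i) * s⁻¹ = a * ((s * y * s⁻¹ * y⁻¹) * y) ^ i := by
    intro s hs a ha i
    rw [show s * (a * y ^ i) * s⁻¹ = (s * a) * (y ^ i * s⁻¹) by group, h.base.comm s hs.1 a ha,
      inv_mul_cancel_right, conj_pow]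
    group
  have hmem : ∀ s ∈ h.commPreimage y R, ∀ x ∈ R, s * x * s⁻¹ ∈ R := by
    intro s hs x hx
    obtain ⟨a, ha, haR, i, rfl⟩ := hdec x hx
    rw [hconj s hs a ha i]
    exact R.mul_mem haR (R.pow_mem (R.mul_mem hs.2 hyR) i)
  refine hrec.exists_extension_sup hR' fun s hs => ⟨?_, ?_⟩
  · refine Subgroup.mem_normalizer_iff.2 fun x => ⟨hmem s hs x, fun hx => ?_⟩
    have h1 := hmem s⁻¹ (Subgroup.inv_mem _ hs) _ hx
    rwa [show s⁻¹ * (s * x * s⁻¹) * s⁻¹⁻¹ = x by group] at h1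
  · obtain ⟨t, ht, hts⟩ := (h.base.mem_commSet hfy).1
      (h.commutator_image_mem_commSet hsc hf hyR hfy hs)
    refine ⟨t, fun x hx => ?_⟩
    obtain ⟨a, ha, haR, i, rfl⟩ := hdec x hx
    have hfa := hsc a ha f (hf.restrict (Subgroup.zpowers_le.2 haR))
    rw [hconj s hs a ha i, hf.map_mul haR (R.pow_mem (R.mul_mem hs.2 hyR) i),
      hf.map_pow (R.mul_mem hs.2 hyR), hf.map_mul hs.2 hyR, hf.map_mul haR (R.pow_mem hyR i),
      hf.map_pow hyR, ← hts, inv_mul_cancel_right, conj_pow, ← mul_assoc t, h.base.comm t ht _ hfa]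
    group

/-- The extension over {b ∈ A | [b,y] ∈ R} is iterated. Since a ↦ [a,y] is locally nilpotent, the
union of the domains contains A, and continuity makes the union of the maps a morphism. -/
theorem exists_extension_sup_of_stronglyClosed (h : FusionSetup p F A T r)
    (hsc : ∀ a ∈ A, ∀ f, F.Mor (Subgroup.zpowers a) f → f a ∈ A) (hf : F.Mor R f) (hy : y ∉ A)
    (hyR : y ∈ R) : ∃ g, F.Mor (A ⊔ R) g ∧ ∀ x ∈ R, g x = f x := by
  classical
  let X := {q : Subgroup S × (S → S) // y ∈ q.1 ∧ F.Mor q.1 q.2}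
  have step : ∀ q : X, ∃ q' : X, q'.1.1 = q.1.1 ⊔ h.commPreimage y q.1.1 ∧
      ∀ x ∈ q.1.1, q'.1.2 x = q.1.2 x := by
    rintro ⟨⟨R, f⟩, hyR, hf⟩
    obtain ⟨g, hg, hgf⟩ := h.exists_extension_commPreimage hsc hf hy hyR
    exact ⟨⟨⟨_, g⟩, (le_sup_left : R ≤ R ⊔ h.commPreimage y R) hyR, hg⟩, rfl, hgf⟩
  choose next hnext hnext' using step
  let q : ℕ → X := fun n => next^[n] ⟨(R, f), hyR, hf⟩
  have hq : ∀ n, q (n + 1) = next (q n) := fun n => Function.iterate_succ_apply' next n _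
  have hstep : ∀ n, (q (n + 1)).1.1 = (q n).1.1 ⊔ h.commPreimage y (q n).1.1 := fun n => by
    rw [hq, hnext]
  have hmono : Monotone fun n => (q n).1.1 := monotone_nat_of_le_succ fun n => by
    rw [hstep]
    exact le_sup_left
  have hcoh : ∀ n m, n ≤ m → ∀ x ∈ (q n).1.1, (q m).1.2 x = (q n).1.2 x := by
    intro n m hnm x hx
    induction m, hnm using Nat.le_induction with
    | base => rfl
    | succ m hnm ih => rw [hq, hnext' _ _ (hmono hnm hx), ih]
  let g : S → S := fun x => if hx : ∃ n, x ∈ (q n).1.1 then (q hx.choose).1.2 x else 1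
  have hgq : ∀ n, ∀ x ∈ (q n).1.1, g x = (q n).1.2 x := by
    intro n x hx
    have hex : ∃ n, x ∈ (q n).1.1 := ⟨n, hx⟩
    have h1 : g x = (q hex.choose).1.2 x := dif_pos hex
    rw [h1]
    rcases le_total n hex.choose with hle | hle
    · exact hcoh _ _ hle x hx
    · exact (hcoh _ _ hle x hex.choose_spec).symm
  have hgn : ∀ n, F.Mor (q n).1.1 g := fun n => (q n).2.2.congr (hgq n)
  have hA : ∀ n m, ∀ a ∈ A, (fun a => a * y * a⁻¹ * y⁻¹)^[n] a ∈ (q m).1.1 →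
      a ∈ (q (m + n)).1.1 := by
    intro n
    induction n with
    | zero => exact fun m a _ ha => ha
    | succ n ih =>
      intro m a ha hm
      rw [Function.iterate_succ_apply] at hm
      have h1 := ih m _ (h.base.commutator_mem ha y) hm
      rw [← add_assoc, hstep]
      exact (le_sup_right : _ ≤ (q (m + n)).1.1 ⊔ h.commPreimage y (q (m + n)).1.1) ⟨ha, h1⟩
  have hle := le_iSup fun n => (q n).1.1
  refine ⟨g, (h.saturated.mor_iSup hmono hgn).restrict (sup_le (fun a ha => ?_) (hle 0)), hgq 0⟩
  obtain ⟨n, hn⟩ := h.base.exists_iterate_commutator_eq_one h.odd y ha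
  exact hle _ (hA n 0 a ha (by rw [hn]; exact Subgroup.one_mem _))

/-- A is nontrivial, so not normal in F; hence it is not strongly closed, and some element of A has
a conjugate outside A. -/
theorem centerCommCyclic (h : FusionSetup p F A T r) : h.base.CenterCommCyclic := by
  by_cases hsc : ∀ a ∈ A, ∀ f, F.Mor (Subgroup.zpowers a) f → f a ∈ A
  · exfalso
    have hbot : A = ⊥ := by
      refine h.eq_bot_of_isNormal A (isNormal_of_exists_extension fun R R' f hf => ?_)
      have key : ∀ x ∈ R, x ∈ A → f x ∈ A := fun x hx hxA =>
        hsc x hxA f (hf.1.restrict (Subgroup.zpowers_le.2 hx))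
      by_cases hR : R ≤ A
      · have hR' : R' ≤ A := fun x hx => by
          obtain ⟨x, hx', rfl⟩ := hf.exists_mem hx
          exact key x hx' (hR hx')
        obtain ⟨g, hg, hgf⟩ := h.exists_extension_of_le hf hR hR'
        exact ⟨g, (sup_eq_left.2 hR).symm ▸ hg.1, hgf, hg.2⟩
      · obtain ⟨y, hyR, hy⟩ := SetLike.not_le_iff_exists.1 hR
        obtain ⟨g, hg, hgf⟩ := h.exists_extension_sup_of_stronglyClosed hsc hf.1 hy hyR
        exact ⟨g, hg, hgf, (h.iso_of_mor (hg.restrict le_sup_left)).2⟩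
    refine h.noncentral (h.base.torus_le.trans ?_)
    rw [hbot]
    exact bot_le
  · push Not at hsc
    obtain ⟨a, ha, f, hf, hfa⟩ := hsc
    exact h.centerCommCyclic_of_conj_notMem ha hf hfa

end StronglyClosed

end FusionSetup

/-! ### Operators of order `p` on torsion modules -/

section Operator

variable {p : ℕ} [hp : Fact p.Prime] {M : Type*} [AddCommGroup M]

theorem end_sum_apply {ι : Type*} {M : Type*} [AddCommGroup M] (s : Finset ι)
    (f : ι → AddMonoid.End M) (m : M) : (∑ i ∈ s, f i) m = ∑ i ∈ s, f i m :=
  map_sum (AddMonoidHom.eval m : (M →+ M) →+ M) f s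

theorem exists_geom_sum_eq (σ : AddMonoid.End M) : ∃ w : AddMonoid.End M,
    Commute w (σ - 1) ∧ (∀ B : AddSubgroup M, (∀ b ∈ B, (σ - 1) b ∈ B) → ∀ b ∈ B, w b ∈ B) ∧
      ∑ i ∈ Finset.range p, σ ^ i =
        (σ - 1) ^ (p - 1) + (p : AddMonoid.End M) * (1 + (σ - 1) * w) := by
  obtain ⟨x, hx⟩ : ∃ x : AddMonoid.End M, x = σ - 1 := ⟨_, rfl⟩
  have hσ : σ = x + 1 := by rw [hx, sub_add_cancel]
  rw [← hx]
  obtain ⟨q, hq⟩ : ∃ q, p = q + 2 := ⟨p - 2, by have := hp.out.two_le; omega⟩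
  -- In ((1 + x)^p − 1)/x the extreme terms are p and x^(p−1); the binomial coefficients between
  -- them are divisible by p, and w collects their quotients.
  refine ⟨∑ i ∈ Finset.range q, ((p.choose (i + 2) / p : ℕ) : AddMonoid.End M) * x ^ i,
    ?_, fun B hB b hb => ?_, ?_⟩
  · exact Commute.sum_left _ _ _ fun i _ =>
      (Nat.cast_commute _ _).mul_left ((Commute.refl x).pow_left i)
  · have hpow : ∀ i : ℕ, (x ^ i) b ∈ B := by
      intro i
      induction i with
      | zero => exact hb
      | succ i ih => rw [pow_succ']; exact hB _ ih
    rw [end_sum_apply]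
    refine B.sum_mem fun i _ => ?_
    rw [← nsmul_eq_mul]
    exact B.nsmul_mem (hpow i) _
  · have h1 := congrArg (Polynomial.aeval x) (Polynomial.geom_sum_X_comp_X_add_one_eq_sum (R := ℤ) p)
    simp only [Polynomial.aeval_comp, map_sum, map_pow, map_add, Polynomial.aeval_X, map_one,
      map_mul, map_natCast] at h1
    have h3 : ∀ i ∈ Finset.range q, ((p.choose (i + 2) : ℕ) : AddMonoid.End M) * x ^ (i + 1) =
        (p : AddMonoid.End M) * (x * (((p.choose (i + 2) / p : ℕ) : AddMonoid.End M) * x ^ i)) := by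
      intro i hi
      have h2 : p ∣ p.choose (i + 2) := hp.out.dvd_choose_self (by omega)
        (by have := Finset.mem_range.1 hi; omega)
      conv_lhs => rw [← Nat.mul_div_cancel' h2]
      rw [Nat.cast_mul, mul_assoc, ← mul_assoc x, ← (Nat.cast_commute _ x).eq, mul_assoc,
        ← pow_succ']
    rw [hσ, h1]
    conv_lhs => rw [hq, Finset.sum_range_succ, Finset.sum_range_succ', ← hq]
    rw [Finset.sum_congr rfl h3, ← Finset.mul_sum, ← Finset.mul_sum, mul_add]
    simp [show p - 1 = q + 1 by omega]
    abel

theorem sub_one_apply (σ : AddMonoid.End M) (m : M) : (σ - 1) m = σ m - m := rfl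

theorem exists_sub_one_pow_apply_eq_zero (hodd : Odd p) {σ : AddMonoid.End M} (hσ : σ ^ p = 1)
    (k : ℕ) {m : M} (hm : p ^ k • m = 0) : ((σ - 1) ^ (p * k)) m = 0 := by
  have h1 := one_sub_pow_apply_eq_zero hodd hσ k m hm
  rw [← neg_sub, neg_pow]
  change ((-1 : AddMonoid.End M) ^ (p * k)) (((1 - σ) ^ (p * k)) m) = 0
  rw [h1, map_zero]

/-- Unipotence: x is nilpotent on the element and commutes with w. -/
theorem one_add_mul_injective {x w : AddMonoid.End M} (hw : Commute w x) {n : ℕ} :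
    ∀ t : M, (x ^ n) t = 0 → (1 + x * w) t = 0 → t = 0 := by
  induction n with
  | zero => exact fun t ht _ => ht
  | succ n ih =>
    intro t ht ht'
    refine ih t ?_ ht'
    have hc : Commute (1 + x * w) (x ^ n) :=
      (Commute.one_left _).add_left (((Commute.refl x).pow_right n).mul_left (hw.pow_right n))
    have h1 : (1 + x * w) ((x ^ n) t) = 0 := by
      change ((1 + x * w) * x ^ n) t = 0
      rw [hc.eq]
      change (x ^ n) ((1 + x * w) t) = 0
      rw [ht', map_zero]
    have h2 : (1 + x * w) ((x ^ n) t) = (x ^ n) t + w ((x ^ (n + 1)) t) := by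
      rw [← hw.eq, pow_succ']
      rfl
    rwa [h2, ht, map_zero, add_zero] at h1

theorem one_add_mul_surjective {x w : AddMonoid.End M} (hw : Commute w x) {B : AddSubgroup M}
    (hx : ∀ b ∈ B, x b ∈ B) (hwB : ∀ b ∈ B, w b ∈ B) {n : ℕ} :
    ∀ b ∈ B, (x ^ n) b = 0 → ∃ b' ∈ B, (1 + x * w) b' = b := by
  induction n with
  | zero => exact fun b _ h0 => ⟨0, B.zero_mem, by rw [map_zero]; exact h0.symm⟩
  | succ n ih =>
    intro b hb h0
    have h1 : (x ^ n) (x (w b)) = 0 := by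
      change (x ^ n * x * w) b = 0
      rw [← pow_succ, ← (hw.pow_right (n + 1)).eq]
      change w ((x ^ (n + 1)) b) = 0
      rw [h0, map_zero]
    obtain ⟨b', hb', h2⟩ := ih _ (hx _ (hwB b hb)) h1
    refine ⟨b - b', B.sub_mem hb hb', ?_⟩
    rw [map_sub, h2]
    change b + x (w b) - x (w b) = b
    rw [add_sub_cancel_right]

end Operator

/-! ### Counting and averaging -/

theorem AddSubgroup.card_eq_of_surjOn {M : Type*} [AddCommGroup M] (φ : M →+ M)
    (A B : AddSubgroup M) (hA : ∀ a ∈ A, φ a ∈ B) (hB : ∀ b ∈ B, ∃ a ∈ A, φ a = b) :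
    Nat.card A = Nat.card (A ⊓ φ.ker : AddSubgroup M) * Nat.card B := by
  let g : A →+ B := (φ.comp A.subtype).codRestrict B fun a => hA a a.2
  have hg : g.range = ⊤ := by
    refine AddMonoidHom.range_eq_top.2 fun b => ?_
    obtain ⟨a, ha, hab⟩ := hB b b.2
    exact ⟨⟨a, ha⟩, Subtype.ext hab⟩
  have e : g.ker ≃ (A ⊓ φ.ker : AddSubgroup M) :=
    { toFun := fun a => ⟨a.1, a.1.2, congrArg Subtype.val a.2⟩
      invFun := fun a => ⟨⟨a.1, a.2.1⟩, Subtype.ext a.2.2⟩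
      left_inv := fun a => rfl
      right_inv := fun a => rfl }
  rw [← Nat.card_congr e, ← AddSubgroup.card_mul_index g.ker, AddSubgroup.index_ker, hg,
    AddSubgroup.card_top]

theorem exists_projection {M : Type*} [AddCommGroup M] {P Q : AddSubgroup M} (hPQ : Disjoint P Q)
    {C : AddSubgroup M} (hC : ∀ c ∈ C, ∃ a ∈ P, ∃ b ∈ Q, c = a + b) :
    ∃ f : M → M, (∀ c ∈ C, f c ∈ P) ∧ (∀ c ∈ C, c - f c ∈ Q) ∧
      (∀ c ∈ C, ∀ a ∈ P, c - a ∈ Q → f c = a) ∧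
      ∀ c ∈ C, ∀ d ∈ C, f (c + d) = f c + f d := by
  classical
  choose! f hf g hg hfg using hC
  have h1 : ∀ c ∈ C, c - f c ∈ Q := fun c hc => by
    have h2 := hfg c hc
    rw [sub_eq_of_eq_add' h2]
    exact hg c hc
  have h3 : ∀ c ∈ C, ∀ a ∈ P, c - a ∈ Q → f c = a := fun c hc a ha hca => by
    refine sub_eq_zero.1 (AddSubgroup.disjoint_def.1 hPQ (P.sub_mem (hf c hc) ha) ?_)
    have h4 := Q.sub_mem hca (h1 c hc)
    rwa [sub_sub_sub_cancel_left] at h4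
  refine ⟨f, hf, h1, h3, fun c hc d hd => h3 _ (C.add_mem hc hd) _ (P.add_mem (hf c hc) (hf d hd)) ?_⟩
  rw [add_sub_add_comm]
  exact Q.add_mem (h1 c hc) (h1 d hd)

theorem sum_quotient_out_mul {G X : Type*} [Group G] [AddCommMonoid X] (U : Subgroup G)
    [Fintype (G ⧸ U)] (F : G → X) (hF : ∀ g, ∀ u ∈ U, F (g * u) = F g) (k : G) :
    ∑ q : G ⧸ U, F (k * q.out) = ∑ q : G ⧸ U, F q.out := by
  have h1 : ∀ q : G ⧸ U, F (k * q.out) = F (k • q).out := fun q => by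
    obtain ⟨v, hv⟩ := QuotientGroup.mk_out_eq_mul U (k * q.out)
    have h2 : ((k * q.out : G) : G ⧸ U) = k • q := by
      conv_rhs => rw [← q.out_eq']
      rfl
    rw [← h2, hv, hF _ _ v.2]
  simp_rw [h1]
  exact Equiv.sum_comp (MulAction.toPerm k) fun q : G ⧸ U => F q.out

section Average

variable {M : Type*} [AddCommGroup M] {G : Type*} [Group G] (ρ : G →* AddMonoid.End M)
  (U : Subgroup G)

theorem rho_mul (g k : G) (m : M) : ρ (g * k) m = ρ g (ρ k m) := by
  rw [map_mul]
  rfl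

theorem rho_one (m : M) : ρ 1 m = m := by
  rw [map_one]
  rfl

theorem conj_apply_mul {f : M → M} {C : AddSubgroup M} (hC : ∀ g, ∀ c ∈ C, ρ g c ∈ C)
    (hf : ∀ v ∈ U, ∀ c ∈ C, f (ρ v c) = ρ v (f c)) {c : M} (hc : c ∈ C) (g : G) {v : G}
    (hv : v ∈ U) : ρ (g * v) (f (ρ (g * v)⁻¹ c)) = ρ g (f (ρ g⁻¹ c)) := by
  rw [mul_inv_rev, rho_mul, rho_mul, hf _ (U.inv_mem hv) _ (hC _ _ hc), ← rho_mul ρ v,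
    mul_inv_cancel, rho_one]

variable [Fintype (G ⧸ U)]

/-- The sum of the conjugates of a map, over the cosets of `U`. -/
noncomputable def average (f : M → M) (m : M) : M := ∑ q : G ⧸ U, ρ q.out (f (ρ q.out⁻¹ m))

theorem average_add {f : M → M} {C : AddSubgroup M} (hC : ∀ g, ∀ c ∈ C, ρ g c ∈ C)
    (hf : ∀ c ∈ C, ∀ d ∈ C, f (c + d) = f c + f d) {c d : M} (hc : c ∈ C) (hd : d ∈ C) :
    average ρ U f (c + d) = average ρ U f c + average ρ U f d := by
  rw [average, average, average, ← Finset.sum_add_distrib]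
  exact Finset.sum_congr rfl fun q _ => by rw [map_add, hf _ (hC _ _ hc) _ (hC _ _ hd), map_add]

theorem average_apply {f : M → M} {C : AddSubgroup M} (hC : ∀ g, ∀ c ∈ C, ρ g c ∈ C)
    (hf : ∀ v ∈ U, ∀ c ∈ C, f (ρ v c) = ρ v (f c)) {c : M} (hc : c ∈ C) (k : G) :
    average ρ U f (ρ k c) = ρ k (average ρ U f c) := by
  have h1 := sum_quotient_out_mul U (fun g => ρ g (f (ρ g⁻¹ c)))
    (fun g v hv => conj_apply_mul ρ U hC hf hc g hv) k⁻¹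
  rw [average, average, ← h1, map_sum]
  refine Finset.sum_congr rfl fun q _ => ?_
  rw [← rho_mul ρ k, mul_inv_cancel_left, mul_inv_rev, inv_inv, rho_mul ρ _ k]

end Average

/-- An orbit without fixed point has exactly p elements, so its sum is one of the vanishing sums. -/
theorem sum_eq_sum_fixed {p : ℕ} [hp : Fact p.Prime] {X E : Type*} [Fintype X] [DecidableEq X]
    [AddCommMonoid E] (π : X → X) (hπ : ∀ x, π^[p] x = x) (h : X → E)
    (hN : ∀ x, ∑ i ∈ Finset.range p, h (π^[i] x) = 0) :
    ∑ x, h x = ∑ x with π x = x, h x := by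
  have key : ∀ s : Finset X, (∀ x ∈ s, π x ∈ s ∧ π x ≠ x) → ∑ x ∈ s, h x = 0 := by
    intro s
    induction s using Finset.strongInduction with
    | H s ih =>
      intro hs
      rcases s.eq_empty_or_nonempty with rfl | ⟨x, hx⟩
      · simp
      have hper : Function.IsPeriodicPt π p x := hπ x
      have hmin := Function.minimalPeriod_eq_prime hper (hs x hx).2
      set O := (Finset.range p).image fun i => π^[i] x with hO
      have hmem : ∀ i, π^[i] x ∈ O := fun i => Finset.mem_image.2
        ⟨i % p, Finset.mem_range.2 (Nat.mod_lt _ hp.out.pos), hper.iterate_mod_apply i⟩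
      have hOs : O ⊆ s := by
        intro z hz
        obtain ⟨i, -, rfl⟩ := Finset.mem_image.1 hz
        clear hz
        induction i with
        | zero => exact hx
        | succ i ih => rw [Function.iterate_succ_apply']; exact (hs _ ih).1
      have hsum : ∑ x ∈ O, h x = 0 := by
        rw [hO, Finset.sum_image]
        · exact hN x
        · intro i hi j hj hij
          refine Function.iterate_injOn_Iio_minimalPeriod (f := π) (x := x) ?_ ?_ hij <;>
            rw [hmin]
          · simpa using hi
          · simpa using hj
      rw [← Finset.sum_sdiff hOs, hsum, add_zero]
      refine ih _ (Finset.sdiff_ssubset hOs ⟨x, hmem 0⟩) fun z hz => ?_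
      rw [Finset.mem_sdiff] at hz
      refine ⟨Finset.mem_sdiff.2 ⟨(hs z hz.1).1, fun hz' => hz.2 ?_⟩, (hs z hz.1).2⟩
      obtain ⟨i, -, hi⟩ := Finset.mem_image.1 hz'
      have h1 : z = π^[p - 1 + i] x := by
        rw [Function.iterate_add_apply]
        rw [hi, ← Function.iterate_succ_apply, Nat.succ_eq_add_one,
          Nat.sub_add_cancel hp.out.one_le, hπ]
      rw [h1]
      exact hmem _
  rw [← Finset.sum_filter_add_sum_filter_not Finset.univ (fun x => π x = x),
    key (Finset.univ.filter fun x => ¬ π x = x) ?_, add_zero]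
  intro x hx
  have hx' : π x ≠ x := (Finset.mem_filter.1 hx).2
  refine ⟨Finset.mem_filter.2 ⟨Finset.mem_univ _, fun hxx => hx' ?_⟩, hx'⟩
  have h1 : ∀ i, π^[i] (π x) = π x := fun i => by
    induction i with
    | zero => rfl
    | succ i ih => rw [Function.iterate_succ_apply', ih, hxx]
  have h2 := h1 (p - 1)
  rw [← Function.iterate_succ_apply, Nat.succ_eq_add_one, Nat.sub_add_cancel hp.out.one_le,
    hπ] at h2
  exact h2.symm

/-! ### Divisibility of modules over a group with a Sylow subgroup of order `p` -/

/-- The fixed points of an endomorphism. -/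
def fixedSub {M : Type*} [AddCommGroup M] (σ : AddMonoid.End M) : AddSubgroup M :=
  AddMonoidHom.ker ((σ - 1 : AddMonoid.End M) : M →+ M)

/-- The elements `σ m - m`. -/
def movedSub {M : Type*} [AddCommGroup M] (σ : AddMonoid.End M) : AddSubgroup M :=
  AddMonoidHom.range ((σ - 1 : AddMonoid.End M) : M →+ M)

/-- An action of a group on a `p`-torsion module, together with an element `u` generating a Sylow
`p`-subgroup, such that invariant submodules fixed by `u` are restricted. -/
structure RigidAction (p : ℕ) {M : Type*} [AddCommGroup M] {G : Type*} [Group G]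
    (ρ : G →* AddMonoid.End M) (u : G) : Prop where
  odd : Odd p
  torsion : ∀ m : M, ∃ n : ℕ, p ^ n • m = 0
  pow_eq_one : u ^ p = 1
  coprime : p.Coprime (Subgroup.zpowers u).index
  cyclic : ∀ w ∈ fixedSub (ρ u) ⊓ movedSub (ρ u), w ≠ 0 →
    ∀ w' ∈ fixedSub (ρ u) ⊓ movedSub (ρ u), ∃ i : ℕ, w' = i • w
  exists_ne_zero : ∃ w ∈ fixedSub (ρ u) ⊓ movedSub (ρ u), w ≠ 0
  smul_eq_zero : ∀ w ∈ fixedSub (ρ u) ⊓ movedSub (ρ u), p • w = 0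
  map_mem : ∀ g, ∀ w ∈ fixedSub (ρ u) ⊓ movedSub (ρ u), ρ g w ∈ fixedSub (ρ u) →
    ρ g w ∈ fixedSub (ρ u) ⊓ movedSub (ρ u)
  invariant : ∀ Q ≤ fixedSub (ρ u), (∀ g, ∀ q ∈ Q, ρ g q ∈ Q) → Q ≠ ⊥ →
    fixedSub (ρ u) ⊓ movedSub (ρ u) ≤ Q ∧ ∃ Z₁ ≤ fixedSub (ρ u),
      Disjoint (fixedSub (ρ u) ⊓ movedSub (ρ u)) Z₁ ∧ ∀ z ∈ fixedSub (ρ u),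
        ∃ w ∈ fixedSub (ρ u) ⊓ movedSub (ρ u), ∃ z₁ ∈ Z₁, z = w + z₁
  exists_divisible : ∃ D : AddSubgroup M, (∀ d ∈ D, ρ u d ∈ D) ∧ (∀ d ∈ D, ∃ e ∈ D, p • e = d) ∧
    ¬ D ≤ fixedSub (ρ u)

theorem mem_fixedSub {M : Type*} [AddCommGroup M] {σ : AddMonoid.End M} {m : M} :
    m ∈ fixedSub σ ↔ σ m = m := by
  change (σ - 1) m = 0 ↔ _
  exact sub_eq_zero

theorem mem_fixedSub_iff {M : Type*} [AddCommGroup M] {σ : AddMonoid.End M} {m : M} :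
    m ∈ fixedSub σ ↔ (σ - 1) m = 0 := Iff.rfl

theorem sub_one_mem_movedSub {M : Type*} [AddCommGroup M] (σ : AddMonoid.End M) (m : M) :
    (σ - 1) m ∈ movedSub σ := ⟨m, rfl⟩

theorem nsmul_mem_iff_of_coprime {M : Type*} [AddCommGroup M] (B : AddSubgroup M) {p n : ℕ}
    (h : p.Coprime n) {m : M} (hp : p • m ∈ B) (hn : n • m ∈ B) : m ∈ B := by
  have h1 := Nat.gcd_eq_gcd_ab p n
  rw [h.gcd_eq_one] at h1
  have h2 : m = (p.gcdA n) • (p • m) + (p.gcdB n) • (n • m) := by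
    rw [← natCast_zsmul m p, ← natCast_zsmul m n, smul_smul, smul_smul, ← add_smul,
      mul_comm (p.gcdA n), mul_comm (p.gcdB n), ← h1, Nat.cast_one, one_smul]
  rw [h2]
  exact B.add_mem (B.zsmul_mem hp _) (B.zsmul_mem hn _)

namespace RigidAction

variable {p : ℕ} [hp : Fact p.Prime] {M : Type*} [AddCommGroup M] {G : Type*} [Group G]
  {ρ : G →* AddMonoid.End M} {u : G}

theorem rho_pow_eq_one (h : RigidAction p ρ u) : ρ u ^ p = 1 := by
  rw [← map_pow, h.pow_eq_one, map_one]

theorem exists_pow_eq_zero (h : RigidAction p ρ u) (m : M) : ∃ n : ℕ, ((ρ u - 1) ^ n) m = 0 := by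
  obtain ⟨n, hn⟩ := h.torsion m
  exact ⟨_, exists_sub_one_pow_apply_eq_zero h.odd h.rho_pow_eq_one n hn⟩

/-- The norm of u is (u−1)^(p−1) + p·v with v unipotent on each element, and it kills [M,u] because
u^p = 1. So p and (u−1)^(p−1) agree on [M,u] up to the factor −v. -/
theorem exists_norm_eq (h : RigidAction p ρ u) : ∃ v : AddMonoid.End M,
    (∀ m, v m = 0 → m = 0) ∧
    (∀ B : AddSubgroup M, (∀ b ∈ B, (ρ u - 1) b ∈ B) → ∀ b ∈ B, ∃ b' ∈ B, v b' = b) ∧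
    (∀ m, ∑ i ∈ Finset.range p, (ρ u ^ i) m = ((ρ u - 1) ^ (p - 1)) m + p • v m) ∧
    ∀ s ∈ movedSub (ρ u), ((ρ u - 1) ^ (p - 1)) s + p • v s = 0 := by
  obtain ⟨w, hw, hwB, hs⟩ := exists_geom_sum_eq (p := p) (ρ u)
  have hsum : ∀ m, ∑ i ∈ Finset.range p, (ρ u ^ i) m =
      ((ρ u - 1) ^ (p - 1)) m + p • (1 + (ρ u - 1) * w) m := fun m => by
    rw [← end_sum_apply, hs, ← nsmul_eq_mul]
    rfl
  refine ⟨1 + (ρ u - 1) * w, fun m hm => ?_, fun B hB b hb => ?_, hsum, ?_⟩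
  · obtain ⟨n, hn⟩ := h.exists_pow_eq_zero m
    exact one_add_mul_injective hw m hn hm
  · obtain ⟨n, hn⟩ := h.exists_pow_eq_zero b
    exact one_add_mul_surjective hw hB (hwB B hB) b hb hn
  · rintro _ ⟨t, rfl⟩
    rw [← hsum, ← end_sum_apply]
    change ((∑ i ∈ Finset.range p, ρ u ^ i) * (ρ u - 1)) t = 0
    rw [geom_sum_mul, h.rho_pow_eq_one, sub_self]
    rfl

/-- B = pB = v(pB) = (u−1)^(p−1)B. -/
theorem exists_sub_one_eq (h : RigidAction p ρ u) {B : AddSubgroup M} (hB : B ≤ movedSub (ρ u))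
    (hx : ∀ b ∈ B, (ρ u - 1) b ∈ B) (hd : ∀ b ∈ B, ∃ b' ∈ B, p • b' = b) :
    ∀ b ∈ B, ∃ b' ∈ B, (ρ u - 1) b' = b := by
  obtain ⟨v, -, hv, -, hv'⟩ := h.exists_norm_eq
  intro b hb
  obtain ⟨b₁, hb₁, rfl⟩ := hv B hx b hb
  obtain ⟨b₂, hb₂, rfl⟩ := hd b₁ hb₁
  have h1 := hv' b₂ (hB hb₂)
  have hpow : ∀ i : ℕ, ((ρ u - 1) ^ i) b₂ ∈ B := by
    intro i
    induction i with
    | zero => exact hb₂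
    | succ i ih => rw [pow_succ']; exact hx _ ih
  refine ⟨-((ρ u - 1) ^ (p - 2)) b₂, B.neg_mem (hpow _), ?_⟩
  rw [map_neg, map_nsmul, neg_eq_iff_add_eq_zero, ← h1]
  congr 1
  change ((ρ u - 1) * (ρ u - 1) ^ (p - 2)) b₂ = _
  rw [← pow_succ', show p - 2 + 1 = p - 1 by have := hp.out.two_le; omega]

theorem le_of_mem (h : RigidAction p ρ u) {B : AddSubgroup M} {w : M}
    (hw : w ∈ fixedSub (ρ u) ⊓ movedSub (ρ u)) (hw0 : w ≠ 0) (hwB : w ∈ B) :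
    fixedSub (ρ u) ⊓ movedSub (ρ u) ≤ B := by
  intro w' hw'
  obtain ⟨i, rfl⟩ := h.cyclic w hw hw0 w' hw'
  exact B.nsmul_mem hwB i

/-- By nilpotence B contains a nonzero fixed element, hence all fixed elements of [M,u]. As u − 1
maps B onto B, induction on the nilpotency degree puts each element of [M,u] into B. -/
theorem movedSub_le (h : RigidAction p ρ u) {B : AddSubgroup M} (hB : B ≤ movedSub (ρ u))
    (hx : ∀ b ∈ B, (ρ u - 1) b ∈ B) (hd : ∀ b ∈ B, ∃ b' ∈ B, p • b' = b) (hne : B ≠ ⊥) :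
    movedSub (ρ u) ≤ B := by
  have hsurj := h.exists_sub_one_eq hB hx hd
  obtain ⟨b, hb, hb0⟩ : ∃ b ∈ B, b ≠ 0 := by
    by_contra! hcon
    exact hne ((AddSubgroup.eq_bot_iff_forall B).2 hcon)
  have hle : fixedSub (ρ u) ⊓ movedSub (ρ u) ≤ B := by
    obtain ⟨n, hn⟩ := h.exists_pow_eq_zero b
    have key : ∀ n : ℕ, ∀ b ∈ B, b ≠ 0 → ((ρ u - 1) ^ n) b = 0 →
        ∃ w ∈ B, w ≠ 0 ∧ w ∈ fixedSub (ρ u) := by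
      intro n
      induction n with
      | zero => exact fun b _ hb0 hn => absurd hn hb0
      | succ n ih =>
        intro b hb hb0 hn
        by_cases hb' : (ρ u - 1) b = 0
        · exact ⟨b, hb, hb0, hb'⟩
        · exact ih _ (hx b hb) hb' hn
    obtain ⟨w, hwB, hw0, hw⟩ := key n b hb hb0 hn
    exact h.le_of_mem ⟨hw, hB hwB⟩ hw0 hwB
  have key : ∀ n : ℕ, ∀ s ∈ movedSub (ρ u), ((ρ u - 1) ^ n) s = 0 → s ∈ B := by
    intro n
    induction n with
    | zero =>
      intro s _ hs
      have h0 : s = 0 := hs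
      exact h0 ▸ B.zero_mem
    | succ n ih =>
      intro s hs hn
      obtain ⟨b', hb', hbs⟩ := hsurj _ (ih _ (sub_one_mem_movedSub (ρ u) s) hn)
      have h1 : s - b' ∈ fixedSub (ρ u) := by
        rw [mem_fixedSub_iff, map_sub, hbs, sub_self]
      have h2 := B.add_mem (hle ⟨h1, AddSubgroup.sub_mem _ hs (hB hb')⟩) hb'
      rwa [sub_add_cancel] at h2
  intro s hs
  obtain ⟨n, hn⟩ := h.exists_pow_eq_zero s
  exact key n s hs hn

/-- The module is the sum of a divisible submodule and the fixed points. -/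
theorem exists_divisible_sup (h : RigidAction p ρ u) : ∃ D : AddSubgroup M,
    (∀ d ∈ D, ρ u d ∈ D) ∧ (∀ d ∈ D, ∃ e ∈ D, p • e = d) ∧
    (∀ s ∈ movedSub (ρ u), ∃ d ∈ D, (ρ u - 1) d = s) := by
  obtain ⟨D, hD, hdiv, hne⟩ := h.exists_divisible
  refine ⟨D, hD, hdiv, fun s hs => ?_⟩
  have hle : movedSub (ρ u) ≤ D.map ((ρ u - 1 : AddMonoid.End M) : M →+ M) := by
    refine h.movedSub_le ?_ ?_ ?_ ?_
    · rintro _ ⟨d, -, rfl⟩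
      exact ⟨d, rfl⟩
    · rintro _ ⟨d, hd, rfl⟩
      exact ⟨_, D.sub_mem (hD d hd) hd, rfl⟩
    · rintro _ ⟨d, hd, rfl⟩
      obtain ⟨e, he, rfl⟩ := hdiv d hd
      exact ⟨_, ⟨e, he, rfl⟩, (map_nsmul _ _ _).symm⟩
    · intro hbot
      refine hne fun d hd => ?_
      have h1 : (ρ u - 1) d ∈ D.map ((ρ u - 1 : AddMonoid.End M) : M →+ M) := ⟨d, hd, rfl⟩
      rw [hbot] at h1
      exact h1
  exact hle hs

theorem movedSub_divisible (h : RigidAction p ρ u) : ∀ s ∈ movedSub (ρ u),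
    ∃ s' ∈ movedSub (ρ u), p • s' = s := by
  obtain ⟨D, hD, hdiv, hs⟩ := h.exists_divisible_sup
  intro s hs'
  obtain ⟨d, hd, rfl⟩ := hs s hs'
  obtain ⟨e, he, rfl⟩ := hdiv d hd
  exact ⟨_, sub_one_mem_movedSub (ρ u) e, (map_nsmul _ _ _).symm⟩

theorem movedSub_surj (h : RigidAction p ρ u) : ∀ s ∈ movedSub (ρ u),
    ∃ s' ∈ movedSub (ρ u), (ρ u - 1) s' = s :=
  h.exists_sub_one_eq le_rfl (fun b _ => sub_one_mem_movedSub (ρ u) b) h.movedSub_divisible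

theorem fixedSub_sub_mem (m s : M) (hms : (ρ u - 1) s = (ρ u - 1) m) :
    m - s ∈ fixedSub (ρ u) := by
  rw [mem_fixedSub_iff, map_sub, hms, sub_self]

theorem exists_eq_smul_add (h : RigidAction p ρ u) (m : M) :
    ∃ a, ∃ z ∈ fixedSub (ρ u), m = p • a + z := by
  obtain ⟨D, hD, hdiv, hs⟩ := h.exists_divisible_sup
  obtain ⟨d, hd, hdm⟩ := hs _ (sub_one_mem_movedSub (ρ u) m)
  obtain ⟨e, he, rfl⟩ := hdiv d hd
  exact ⟨e, _, fixedSub_sub_mem m _ hdm, (add_sub_cancel _ _).symm⟩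

theorem exists_eq_moved_add (h : RigidAction p ρ u) (m : M) :
    ∃ s ∈ movedSub (ρ u), ∃ z ∈ fixedSub (ρ u), m = s + z := by
  obtain ⟨s, hs, hsm⟩ := h.movedSub_surj _ (sub_one_mem_movedSub (ρ u) m)
  exact ⟨s, hs, _, fixedSub_sub_mem m s hsm, (add_sub_cancel _ _).symm⟩

theorem apply_zpowers {v : G} (hv : v ∈ Subgroup.zpowers u) {m : M} (hm : m ∈ fixedSub (ρ u)) :
    ρ v m = m := by
  have h1 : Subgroup.zpowers u ≤
      { carrier := {g : G | ρ g m = m}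
        one_mem' := rho_one ρ m
        mul_mem' := fun {a b} (ha : ρ a m = m) (hb : ρ b m = m) =>
          show ρ (a * b) m = m by rw [rho_mul, hb, ha]
        inv_mem' := fun {a} (ha : ρ a m = m) => show ρ a⁻¹ m = m by
          conv_lhs => rw [← ha]
          rw [← rho_mul, inv_mul_cancel, rho_one] : Subgroup G } := by
    rw [Subgroup.zpowers_le]
    exact mem_fixedSub.1 hm
  exact h1 hv

/-- M = C + pM, where C is the centralizer in M of the kernel H of the action on M/pM, and C itself
lies in pM. -/
theorem divisible [Finite G] (h : RigidAction p ρ u) (m : M) : ∃ a, p • a = m := by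
  let P : AddSubgroup M := (nsmulAddMonoidHom (α := M) p).range
  let H : Subgroup G :=
    { carrier := {g | ∀ m, ρ g m - m ∈ P}
      one_mem' := fun m => by rw [rho_one, sub_self]; exact P.zero_mem
      mul_mem' := fun {a b} ha hb m => by
        have h1 := P.add_mem (ha (ρ b m)) (hb m)
        rwa [sub_add_sub_cancel, ← rho_mul] at h1
      inv_mem' := fun {a} ha m => by
        have h1 := P.neg_mem (ha (ρ a⁻¹ m))
        rwa [neg_sub, ← rho_mul, mul_inv_cancel, rho_one] at h1 }
  have hP : ∀ g : G, ∀ m ∈ P, ρ g m ∈ P := by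
    rintro g _ ⟨a, rfl⟩
    exact ⟨ρ g a, (map_nsmul _ _ _).symm⟩
  have huH : u ∈ H := by
    intro m
    obtain ⟨a, z, hz, rfl⟩ := h.exists_eq_smul_add m
    rw [map_add, mem_fixedSub.1 hz, add_sub_add_right_eq_sub]
    exact P.sub_mem (hP u _ ⟨a, rfl⟩) ⟨a, rfl⟩
  have hnormal : ∀ g : G, ∀ k ∈ H, g⁻¹ * k * g ∈ H := by
    intro g k hk m
    have h1 := hP g⁻¹ _ (hk (ρ g m))
    rwa [map_sub, ← rho_mul, ← rho_mul, ← rho_mul, inv_mul_cancel, rho_one] at h1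
  let C : AddSubgroup M :=
    { carrier := {m | ∀ k ∈ H, ρ k m = m}
      zero_mem' := fun k _ => map_zero _
      add_mem' := fun {a b} ha hb k hk => by rw [map_add, ha k hk, hb k hk]
      neg_mem' := fun {a} ha k hk => by rw [map_neg, ha k hk] }
  have hCG : ∀ g, ∀ c ∈ C, ρ g c ∈ C := by
    intro g c hc k hk
    have h1 := hc _ (hnormal g k hk)
    conv_rhs => rw [← h1]
    rw [← rho_mul, ← rho_mul]
    congr 2
    group
  have hCZ : C ≤ fixedSub (ρ u) := fun c hc => mem_fixedSub.2 (hc u huH)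
  have hUH : Subgroup.zpowers u ≤ H := Subgroup.zpowers_le.2 huH
  -- The transfer of z over H/⟨u⟩ lies in C and is congruent modulo pM to z times the index, which
  -- is prime to p.
  have htransfer : ∀ z ∈ fixedSub (ρ u), z ∈ C ⊔ P := by
    intro z hz
    let U := (Subgroup.zpowers u).subgroupOf H
    obtain ⟨inst⟩ := nonempty_fintype (H ⧸ U)
    let ρ' : H →* AddMonoid.End M := ρ.comp H.subtype
    have hF : ∀ g, ∀ v ∈ U, ρ' (g * v) z = ρ' g z := fun g v hv => by
      rw [rho_mul]
      exact congrArg _ (apply_zpowers (Subgroup.mem_subgroupOf.1 hv) hz)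
    have hN : ∑ q : H ⧸ U, ρ' q.out z ∈ C := by
      intro k hk
      have h1 := sum_quotient_out_mul U (fun g => ρ' g z) hF ⟨k, hk⟩
      rw [map_sum, ← h1]
      exact Finset.sum_congr rfl fun q _ => (rho_mul ρ' ⟨k, hk⟩ q.out z).symm
    have hd : ∑ q : H ⧸ U, ρ' q.out z - U.index • z ∈ P := by
      rw [Subgroup.index_eq_card, Nat.card_eq_fintype_card, ← Finset.card_univ,
        ← Finset.sum_const, ← Finset.sum_sub_distrib]
      exact P.sum_mem fun q _ => q.out.2 z
    have hcop : p.Coprime U.index := by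
      refine h.coprime.coprime_dvd_right ?_
      exact ⟨H.index, (Subgroup.relIndex_mul_index hUH).symm⟩
    refine nsmul_mem_iff_of_coprime _ hcop
      ((le_sup_right : P ≤ C ⊔ P) ⟨z, rfl⟩) ?_
    have h2 := (C ⊔ P).sub_mem ((le_sup_left : C ≤ C ⊔ P) hN) ((le_sup_right : P ≤ C ⊔ P) hd)
    rwa [sub_sub_cancel] at h2
  have hCP : C ≤ P := by
    by_cases hC : C = ⊥
    · rw [hC]
      exact bot_le
    obtain ⟨hZC, Z₁, hZ₁, hdisj, hdec⟩ := h.invariant C hCZ hCG hC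
    have hZ₀G : ∀ g, ∀ w ∈ fixedSub (ρ u) ⊓ movedSub (ρ u),
        ρ g w ∈ fixedSub (ρ u) ⊓ movedSub (ρ u) := fun g w hw =>
      h.map_mem g w hw (hCZ (hCG g w (hZC hw)))
    -- The average φ of the projection onto the fixed elements of [M,u] is G-equivariant on C, and
    -- is multiplication by the index of ⟨u⟩ on its image.
    obtain ⟨f, hfZ, -, hfu, hfadd⟩ := exists_projection hdisj hdec
    obtain ⟨inst⟩ := nonempty_fintype (G ⧸ Subgroup.zpowers u)
    let φ := average ρ (Subgroup.zpowers u) f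
    have hφadd : ∀ c ∈ C, ∀ d ∈ C, φ (c + d) = φ c + φ d := fun c hc d hd =>
      average_add ρ _ hCG (fun c hc d hd => hfadd c (hCZ hc) d (hCZ hd)) hc hd
    have hfcomm : ∀ v ∈ Subgroup.zpowers u, ∀ c ∈ C, f (ρ v c) = ρ v (f c) := fun v hv c hc => by
      rw [apply_zpowers hv (hCZ hc), apply_zpowers hv (hfZ c (hCZ hc)).1]
    have hφρ : ∀ g, ∀ c ∈ C, φ (ρ g c) = ρ g (φ c) := fun g c hc =>
      average_apply ρ _ hCG hfcomm hc g
    have hφmem : ∀ c ∈ C, φ c ∈ fixedSub (ρ u) ⊓ movedSub (ρ u) := fun c hc =>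
      AddSubgroup.sum_mem _ fun q _ => hZ₀G _ _ (hfZ _ (hCZ (hCG _ c hc)))
    have hφZ₀ : ∀ w ∈ fixedSub (ρ u) ⊓ movedSub (ρ u), φ w = (Subgroup.zpowers u).index • w := by
      intro w hw
      rw [Subgroup.index_eq_card, Nat.card_eq_fintype_card, ← Finset.card_univ,
        ← Finset.sum_const]
      refine Finset.sum_congr rfl fun q _ => ?_
      have h1 := hZ₀G q.out⁻¹ w hw
      rw [hfu _ h1.1 _ h1 (by rw [sub_self]; exact Z₁.zero_mem), ← rho_mul, mul_inv_cancel,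
        rho_one]
    have hinj : ∀ w ∈ fixedSub (ρ u) ⊓ movedSub (ρ u), φ w = 0 → w = 0 := by
      intro w hw hw0
      rw [hφZ₀ w hw] at hw0
      exact nsmul_mem_iff_of_coprime ⊥ h.coprime (h.smul_eq_zero w hw) hw0
    have hφ0 : φ 0 = 0 := by
      have h1 := hφadd 0 C.zero_mem 0 C.zero_mem
      rwa [add_zero, left_eq_add] at h1
    have hφneg : ∀ c ∈ C, φ (-c) = -φ c := fun c hc => by
      have h1 := hφadd (-c) (C.neg_mem hc) c hc
      rw [neg_add_cancel, hφ0] at h1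
      exact eq_neg_of_add_eq_zero_left h1.symm
    let K : AddSubgroup M :=
      { carrier := {c | c ∈ C ∧ φ c = 0}
        zero_mem' := ⟨C.zero_mem, hφ0⟩
        add_mem' := fun {a b} ha hb => ⟨C.add_mem ha.1 hb.1, by
          rw [hφadd a ha.1 b hb.1, ha.2, hb.2, add_zero]⟩
        neg_mem' := fun {a} ha => ⟨C.neg_mem ha.1, by rw [hφneg a ha.1, ha.2, neg_zero]⟩ }
    -- The kernel of φ on C is invariant, so if nonzero it would contain the fixed elements of
    -- [M,u], where φ is injective.
    have hK : K = ⊥ := by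
      by_contra hK
      obtain ⟨hle, -⟩ := h.invariant K (fun c hc => hCZ hc.1)
        (fun g c hc => ⟨hCG g c hc.1, by rw [hφρ g c hc.1, hc.2, map_zero]⟩) hK
      obtain ⟨w, hw, hw0⟩ := h.exists_ne_zero
      exact hw0 (hinj w hw (hle hw).2)
    intro c hc
    have h1 := hφmem c hc
    -- Since b inverts the index modulo p, c − b·φ(c) lies in the kernel of φ, so c = b·φ(c) lies in
    -- the divisible group [M,u].
    obtain ⟨a, b, hab⟩ := Nat.isCoprime_iff_coprime.2 h.coprime
    have hb : φ (b • φ c) = φ c := by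
      rw [hφZ₀ _ (AddSubgroup.zsmul_mem _ h1 b), ← natCast_zsmul, smul_smul]
      have h2 : φ c = a • (p • φ c) + ((Subgroup.zpowers u).index * b : ℤ) • φ c := by
        rw [← natCast_zsmul (φ c) p, smul_smul, ← add_smul, mul_comm (_ : ℤ) b, hab, one_smul]
      conv_rhs => rw [h2]
      rw [h.smul_eq_zero _ h1, smul_zero, zero_add]
    have hbC := hZC (AddSubgroup.zsmul_mem _ h1 b)
    have h3 : c - b • φ c ∈ K := by
      refine ⟨C.sub_mem hc hbC, ?_⟩
      rw [sub_eq_add_neg, hφadd _ hc _ (C.neg_mem hbC), hφneg _ hbC, hb, add_neg_cancel]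
    rw [hK, AddSubgroup.mem_bot, sub_eq_zero] at h3
    rw [h3]
    obtain ⟨s, -, hs⟩ := h.movedSub_divisible _ (AddSubgroup.zsmul_mem _ h1 b).2
    exact ⟨s, hs⟩
  obtain ⟨a, z, hz, rfl⟩ := h.exists_eq_smul_add m
  have hmP : p • a + z ∈ P := P.add_mem ⟨a, rfl⟩ (sup_le hCP le_rfl (htransfer z hz))
  exact hmP

end RigidAction

/-- The elements of exponent `p`. -/
def socle (p : ℕ) (M : Type*) [AddCommGroup M] : AddSubgroup M :=
  (nsmulAddMonoidHom (α := M) p).ker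

theorem mem_socle {p : ℕ} {M : Type*} [AddCommGroup M] {m : M} : m ∈ socle p M ↔ p • m = 0 :=
  Iff.rfl

/-! ### Counting socles, and divisibility of the fixed points -/

namespace RigidAction

variable {p : ℕ} [hp : Fact p.Prime] {M : Type*} [AddCommGroup M] {G : Type*} [Group G]
  {ρ : G →* AddMonoid.End M} {u : G}

theorem card_fixed_moved (h : RigidAction p ρ u) :
    Nat.card (fixedSub (ρ u) ⊓ movedSub (ρ u) : AddSubgroup M) = p := by
  obtain ⟨w, hw, hw0⟩ := h.exists_ne_zero
  have h1 : fixedSub (ρ u) ⊓ movedSub (ρ u) = AddSubgroup.zmultiples w :=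
    le_antisymm (h.le_of_mem hw hw0 (AddSubgroup.mem_zmultiples w))
      (by rw [AddSubgroup.zmultiples_le]; exact hw)
  rw [h1, Nat.card_zmultiples, addOrderOf_eq_prime (h.smul_eq_zero w hw) hw0]

/-- u − 1 maps [M,u] onto itself with kernel of order p. -/
theorem card_moved_ker (h : RigidAction p ρ u) (n : ℕ) :
    Nat.card (movedSub (ρ u) ⊓ AddMonoidHom.ker
      (((ρ u - 1) ^ n : AddMonoid.End M) : M →+ M) : AddSubgroup M) = p ^ n := by
  induction n with
  | zero =>
    have h0 : movedSub (ρ u) ⊓ AddMonoidHom.ker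
        (((ρ u - 1) ^ 0 : AddMonoid.End M) : M →+ M) = ⊥ := by
      refine (AddSubgroup.eq_bot_iff_forall _).2 fun m hm => ?_
      have h0 : ((ρ u - 1) ^ 0 : AddMonoid.End M) m = 0 := hm.2
      rwa [pow_zero] at h0
    rw [h0, AddSubgroup.card_bot, pow_zero]
  | succ n ih =>
    rw [AddSubgroup.card_eq_of_surjOn ((ρ u - 1 : AddMonoid.End M) : M →+ M) _ (movedSub (ρ u) ⊓
      AddMonoidHom.ker (((ρ u - 1) ^ n : AddMonoid.End M) : M →+ M)), ih, pow_succ' p n]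
    · congr 1
      refine Eq.trans ?_ h.card_fixed_moved
      congr 2
      ext m
      refine ⟨fun hm => ⟨hm.2, hm.1.1⟩, fun hm => ⟨⟨hm.2, ?_⟩, hm.1⟩⟩
      change ((ρ u - 1) ^ n) ((ρ u - 1) m) = 0
      rw [mem_fixedSub_iff.1 hm.1, map_zero]
    · exact fun m hm => ⟨sub_one_mem_movedSub (ρ u) m, hm.2⟩
    · intro s hs
      obtain ⟨s', hs', h1⟩ := h.movedSub_surj s hs.1
      refine ⟨s', ⟨hs', ?_⟩, h1⟩
      change ((ρ u - 1) ^ n) ((ρ u - 1) s') = 0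
      rw [h1]
      exact hs.2

/-- On [M,u], (u−1)^(p−1) is −p·v with v injective. -/
theorem moved_socle_iff (h : RigidAction p ρ u) {s : M} (hs : s ∈ movedSub (ρ u)) :
    p • s = 0 ↔ ((ρ u - 1) ^ (p - 1)) s = 0 := by
  obtain ⟨v, hv, -, -, hv'⟩ := h.exists_norm_eq
  have h1 := hv' s hs
  constructor
  · intro h0
    rwa [← map_nsmul, h0, map_zero, add_zero] at h1
  · intro h0
    rw [h0, zero_add, ← map_nsmul] at h1
    exact hv _ h1

theorem card_moved_socle (h : RigidAction p ρ u) :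
    Nat.card (movedSub (ρ u) ⊓ socle p M : AddSubgroup M) = p ^ (p - 1) := by
  rw [← h.card_moved_ker]
  congr 2
  ext s
  exact ⟨fun hs => ⟨hs.1, (h.moved_socle_iff hs.1).1 hs.2⟩,
    fun hs => ⟨hs.1, (h.moved_socle_iff hs.1).2 hs.2⟩⟩

/-- u − 1 maps the socle of M onto that of [M,u]: if (u−1)s has exponent p then p·s is fixed, and by
divisibility s can be corrected by a fixed element to have exponent p. -/
theorem card_fixed_socle (h : RigidAction p ρ u)
    (hdiv : ∀ z ∈ fixedSub (ρ u), ∃ z' ∈ fixedSub (ρ u), p • z' = z) :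
    Nat.card (socle p M) = Nat.card (fixedSub (ρ u) ⊓ socle p M : AddSubgroup M) * p ^ (p - 1) := by
  rw [AddSubgroup.card_eq_of_surjOn ((ρ u - 1 : AddMonoid.End M) : M →+ M) _
    (movedSub (ρ u) ⊓ socle p M), h.card_moved_socle, inf_comm]
  · rfl
  · intro m hm
    refine ⟨sub_one_mem_movedSub (ρ u) m, ?_⟩
    have h1 := map_nsmul (ρ u - 1) p m
    rw [mem_socle.1 hm, map_zero] at h1
    exact h1.symm
  · rintro t ⟨ht, ht'⟩
    obtain ⟨s, hs, rfl⟩ := h.movedSub_surj t ht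
    have h1 : p • s ∈ fixedSub (ρ u) := by
      rw [mem_fixedSub_iff, map_nsmul]
      exact ht'
    obtain ⟨z, hz, hzs⟩ := hdiv _ h1
    refine ⟨s - z, ?_, ?_⟩
    · rw [mem_socle, nsmul_sub, hzs, sub_self]
    · change (ρ u - 1) (s - z) = (ρ u - 1) s
      rw [map_sub, mem_fixedSub_iff.1 hz, sub_zero]

/-- If `Y` is a complement to `[M, u]` in `M` which is fixed by `u`, then `Y` has no elements of
order `p`. -/
theorem socle_complement_eq_zero [Finite G] (h : RigidAction p ρ u) {Y : AddSubgroup M}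
    (hY : Y ≤ fixedSub (ρ u)) (hdisj : Disjoint Y (movedSub (ρ u)))
    (hdec : ∀ m : M, ∃ y ∈ Y, ∃ s ∈ movedSub (ρ u), m = y + s) : ∀ y ∈ Y, p • y = 0 → y = 0 := by
  classical
  obtain ⟨f, hfY, hfS, hfu, hfadd⟩ := exists_projection hdisj (C := ⊤) fun m _ => hdec m
  have htop : ∀ m : M, m ∈ (⊤ : AddSubgroup M) := fun _ => trivial
  replace hfY := fun m => hfY m (htop m)
  replace hfS := fun m => hfS m (htop m)
  replace hfu := fun m => hfu m (htop m)
  replace hfadd := fun a b => hfadd a (htop a) b (htop b)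
  obtain ⟨inst⟩ := nonempty_fintype (G ⧸ Subgroup.zpowers u)
  have hfzp : ∀ v ∈ Subgroup.zpowers u, ∀ m, f (ρ v m) = ρ v (f m) := by
    intro v hv m
    rw [apply_zpowers hv (hY (hfY m))]
    refine hfu _ _ (hfY m) ?_
    obtain ⟨t, ht⟩ := hfS m
    have h1 : ρ v m = f m + ρ v (m - f m) := by
      rw [map_sub, apply_zpowers hv (hY (hfY m)), add_sub_cancel]
    rw [h1, add_sub_cancel_left, ← ht]
    have hc : ρ v * (ρ u - 1) = (ρ u - 1) * ρ v := by
      obtain ⟨n, rfl⟩ := hv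
      rw [mul_sub, sub_mul, ← map_mul, ← map_mul, mul_one, one_mul]
      simp only [(Commute.refl u).zpow_left n |>.eq]
    change (ρ v * (ρ u - 1)) t ∈ _
    rw [hc]
    exact sub_one_mem_movedSub (ρ u) _
  have hCG : ∀ g, ∀ c ∈ (⊤ : AddSubgroup M), ρ g c ∈ (⊤ : AddSubgroup M) := fun _ _ _ => trivial
  -- The trace over G/⟨u⟩ of the projection f onto Y, a G-equivariant endomorphism.
  let φ : M →+ M := AddMonoidHom.mk' (average ρ (Subgroup.zpowers u) f) fun a b =>
    average_add ρ _ hCG (fun a _ b _ => hfadd a b) (htop a) (htop b)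
  have hφρ : ∀ g m, φ (ρ g m) = ρ g (φ m) := fun g m =>
    average_apply ρ _ hCG (fun v hv c _ => hfzp v hv c) (htop m) g
  have hφx : ∀ m, φ ((ρ u - 1) m) = (ρ u - 1) (φ m) := fun m => by
    rw [sub_one_apply, sub_one_apply, map_sub, hφρ]
  have hf0 : f 0 = 0 := hfu 0 0 Y.zero_mem (by simp)
  have hfp : ∀ m, p • m = 0 → p • f m = 0 := by
    intro m hm
    have h1 := map_nsmul (AddMonoidHom.mk' f hfadd) p m
    rw [hm, map_zero] at h1
    exact h1.symm
  have hfS0 : ∀ s ∈ movedSub (ρ u), f s = 0 := fun s hs => hfu s 0 Y.zero_mem (by simpa using hs)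
  have hSY : ∀ m ∈ Y, m ∈ movedSub (ρ u) → m = 0 := fun m hm hm' =>
    AddSubgroup.disjoint_def.1 hdisj hm hm'
  have hsplit : ∀ m, p • m = 0 → ∃ y ∈ Y, ∃ s ∈ movedSub (ρ u), m = y + s ∧ p • y = 0 ∧
      p • s = 0 := by
    intro m hm
    obtain ⟨y, hy, s, hs, rfl⟩ := hdec m
    rw [nsmul_add] at hm
    have h1 : p • y = 0 := by
      refine hSY _ (Y.nsmul_mem hy p) ?_
      rw [eq_neg_of_add_eq_zero_left hm]
      exact AddSubgroup.neg_mem _ (AddSubgroup.nsmul_mem _ hs p)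
    rw [h1, zero_add] at hm
    exact ⟨y, hy, s, hs, rfl, h1, hm⟩
  have hnorm : ∀ m, p • m = 0 → ∑ i ∈ Finset.range p, (ρ u ^ i) m = 0 := by
    intro m hm
    obtain ⟨v, -, -, hv, -⟩ := h.exists_norm_eq
    obtain ⟨y, hy, s, hs, rfl, hpy, hps⟩ := hsplit m hm
    have h1 : ((ρ u - 1) ^ (p - 1)) y = 0 := by
      rw [show p - 1 = p - 2 + 1 by have := hp.out.two_le; omega, pow_succ]
      change ((ρ u - 1) ^ (p - 2)) ((ρ u - 1) y) = 0
      rw [mem_fixedSub_iff.1 (hY hy), map_zero]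
    rw [hv, ← map_nsmul, hm, map_zero, add_zero, map_add, h1, (h.moved_socle_iff hs).1 hps,
      add_zero]
  let π : G ⧸ Subgroup.zpowers u → G ⧸ Subgroup.zpowers u := fun q => u • q
  have hπi : ∀ i q, π^[i] q = u ^ i • q := fun i q => by
    induction i with
    | zero => simp
    | succ i ih => rw [Function.iterate_succ_apply', ih, pow_succ', mul_smul]
  have hπp : ∀ q, π^[p] q = q := fun q => by rw [hπi, h.pow_eq_one, one_smul]
  -- On fixed socle elements, orbits of u on G/⟨u⟩ of length p contribute norms, which vanish on the
  -- socle. Only the fixed cosets remain; their representatives normalize ⟨u⟩ and so preserve its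
  -- fixed points.
  have hsum : ∀ z ∈ fixedSub (ρ u), p • z = 0 →
      φ z = ∑ q with π q = q, ρ q.out (f (ρ q.out⁻¹ z)) := by
    intro z hz hpz
    refine sum_eq_sum_fixed π hπp (fun q => ρ q.out (f (ρ q.out⁻¹ z))) fun q => ?_
    have h1 : ∀ i : ℕ, ρ (π^[i] q).out (f (ρ (π^[i] q).out⁻¹ z)) =
        (ρ u ^ i) (ρ q.out (f (ρ q.out⁻¹ z))) := by
      intro i
      obtain ⟨v, hv⟩ := QuotientGroup.mk_out_eq_mul (Subgroup.zpowers u) (u ^ i * q.out)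
      have h2 : ((u ^ i * q.out : G) : G ⧸ Subgroup.zpowers u) = π^[i] q := by
        rw [hπi]
        conv_rhs => rw [← q.out_eq']
        rfl
      rw [← h2, hv, conj_apply_mul ρ _ hCG (fun v hv c _ => hfzp v hv c) (htop z) _ v.2,
        mul_inv_rev, rho_mul, rho_mul]
      have h3 : ρ (u ^ i)⁻¹ z = z :=
        apply_zpowers (Subgroup.inv_mem _ (Subgroup.pow_mem _ (Subgroup.mem_zpowers u) i)) hz
      rw [h3, map_pow]
    rw [Finset.sum_congr rfl fun i _ => h1 i]
    refine hnorm _ ?_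
    rw [← map_nsmul, hfp, map_zero]
    rw [← map_nsmul, hpz, map_zero]
  set n := (Finset.univ.filter fun q => π q = q).card with hn
  have hpn : p.Coprime n := by
    have h1 := sum_eq_sum_fixed π hπp (fun _ => (1 : ZMod p)) fun q => by simp
    rw [Finset.sum_const, Finset.sum_const, ← hn, Finset.card_univ, nsmul_one, nsmul_one,
      ← Nat.card_eq_fintype_card, ← Subgroup.index_eq_card] at h1
    rw [hp.out.coprime_iff_not_dvd, ← ZMod.natCast_eq_zero_iff, ← h1, ZMod.natCast_eq_zero_iff,
      ← hp.out.coprime_iff_not_dvd]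
    exact h.coprime
  have hstab : ∀ q, π q = q → ∀ g, g = q.out ∨ g = q.out⁻¹ → ∀ z ∈ fixedSub (ρ u),
      ρ g z ∈ fixedSub (ρ u) := by
    intro q hq g hg z hz
    have h1 : q.out⁻¹ * (u * q.out) ∈ Subgroup.zpowers u := by
      refine QuotientGroup.eq.1 ?_
      have h0 : ((q.out : G) : G ⧸ Subgroup.zpowers u) = q := q.out_eq'
      exact h0.trans (hq.symm.trans (congrArg (u • ·) h0.symm))
    have h2 : q.out ∈ Subgroup.normalizer (Subgroup.zpowers u : Set G) := by
      rw [← inv_mem_iff]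
      refine Subgroup.mem_normalizer_fintype fun v hv => ?_
      obtain ⟨n, rfl⟩ := hv
      have h3 := Subgroup.zpow_mem _ h1 n
      rwa [← mul_assoc, show q.out⁻¹ * u * q.out = q.out⁻¹ * u * q.out⁻¹⁻¹ by rw [inv_inv],
        conj_zpow] at h3
    have h3 : g⁻¹ * (u * g) ∈ Subgroup.zpowers u := by
      rcases hg with rfl | rfl
      · exact h1
      · rw [inv_inv, ← mul_assoc]
        exact (Subgroup.mem_normalizer_iff.1 h2 u).1 (Subgroup.mem_zpowers u)
    rw [mem_fixedSub, ← rho_mul]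
    conv_rhs => rw [← apply_zpowers h3 hz]
    rw [← rho_mul, mul_inv_cancel_left]
  have hφw : ∀ w ∈ fixedSub (ρ u) ⊓ movedSub (ρ u), φ w = 0 := by
    intro w hw
    rw [hsum w hw.1 (h.smul_eq_zero w hw)]
    refine Finset.sum_eq_zero fun q hq => ?_
    have hq' := (Finset.mem_filter.1 hq).2
    rw [hfS0 _ (h.map_mem _ w hw (hstab q hq' _ (Or.inr rfl) w hw.1)).2, map_zero]
  -- Modulo the fixed elements of [M,u], each of the n fixed cosets contributes y, and n is prime to
  -- p.
  have hφy : ∀ y ∈ Y, p • y = 0 → n • y - φ y ∈ fixedSub (ρ u) ⊓ movedSub (ρ u) := by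
    intro y hy hpy
    rw [hsum y (hY hy) hpy, hn, ← Finset.sum_const, ← Finset.sum_sub_distrib]
    refine AddSubgroup.sum_mem _ fun q hq => ?_
    have hq' := (Finset.mem_filter.1 hq).2
    have h1 := hstab q hq' _ (Or.inr rfl) y (hY hy)
    have h2 : ρ q.out⁻¹ y - f (ρ q.out⁻¹ y) ∈ fixedSub (ρ u) ⊓ movedSub (ρ u) :=
      ⟨AddSubgroup.sub_mem _ h1 (hY (hfY _)), hfS _⟩
    have h3 := h.map_mem q.out _ h2 (hstab q hq' _ (Or.inl rfl) _ h2.1)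
    rwa [map_sub, ← rho_mul, mul_inv_cancel, rho_one] at h3
  have hz : ∀ z ∈ fixedSub (ρ u), p • z = 0 → ∃ y ∈ Y, p • y = 0 ∧
      z - y ∈ fixedSub (ρ u) ⊓ movedSub (ρ u) ∧ φ z = φ y := by
    intro z hz hpz
    obtain ⟨y, hy, s, hs, rfl, hpy, -⟩ := hsplit z hpz
    have h1 : s ∈ fixedSub (ρ u) ⊓ movedSub (ρ u) := by
      refine ⟨?_, hs⟩
      have := AddSubgroup.sub_mem _ hz (hY hy)
      rwa [add_sub_cancel_left] at this
    refine ⟨y, hy, hpy, by rwa [add_sub_cancel_left], ?_⟩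
    rw [map_add, hφw s h1, add_zero]
  have hφp : ∀ m, p • m = 0 → p • φ m = 0 := fun m hm => by rw [← map_nsmul, hm, map_zero]
  have hφZ : ∀ z ∈ fixedSub (ρ u), φ z ∈ fixedSub (ρ u) := fun z hz => by
    rw [mem_fixedSub_iff, ← hφx, mem_fixedSub_iff.1 hz, map_zero]
  -- Each application of φ lowers the nilpotency degree: if φ^k((u−1)m) is fixed, it is also in
  -- [M,u], hence killed by φ, so φ^(k+1)(m) is fixed.
  have hiter : ∀ k : ℕ, ∀ m, p • m = 0 → ((ρ u - 1) ^ k) m ∈ fixedSub (ρ u) →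
      φ^[k] m ∈ fixedSub (ρ u) := by
    intro k
    induction k with
    | zero => exact fun m _ hm => hm
    | succ k ih =>
      intro m hm hk
      have hpx : p • (ρ u - 1) m = 0 := by rw [← map_nsmul, hm, map_zero]
      have h1 := ih ((ρ u - 1) m) hpx (by rw [pow_succ] at hk; exact hk)
      have h2 : φ^[k] ((ρ u - 1) m) = (ρ u - 1) (φ^[k] m) := by
        clear h1 ih hk
        induction k with
        | zero => rfl
        | succ k ih => rw [Function.iterate_succ_apply', ih, hφx, Function.iterate_succ_apply']
      rw [h2] at h1
      have h3 := hφw _ ⟨h1, sub_one_mem_movedSub (ρ u) _⟩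
      rw [Function.iterate_succ_apply', mem_fixedSub_iff, ← hφx, h3]
  have hiterp : ∀ m, p • m = 0 → φ^[p] m ∈ fixedSub (ρ u) := by
    intro m hm
    refine hiter p m hm ?_
    have h1 := exists_sub_one_pow_apply_eq_zero h.odd h.rho_pow_eq_one 1 (m := m) (by simpa using hm)
    rw [mul_one] at h1
    rw [h1]
    exact AddSubgroup.zero_mem _
  -- Q = φ^(p+1)(socle M) is invariant and fixed by u. If nonzero, it contains some w ≠ 0 in [M,u]
  -- with w = φ(y), y in the socle of Y; then n·y ∈ [M,u] forces y = 0 and w = 0.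
  let Q : AddSubgroup M :=
    { carrier := {w | ∃ m, p • m = 0 ∧ φ (φ^[p] m) = w}
      zero_mem' := ⟨0, smul_zero _, by rw [iterate_map_zero, map_zero]⟩
      add_mem' := by
        rintro _ _ ⟨a, ha, rfl⟩ ⟨b, hb, rfl⟩
        exact ⟨a + b, by rw [nsmul_add, ha, hb, add_zero], by rw [iterate_map_add, map_add]⟩
      neg_mem' := by
        rintro _ ⟨a, ha, rfl⟩
        exact ⟨-a, by rw [smul_neg, ha, neg_zero], by rw [iterate_map_neg, map_neg]⟩ }
  have hpiter : ∀ k : ℕ, ∀ m, p • m = 0 → p • φ^[k] m = 0 := by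
    intro k m hm
    induction k with
    | zero => exact hm
    | succ k ih => rw [Function.iterate_succ_apply']; exact hφp _ ih
  have hQbot : Q = ⊥ := by
    by_contra hne
    have hQG : ∀ g, ∀ w ∈ Q, ρ g w ∈ Q := by
      rintro g _ ⟨m, hm, rfl⟩
      refine ⟨ρ g m, by rw [← map_nsmul, hm, map_zero], ?_⟩
      have h1 : ∀ k : ℕ, φ^[k] (ρ g m) = ρ g (φ^[k] m) := fun k => by
        induction k with
        | zero => rfl
        | succ k ih => rw [Function.iterate_succ_apply', ih, hφρ, Function.iterate_succ_apply']
      rw [h1, hφρ]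
    obtain ⟨hle, -⟩ := h.invariant Q (by
      rintro _ ⟨m, hm, rfl⟩
      exact hφZ _ (hiterp m hm)) hQG hne
    obtain ⟨w, hw, hw0⟩ := h.exists_ne_zero
    obtain ⟨m, hm, hmw⟩ := hle hw
    obtain ⟨y, hy, hpy, -, hφe⟩ := hz _ (hiterp m hm) (hpiter p m hm)
    have h1 := hφy y hy hpy
    rw [← hφe, hmw] at h1
    have h2 := AddSubgroup.add_mem _ h1 hw
    rw [sub_add_cancel] at h2
    have h3 : y = 0 := nsmul_mem_iff_of_coprime ⊥ hpn hpy
      (hSY _ (Y.nsmul_mem hy n) h2.2)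
    rw [h3, map_zero, hmw] at hφe
    exact hw0 hφe
  intro y hy hpy
  have hyk : ∀ k : ℕ, n ^ k • y - φ^[k] y ∈ fixedSub (ρ u) ⊓ movedSub (ρ u) := by
    intro k
    induction k with
    | zero => 
      rw [pow_zero, one_smul]
      change y - y ∈ _
      rw [sub_self]
      exact AddSubgroup.zero_mem _
    | succ k ih =>
      have h1 : φ (φ^[k] y) = n ^ k • φ y := by
        have h2 := hφw _ ih
        rw [map_sub, map_nsmul, sub_eq_zero] at h2
        exact h2.symm
      rw [Function.iterate_succ_apply', h1, pow_succ, mul_smul, ← nsmul_sub]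
      exact AddSubgroup.nsmul_mem _ (hφy y hy hpy) _
  have h1 : φ^[p + 1] y = 0 := by
    have h2 : φ^[p + 1] y ∈ Q := ⟨y, hpy, (Function.iterate_succ_apply' φ p y).symm⟩
    rwa [hQbot] at h2
  have h2 := hyk (p + 1)
  rw [h1, sub_zero] at h2
  exact nsmul_mem_iff_of_coprime ⊥ (hpn.pow_right (p + 1)) hpy
    (hSY _ (Y.nsmul_mem hy _) h2.2)

theorem exists_pow_smul_eq [Finite G] (h : RigidAction p ρ u) (n : ℕ) (m : M) :
    ∃ a, p ^ n • a = m := by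
  induction n generalizing m with
  | zero => exact ⟨m, by simp⟩
  | succ n ih =>
    obtain ⟨a, rfl⟩ := h.divisible m
    obtain ⟨b, rfl⟩ := ih a
    exact ⟨b, by rw [pow_succ', mul_smul]⟩

/-- Here Y = p^n·Z, with Z the fixed points, and M = Y + [M,u] because M is divisible. If Y contains
Z ∩ [M,u], then Z = Y, and Y is divisible by the choice of n. -/
theorem fixedSub_divisible [Finite G] (h : RigidAction p ρ u) {r : ℕ}
    (hr : Nat.card (socle p M) = p ^ r) (hpr : p ≤ r) {n : ℕ}
    (hn : ∀ z ∈ fixedSub (ρ u), ∃ z' ∈ fixedSub (ρ u), p • p ^ n • z' = p ^ n • z) :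
    ∀ z ∈ fixedSub (ρ u), ∃ z' ∈ fixedSub (ρ u), p • z' = z := by
  let Y : AddSubgroup M := (fixedSub (ρ u)).map (nsmulAddMonoidHom (p ^ n))
  have hYZ : Y ≤ fixedSub (ρ u) := by
    rintro _ ⟨z, hz, rfl⟩
    exact AddSubgroup.nsmul_mem _ hz _
  have hdec : ∀ m : M, ∃ y ∈ Y, ∃ s ∈ movedSub (ρ u), m = y + s := by
    intro m
    obtain ⟨a, rfl⟩ := h.exists_pow_smul_eq n m
    obtain ⟨s, hs, z, hz, rfl⟩ := h.exists_eq_moved_add a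
    exact ⟨p ^ n • z, ⟨z, hz, rfl⟩, p ^ n • s, AddSubgroup.nsmul_mem _ hs _,
      by rw [nsmul_add, add_comm]⟩
  have hle : fixedSub (ρ u) ⊓ movedSub (ρ u) ≤ Y := by
    -- Otherwise Y is a complement of [M,u] without p-torsion, and the socle of M has order p^(p−1),
    -- against p ≤ r.
    by_contra hle
    have hdisj : Disjoint Y (movedSub (ρ u)) := by
      rw [AddSubgroup.disjoint_def]
      intro y hy hyS
      by_contra hy0
      exact hle (h.le_of_mem ⟨hYZ hy, hyS⟩ hy0 hy)
    have hzero := h.socle_complement_eq_zero hYZ hdisj hdec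
    have hsoc : movedSub (ρ u) ⊓ socle p M = socle p M := by
      refine inf_eq_right.2 fun m hm => ?_
      obtain ⟨y, hy, s, hs, rfl⟩ := hdec m
      rw [mem_socle, nsmul_add] at hm
      have h1 : p • y = 0 := by
        refine AddSubgroup.disjoint_def.1 hdisj (Y.nsmul_mem hy p) ?_
        rw [eq_neg_of_add_eq_zero_left hm]
        exact AddSubgroup.neg_mem _ (AddSubgroup.nsmul_mem _ hs p)
      rwa [hzero y hy h1, zero_add]
    have h1 := h.card_moved_socle
    rw [hsoc, hr] at h1
    have h2 := Nat.pow_right_injective hp.out.two_le h1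
    have h3 := hp.out.pos
    omega
  intro z hz
  have hzY : z ∈ Y := by
    obtain ⟨y, hy, s, hs, rfl⟩ := hdec z
    refine Y.add_mem hy (hle ⟨?_, hs⟩)
    have h1 := AddSubgroup.sub_mem _ hz (hYZ hy)
    rwa [add_sub_cancel_left] at h1
  obtain ⟨z₁, hz₁, rfl⟩ := hzY
  obtain ⟨z₂, hz₂, h2⟩ := hn z₁ hz₁
  exact ⟨_, AddSubgroup.nsmul_mem _ hz₂ _, h2⟩

theorem card_fixedSub_socle [Finite G] (h : RigidAction p ρ u) {r : ℕ}
    (hr : Nat.card (socle p M) = p ^ r) (hpr : p ≤ r)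
    (hdiv : ∀ z ∈ fixedSub (ρ u), ∃ z' ∈ fixedSub (ρ u), p • z' = z) :
    Nat.card (fixedSub (ρ u) ⊓ socle p M : AddSubgroup M) = p ^ (r - p + 1) := by
  have h1 := h.card_fixed_socle hdiv
  have h2 := hp.out.one_le
  rw [hr, show r = (r - p + 1) + (p - 1) by omega, pow_add] at h1
  exact (Nat.eq_of_mul_eq_mul_right (pow_pos hp.out.pos _) h1).symm

end RigidAction

/-! ### The action of `Aut_F(A)` on `A` -/

section Representation

open scoped IsMulCommutative

variable {S : Type*} [Group S]

/-- The action of `Aut_F(A)` on `A`, written additively. -/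
def autRep (F : FusionSystem S) (A : Subgroup S) [IsMulCommutative A] :
    F.aut A →* AddMonoid.End (Additive A) where
  toFun γ := MonoidHom.toAdditive γ.1.toMonoidHom
  map_one' := rfl
  map_mul' _ _ := rfl

theorem autRep_apply (F : FusionSystem S) (A : Subgroup S) [IsMulCommutative A] (γ : F.aut A)
    (m : Additive A) : autRep F A γ m = Additive.ofMul (γ.1 m.toMul) := rfl

namespace FusionSetup

theorem pow_apply_eq {F : FusionSystem S} {A : Subgroup S} {y : S} {u : F.aut A}
    (hu : ∀ a : A, (u.1 a : S) = y * a * y⁻¹) (i : ℕ) (a : A) :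
    ((u ^ i).1 a : S) = y ^ i * a * (y ^ i)⁻¹ := by
  induction i with
  | zero => simp
  | succ i ih =>
    have h1 : (u ^ (i + 1)).1 a = u.1 ((u ^ i).1 a) := by rw [pow_succ']; rfl
    rw [h1, hu, ih, pow_succ']
    group

open FusionSystem IndexPSetup

variable {p : ℕ} [hp : Fact p.Prime] {F : FusionSystem S} {A T : Subgroup S} {r : ℕ}
  [IsMulCommutative A] {y : S} {u : F.aut A}

theorem mem_fixedSub_iff (h : FusionSetup p F A T r) (hy : y ∉ A)
    (hu : ∀ a : A, (u.1 a : S) = y * a * y⁻¹) {m : Additive A} :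
    m ∈ fixedSub (autRep F A u) ↔ (m.toMul : S) ∈ Subgroup.center S := by
  rw [mem_fixedSub, autRep_apply]
  constructor
  · intro h1
    have h2 : (u.1 m.toMul : S) = m.toMul := congrArg (fun x : Additive A => (x.toMul : S)) h1
    rw [hu, mul_inv_eq_iff_eq_mul] at h2
    exact h.base.mem_center_of_comm hy m.toMul.2 h2.symm
  · intro h1
    refine congrArg Additive.ofMul (Subtype.ext ?_)
    rw [hu, Subgroup.mem_center_iff.1 h1 y, mul_inv_cancel_right]
    rfl

theorem mem_movedSub_iff (h : FusionSetup p F A T r) (hy : y ∉ A)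
    (hu : ∀ a : A, (u.1 a : S) = y * a * y⁻¹) {m : Additive A} :
    m ∈ movedSub (autRep F A u) ↔ (m.toMul : S) ∈ commSet A := by
  have key : ∀ a : A, (((autRep F A u - 1) (Additive.ofMul a⁻¹)).toMul : S) =
      a * y * (a : S)⁻¹ * y⁻¹ := by
    intro a
    have h1 : (((autRep F A u - 1) (Additive.ofMul a⁻¹)).toMul : S) =
        (u.1 a⁻¹ : S) * ((a⁻¹ : A) : S)⁻¹ := by
      rw [sub_one_apply, autRep_apply, toMul_sub]
      simp [div_eq_mul_inv]
    rw [h1, h.base.comm _ (u.1 a⁻¹).2 _ (A.inv_mem (a⁻¹).2), hu]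
    simp [mul_assoc]
  rw [h.base.mem_commSet hy]
  constructor
  · rintro ⟨b, rfl⟩
    refine ⟨(b.toMul⁻¹ : A), Subtype.mem _, ?_⟩
    rw [← key, inv_inv]
    rfl
  · rintro ⟨a, ha, ham⟩
    exact ⟨Additive.ofMul (⟨a, ha⟩ : A)⁻¹, congrArg Additive.ofMul
      (Subtype.ext ((key ⟨a, ha⟩).trans ham))⟩

theorem mem_centerComm_iff (h : FusionSetup p F A T r) (hy : y ∉ A)
    (hu : ∀ a : A, (u.1 a : S) = y * a * y⁻¹) {m : Additive A} :
    m ∈ fixedSub (autRep F A u) ⊓ movedSub (autRep F A u) ↔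
      (m.toMul : S) ∈ centerComm A h.base := by
  rw [AddSubgroup.mem_inf, h.mem_fixedSub_iff hy hu, h.mem_movedSub_iff hy hu,
    h.base.mem_centerComm, and_comm]

theorem zpowers_eq (h : FusionSetup p F A T r) (hy : y ∉ A)
    (hu : ∀ a : A, (u.1 a : S) = y * a * y⁻¹) :
    Subgroup.zpowers u = (autS A).subgroupOf (F.aut A) := by
  have hn := h.base.normal
  refine le_antisymm ?_ fun α hα => ?_
  · rw [Subgroup.zpowers_le, Subgroup.mem_subgroupOf]
    exact mem_autS.2 ⟨y, by rw [Subgroup.normalizer_eq_top_iff.2 hn]; trivial, hu⟩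
  · rw [Subgroup.mem_subgroupOf] at hα
    obtain ⟨s, -, hs⟩ := mem_autS.1 hα
    obtain ⟨a, ha, i, rfl⟩ := h.base.exists_mul_pow hy s
    refine ⟨i, Subtype.ext (MulEquiv.ext fun b => Subtype.ext ?_)⟩
    have h1 := h.base.comm a ha _ (h.base.conj_mem b.2 (y ^ i))
    change ((u ^ (i : ℤ)).1 b : S) = _
    rw [zpow_natCast, pow_apply_eq hu, hs]
    calc y ^ i * b * (y ^ i)⁻¹ = y ^ i * b * (y ^ i)⁻¹ * a * a⁻¹ := by group
      _ = _ := by rw [← h1]; group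

/-- All fusion-theoretic input of the module argument is gathered here: fixed points of u correspond
to Z(S), [M,u] to [A,S], and T is the noncentral divisible submodule. -/
theorem rigidAction (h : FusionSetup p F A T r) (hy : y ∉ A)
    (hu : ∀ a : A, (u.1 a : S) = y * a * y⁻¹) : RigidAction p (autRep F A) u where
  odd := h.odd
  torsion m := by
    obtain ⟨n, hn⟩ := h.base.pair.isPGroup m.toMul
    exact ⟨n, congrArg Additive.ofMul (Subtype.ext hn : m.toMul ^ p ^ n = 1)⟩
  pow_eq_one := by
    refine Subtype.ext (MulEquiv.ext fun a => Subtype.ext ?_)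
    rw [pow_apply_eq hu, h.base.comm _ (h.base.pow_mem y) _ a.2, mul_inv_cancel_right]
    rfl
  coprime := by
    obtain ⟨hfin, Y, hY⟩ := h.exists_sylow_aut
    rw [h.zpowers_eq hy hu, ← hY, hp.out.coprime_iff_not_dvd]
    exact Y.not_dvd_index
  cyclic w hw hw0 w' hw' := by
    rw [h.mem_centerComm_iff hy hu] at hw hw'
    obtain ⟨i, hi⟩ := h.centerCommCyclic _ hw
      (fun h1 => hw0 (congrArg Additive.ofMul (Subtype.ext h1 : w.toMul = 1))) _ hw'
    exact ⟨i, congrArg Additive.ofMul (Subtype.ext hi : w'.toMul = w.toMul ^ i)⟩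
  exists_ne_zero := by
    obtain ⟨w, hw, hw1⟩ := h.base.exists_mem_centerComm_ne_one h.odd
    refine ⟨Additive.ofMul ⟨w, h.base.center_le hw.2⟩, (h.mem_centerComm_iff hy hu).2 hw, ?_⟩
    exact fun h0 => hw1 (congrArg (fun x : Additive A => (x.toMul : S)) h0)
  smul_eq_zero w hw := by
    rw [h.mem_centerComm_iff hy hu] at hw
    exact congrArg Additive.ofMul
      (Subtype.ext (h.base.pow_eq_one_of_mem_centerComm hw) : w.toMul ^ p = 1)
  map_mem γ w hw hγ := by
    rw [h.mem_centerComm_iff hy hu] at hw ⊢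
    rw [h.mem_fixedSub_iff hy hu] at hγ
    obtain ⟨g, hg, hgγ⟩ := exists_iso_of_mem_aut γ.2
    have h1 := hgγ w.toMul
    change (γ.1 w.toMul : S) ∈ _ at hγ
    change (γ.1 w.toMul : S) ∈ _
    rw [← h1] at hγ ⊢
    exact h.map_mem_centerComm hg.1 hw hγ
  invariant Q hQ hQG hne := by
    let Q' : Subgroup S :=
      { carrier := {s | ∃ m ∈ Q, (m.toMul : S) = s}
        one_mem' := ⟨0, Q.zero_mem, rfl⟩
        mul_mem' := by
          rintro _ _ ⟨a, ha, rfl⟩ ⟨b, hb, rfl⟩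
          exact ⟨a + b, Q.add_mem ha hb, rfl⟩
        inv_mem' := by
          rintro _ ⟨a, ha, rfl⟩
          exact ⟨-a, Q.neg_mem ha, rfl⟩ }
    have hQ' : CentralInvariant F A Q' := by
      constructor
      · rintro _ ⟨m, hm, rfl⟩
        exact (h.mem_fixedSub_iff hy hu).1 (hQ hm)
      · rintro g hg _ ⟨m, hm, rfl⟩
        obtain ⟨γ, hγ, hγg⟩ := (h.iso_of_mor hg).exists_mem_aut
        exact ⟨autRep F A ⟨γ, hγ⟩ m, hQG _ m hm, hγg m.toMul⟩
    have hne' : Q' ≠ ⊥ := by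
      intro hbot
      refine hne ((AddSubgroup.eq_bot_iff_forall Q).2 fun m hm => ?_)
      have h1 : (m.toMul : S) ∈ Q' := ⟨m, hm, rfl⟩
      rw [hbot, Subgroup.mem_bot] at h1
      exact congrArg Additive.ofMul (Subtype.ext h1 : m.toMul = 1)
    obtain ⟨hle, Z₁, hZ₁, hdisj, hdec⟩ := h.centerComm_le hQ' hne'
    refine ⟨fun w hw => ?_,
      { carrier := {m | (m.toMul : S) ∈ Z₁}
        zero_mem' := Z₁.one_mem
        add_mem' := fun ha hb => Z₁.mul_mem ha hb
        neg_mem' := fun ha => Z₁.inv_mem ha }, ?_, ?_, fun z hz => ?_⟩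
    · obtain ⟨m, hm, hmw⟩ := hle ((h.mem_centerComm_iff hy hu).1 hw)
      have hmw' : m = w := congrArg Additive.ofMul (Subtype.ext hmw : m.toMul = w.toMul)
      exact hmw' ▸ hm
    · exact fun m hm => (h.mem_fixedSub_iff hy hu).2 (hZ₁ hm)
    · rw [AddSubgroup.disjoint_def]
      intro m hm hm'
      have h1 := Subgroup.disjoint_def.1 hdisj ((h.mem_centerComm_iff hy hu).1 hm) hm'
      exact congrArg Additive.ofMul (Subtype.ext h1 : m.toMul = 1)
    · obtain ⟨w, hw, z₁, hz₁, hwz⟩ := hdec _ ((h.mem_fixedSub_iff hy hu).1 hz)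
      exact ⟨Additive.ofMul ⟨w, h.base.center_le hw.2⟩, (h.mem_centerComm_iff hy hu).2 hw,
        Additive.ofMul ⟨z₁, h.base.center_le (hZ₁ hz₁)⟩, hz₁,
        congrArg Additive.ofMul (Subtype.ext hwz : z.toMul = (⟨w, _⟩ * ⟨z₁, _⟩ : A))⟩
  exists_divisible := by
    have hT := h.base.pair.normal
    refine ⟨{ carrier := {m | (m.toMul : S) ∈ T}
              zero_mem' := T.one_mem
              add_mem' := fun ha hb => T.mul_mem ha hb
              neg_mem' := fun ha => T.inv_mem ha }, fun d hd => ?_, fun d hd => ?_, fun hle => ?_⟩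
    · change (u.1 d.toMul : S) ∈ T
      rw [hu]
      exact hT.conj_mem _ hd y
    · obtain ⟨e, he, hed⟩ := h.base.pair.torus.pDivisible _ hd
      exact ⟨Additive.ofMul ⟨e, h.base.torus_le he⟩, he,
        congrArg Additive.ofMul (Subtype.ext hed : (⟨e, _⟩ : A) ^ p = d.toMul)⟩
    · refine h.noncentral fun t ht => ?_
      exact (h.mem_fixedSub_iff hy hu).1
        (hle (show Additive.ofMul (⟨t, h.base.torus_le ht⟩ : A) ∈ _ from ht))

theorem exists_rigidAction (h : FusionSetup p F A T r) : ∃ y u, y ∉ A ∧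
    (∀ a : A, ((u : F.aut A).1 a : S) = y * a * y⁻¹) ∧ RigidAction p (autRep F A) u := by
  obtain ⟨y, hy⟩ := h.base.exists_notMem
  have hn := h.base.normal
  let σ : MulAut A := A.normalizerMonoidHom
    ⟨y, by rw [Subgroup.normalizer_eq_top_iff.2 hn]; trivial⟩
  let u : F.aut A := ⟨σ, autS_le_aut A ⟨_, rfl⟩⟩
  have hu : ∀ a : A, (u.1 a : S) = y * a * y⁻¹ := fun a => rfl
  exact ⟨y, u, hy, hu, h.rigidAction hy hu⟩

/-- A is divisible, so it lies in the maximal torus T. -/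
theorem isDiscreteTorusOfRank (h : FusionSetup p F A T r) : IsDiscreteTorusOfRank p r A := by
  obtain ⟨y, u, hy, hu, hR⟩ := h.exists_rigidAction
  have hfin := h.exists_sylow_aut.1
  have hAT : A = T := by
    refine le_antisymm (h.base.pair.le_of_pDivisible fun a ha => ?_) h.base.torus_le
    obtain ⟨b, hb⟩ := hR.divisible (Additive.ofMul (⟨a, ha⟩ : A))
    exact ⟨_, b.toMul.2, congrArg (fun x : Additive A => (x.toMul : S)) hb⟩
  rw [hAT]
  exact h.base.pair.torus

theorem isDiscreteTorusOfRank_center (h : FusionSetup p F A T r) (hpr : p ≤ r) :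
    IsDiscreteTorusOfRank p (r - p + 1) (Subgroup.center S) := by
  obtain ⟨y, u, hy, hu, hR⟩ := h.exists_rigidAction
  have hfin := h.exists_sylow_aut.1
  have hmem := fun m => h.mem_fixedSub_iff hy hu (m := m)
  have hZp : IsPGroup p (Subgroup.center S) := h.base.pair.isPGroup.to_subgroup _
  have hZfin : Finite {x : Subgroup.center S // x ^ p = 1} := by
    have h1 := h.base.pair.finite_torsion_of_comm (K := Subgroup.center S)
      (fun x _ x' hx' => Subgroup.mem_center_iff.1 hx' x) 1
    have : Finite {x : S // x ∈ Subgroup.center S ∧ x ^ p ^ 1 = 1} := h1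
    refine Finite.of_injective (β := {x : S // x ∈ Subgroup.center S ∧ x ^ p ^ 1 = 1})
      (fun x => ⟨x.1, x.1.2, by rw [pow_one]; exact congrArg Subtype.val x.2⟩) ?_
    exact fun a b hab => Subtype.ext (Subtype.ext (congrArg (fun z => z.1) hab))
  have hsoc : Nat.card (socle p (Additive A)) = p ^ r := by
    rw [← h.isDiscreteTorusOfRank.card_socle]
    exact Nat.card_congr
      { toFun := fun m => ⟨m.1.toMul, m.2⟩
        invFun := fun a => ⟨Additive.ofMul a.1, a.2⟩
        left_inv := fun _ => rfl
        right_inv := fun _ => rfl }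
  obtain ⟨n, hn⟩ := exists_divisible_range hZp hZfin
  have hdiv := hR.fixedSub_divisible hsoc hpr (n := n) fun z hz => by
    obtain ⟨z', hz'⟩ := hn ⟨_, (hmem z).1 hz⟩
    have hz'S := congrArg Subtype.val hz'
    refine ⟨Additive.ofMul ⟨z', h.base.center_le z'.2⟩, (hmem _).2 z'.2, ?_⟩
    exact congrArg Additive.ofMul (Subtype.ext hz'S :
      ((⟨z', h.base.center_le z'.2⟩ : A) ^ p ^ n) ^ p = z.toMul ^ p ^ n)
  have hcard := hR.card_fixedSub_socle hsoc hpr hdiv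
  refine isDiscreteTorusOfRank_of_divisible hZp (fun z => ?_) ?_
  · obtain ⟨z', hz', hzz⟩ := hdiv (Additive.ofMul ⟨z, h.base.center_le z.2⟩) ((hmem _).2 z.2)
    exact ⟨⟨_, (hmem z').1 hz'⟩,
      Subtype.ext (congrArg (fun x : Additive A => (x.toMul : S)) hzz)⟩
  · rw [← hcard]
    exact Nat.card_congr
      { toFun := fun z => ⟨Additive.ofMul ⟨z.1, h.base.center_le z.1.2⟩, (hmem _).2 z.1.2,
          congrArg Additive.ofMul (Subtype.ext (by have e := congrArg Subtype.val z.2; exact e) :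
            (⟨z.1, h.base.center_le z.1.2⟩ : A) ^ p = 1)⟩
        invFun := fun m => ⟨⟨m.1.toMul, (hmem m.1).1 m.2.1⟩,
          Subtype.ext (congrArg (fun x : Additive A => (x.toMul : S)) m.2.2)⟩
        left_inv := fun _ => rfl
        right_inv := fun _ => rfl }

end FusionSetup

end Representation

theorem Subgroup.normal_of_unique {S : Type*} [Group S] {A : Subgroup S} {n : ℕ}
    (hab : IsMulCommutative A) (hindex : A.index = n)
    (huniq : ∀ B : Subgroup S, IsMulCommutative B → B.index = n → B = A) : A.Normal := by
  constructor
  intro a ha g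
  have h1 := huniq (A.map (MulAut.conj g).toMonoidHom) inferInstance
    ((Subgroup.index_map_equiv A (MulAut.conj g)).trans hindex)
  rw [← h1]
  exact ⟨a, ha, rfl⟩

theorem proposition5p7 (p : ℕ) [Fact p.Prime] (hp : Odd p)
    {S : Type*} [Group S] (hS : IsDiscreteToral p S)
    (hnonab : ¬ ∀ x y : S, x * y = y * x)
    (A : Subgroup S) (hAab : IsMulCommutative A) (hAindex : A.index = p)
    (hAuniq : ∀ B : Subgroup S, IsMulCommutative B → B.index = p → B = A)
    (F : FusionSystem S) (hF : F.IsSaturated p)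
    (hAinf : Infinite A) (hOp : F.Op = ⊥) :
    IsDiscreteTorus p A ∧
      ∀ r : ℕ, IsDiscreteTorusOfRank p r A → p ≤ r →
        IsDiscreteTorusOfRank p (r - p + 1) (Subgroup.center S) := by
  obtain ⟨T, hTn, ⟨r, hTr⟩, hTi⟩ := hS
  have hpair : IsToralPair p T r := ⟨hTn, hTr, hTi⟩
  have hbase : IndexPSetup p A T r :=
    { pair := hpair
      comm := fun a ha b hb => congrArg Subtype.val (hAab.is_comm.comm ⟨a, ha⟩ ⟨b, hb⟩)
      normal := Subgroup.normal_of_unique hAab hAindex hAuniq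
      index := hAindex
      nonab := hnonab }
  have hbot : ∀ P, F.IsNormal P → P = ⊥ := fun P hP =>
    le_bot_iff.1 (hOp ▸ (le_sSup hP : P ≤ F.Op))
  have h : FusionSetup p F A T r :=
    { base := hbase
      -- A central T is normal in F, hence trivial; having finite index, it makes S finite, against
      -- the infinitude of A.
      noncentral := fun hT => by
        have h1 := hbot T (hF.isNormal_torus_of_le_center hpair hT)
        have h2 := hpair.index_ne_zero
        rw [h1, Subgroup.index_bot] at h2
        have : Finite S := Nat.finite_of_card_ne_zero h2
        exact not_finite A
      saturated := hF
      odd := hp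
      eq_bot_of_isNormal := hbot }
  have hA := h.isDiscreteTorusOfRank
  refine ⟨⟨r, hA⟩, fun r' hr' hpr => ?_⟩
  obtain rfl := rank_unique hA hr'
  exact h.isDiscreteTorusOfRank_center hpr
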